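/- Let $n\ge 1$, $\mathbb{R}^n_+=\{x\in\mathbb{R}^n: x_i>0,\ i=1,\dots,n\}$, $a=(a_1,\dots,a_n)$ with all $a_i>0$, $|a|=\sum_i a_i$, $x^a=\prod_i x_i^{a_i}$, and let $L^p_a=L^p(\mathbb{R}^n_+,x^a\,dx)$ (real-valued functions) with norm $\|\cdot\|_{p,a}$. Let $\mathcal{S}_e$ be the set of real Schwartz functions $\varphi$ on $\mathbb{R}^n$ with $\partial^{2m+1}\varphi/\partial x_i^{2m+1}=0$ on $\{x_i=0\}$ for all $m\ge 0$ and $1\le i\le n$, regarded as functions on $\mathbb{R}^n_+$, and let $\Delta_a=\sum_{i=1}^n\left(\frac{\partial^2}{\partial x_i^2}+\frac{a_i}{x_i}\frac{\partial}{\partial x_i}\right)$. For $f\in L^p_a$ we say that $\Delta_a f\in L^p_a$ if there is $g\in L^p_a$ (then unique, and denoted by $\Delta_a f$) with $$\int_{\mathbb{R}^n_+} g\,\varphi\, x^a\,dx=\int_{\mathbb{R}^n_+} f\,\Delta_a\varphi\, x^a\,dx\qquad\text{for all }\varphi\in\mathcal{S}_e .$$ For $1\le p<\infty$ let $$W^{1,p}_{\Delta_a}(\mathbb{R}^n_+)=\{f\in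 L^p_a:\Delta_a f\in L^p_a\},\qquad \|f\|_{W^{1,p}_{\Delta_a}}=\left(\|f\|_{p,a}^p+\|\Delta_a f\|_{p,a}^p\right)^{1/p}.$$ The Bessel translation is $$T^t_af(x)=\prod_{i=1}^n\frac{\Gamma\left(\frac{a_i+1}{2}\right)}{\sqrt{\pi}\,\Gamma\left(\frac{a_i}{2}\right)}\int_{(0,\pi)^n} f\left(\left(\sqrt{x_i^2+t_i^2-2x_it_i\cos\vartheta_i}\right)_{i=1}^n\right)\prod_{i=1}^n(\sin\vartheta_i)^{a_i-1}\,d\vartheta ,$$ and, with $S_+=\{\Theta\in\mathbb{R}^n_+:|\Theta|=1\}$ and its surface measure $dS$ (the unit point mass at $1$ if $n=1$), the spherical difference is $$\Delta_{sph,t,a}f(x)=\frac{1}{\int_{S_+}\Theta^a\,dS(\Theta)}\int_{S_+}\left(f(x)-T_a^{t\Theta}f(x)\right)\Theta^a\,dS(\Theta),\qquad t>0 .$$ For $0<s<2$ let $$[f]_{sph,s,p,a}=\left(\int_0^\infty\left(\frac{\|\Delta_{sph,t,a}f\|_{p,a}}{t^s}\right)^p\frac{dt}{t}\right)^{1/p},\qquad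 \|f\|_{W^{s/2,p}_{\Delta_a}}=\left(\|f\|_{p,a}^p+[f]_{sph,s,p,a}^p\right)^{1/p},$$ and $W^{s/2,p}_{\Delta_a}(\mathbb{R}^n_+)=\{f\in L^p_a:\|f\|_{W^{s/2,p}_{\Delta_a}}<\infty\}$. **Theorem.** Let $0<\frac s2<1$ and $1\le p<\infty$. Then $\mathcal{S}_e$ is contained in $W^{1,p}_{\Delta_a}(\mathbb{R}^n_+)$ and dense in it with respect to $\|\cdot\|_{W^{1,p}_{\Delta_a}}$, and $\mathcal{S}_e$ is contained in $W^{s/2,p}_{\Delta_a}(\mathbb{R}^n_+)$ and dense in it with respect to $\|\cdot\|_{W^{s/2,p}_{\Delta_a}}$. -/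

import Mathlib

open MeasureTheory Set
open scoped NNReal ENNReal SchwartzMap

noncomputable section

namespace BesselSobolev

/-- The space `ℝⁿ` with its Euclidean norm. -/
abbrev Space (n : ℕ) : Type := EuclideanSpace ℝ (Fin n)

/-- The open orthant `ℝⁿ₊ = {x : xᵢ > 0 for all i}`. -/
def orthant (n : ℕ) : Set (Space n) := {x | ∀ i, 0 < x i}

/-- The weight `x ^ a = ∏ xᵢ ^ aᵢ`. -/
def weight {n : ℕ} (a : Fin n → ℝ) (x : Space n) : ℝ := ∏ i, x i ^ a i

/-- The measure `x ^ a dx` on the open orthant. The space `L^p_a` consists of the functions `f` with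
`MemLp f p (wMeasure a)`; only the values of `f` on the orthant matter. -/
def wMeasure {n : ℕ} (a : Fin n → ℝ) : Measure (Space n) :=
  (volume.restrict (orthant n)).withDensity fun x => ENNReal.ofReal (weight a x)

/-- The even Schwartz class: the Schwartz functions all of whose odd order pure partial derivatives
`∂^(2m+1) f / ∂xᵢ^(2m+1)` vanish on the hyperplane `xᵢ = 0`. -/
def evenSchwartz (n : ℕ) : Set 𝓢(Space n, ℝ) :=
  {f | ∀ (m : ℕ) (i : Fin n) (x : Space n), x i = 0 →
    iteratedFDeriv ℝ (2 * m + 1) f x (fun _ => EuclideanSpace.single i 1) = 0}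

/-- The Bessel-Laplace operator `Δ_a φ = ∑ᵢ (∂ᵢ² φ + (aᵢ / xᵢ) ∂ᵢ φ)` on smooth functions,
used at the points of the open orthant. -/
def besselLaplace {n : ℕ} (a : Fin n → ℝ) (φ : Space n → ℝ) (x : Space n) : ℝ :=
  ∑ i, (iteratedFDeriv ℝ 2 φ x (fun _ => EuclideanSpace.single i 1)
    + a i / x i * fderiv ℝ φ x (EuclideanSpace.single i 1))

/-- `g ∈ L^p_a` is `Δ_a f` in the sense of distributions on the even Schwartz class:
`⟨g, φ⟩_a = ⟨f, Δ_a φ⟩_a` for every even Schwartz function `φ`. For `f ∈ L^p_a` such a `g` is unique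
up to equality almost everywhere, and both integrals converge. -/
def IsBesselLaplace {n : ℕ} (a : Fin n → ℝ) (p : ℝ≥0) (f g : Space n → ℝ) : Prop :=
  MemLp g p (wMeasure a) ∧
    ∀ φ ∈ evenSchwartz n,
      ∫ x, g x * φ x ∂(wMeasure a) = ∫ x, f x * besselLaplace a φ x ∂(wMeasure a)

/-- The Bessel-Sobolev space `W^{1,p}_{Δ_a}`: both `f` and `Δ_a f` belong to `L^p_a`. -/
def sobolev {n : ℕ} (a : Fin n → ℝ) (p : ℝ≥0) : Set (Space n → ℝ) :=
  {f | MemLp f p (wMeasure a) ∧ ∃ g, IsBesselLaplace a p f g}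

/-- The norm `(‖f‖_{p,a}^p + ‖Δ_a f‖_{p,a}^p)^{1/p}` of `W^{1,p}_{Δ_a}`. Since `Δ_a f` is unique almost
everywhere, the infimum runs over the representatives of one class and all of them give the same
value; it is `∞` if `Δ_a f` does not belong to `L^p_a`. -/
def sobolevNorm {n : ℕ} (a : Fin n → ℝ) (p : ℝ≥0) (f : Space n → ℝ) : ℝ≥0∞ :=
  ⨅ (g : Space n → ℝ) (_ : IsBesselLaplace a p f g),
    (eLpNorm f p (wMeasure a) ^ (p : ℝ) + eLpNorm g p (wMeasure a) ^ (p : ℝ)) ^ (1 / (p : ℝ))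

/-- The constant `Γ(αᵢ + 1) / (√π Γ(αᵢ + 1/2))` with `aᵢ = 2 αᵢ + 1`, as a function of `aᵢ`. -/
def translationConst (b : ℝ) : ℝ :=
  Real.Gamma ((b + 1) / 2) / (Real.sqrt Real.pi * Real.Gamma (b / 2))

/-- The Bessel translation `T_a^t f (x)`, the composition of the one-dimensional translations
in the variables `x₁, …, xₙ`, written as one integral over the angles `ϑ ∈ (0, π)ⁿ`
(note `2 αᵢ = aᵢ - 1`). -/
def translation {n : ℕ} (a : Fin n → ℝ) (t : Space n) (f : Space n → ℝ) (x : Space n) : ℝ :=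
  (∏ i, translationConst (a i)) *
    ∫ ϑ in Set.univ.pi fun _ : Fin n => Ioo (0 : ℝ) Real.pi,
      f (WithLp.toLp 2 fun i =>
          Real.sqrt (x i ^ 2 + t i ^ 2 - 2 * x i * t i * Real.cos (ϑ i))) *
        ∏ i, Real.sin (ϑ i) ^ (a i - 1)

/-- The surface measure `dS` on the part of the unit sphere in the open orthant. -/
def sphereMeasure (n : ℕ) : Measure (Metric.sphere (0 : Space n) 1) :=
  ((volume : Measure (Space n)).toSphere).restrict {Θ | (Θ : Space n) ∈ orthant n}

/-- The weighted area `∫ Θ ^ a dS(Θ)` of the positive part of the unit sphere. -/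
def sphereArea {n : ℕ} (a : Fin n → ℝ) : ℝ :=
  ∫ Θ, weight a (Θ : Space n) ∂(sphereMeasure n)

/-- The spherical difference `Δ_{sph,r,a} f`. -/
def sphericalDiff {n : ℕ} (a : Fin n → ℝ) (r : ℝ) (f : Space n → ℝ) (x : Space n) : ℝ :=
  1 / sphereArea a *
    ∫ Θ, (f x - translation a (r • (Θ : Space n)) f x) * weight a (Θ : Space n) ∂(sphereMeasure n)

/-- The spherical Gagliardo seminorm
`[f]_{sph,s,p,a} = (∫₀^∞ (‖Δ_{sph,t,a} f‖_{p,a} / t^s)^p dt/t)^{1/p}`. -/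
def gagliardo {n : ℕ} (a : Fin n → ℝ) (s : ℝ) (p : ℝ≥0) (f : Space n → ℝ) : ℝ≥0∞ :=
  (∫⁻ t in Ioi (0 : ℝ),
    (eLpNorm (sphericalDiff a t f) p (wMeasure a) / ENNReal.ofReal (t ^ s)) ^ (p : ℝ)
      / ENNReal.ofReal t) ^ (1 / (p : ℝ))

/-- The norm `(‖f‖_{p,a}^p + [f]_{sph,s,p,a}^p)^{1/p}` of `W^{s/2,p}_{Δ_a}`. -/
def fracNorm {n : ℕ} (a : Fin n → ℝ) (s : ℝ) (p : ℝ≥0) (f : Space n → ℝ) : ℝ≥0∞ :=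
  (eLpNorm f p (wMeasure a) ^ (p : ℝ) + gagliardo a s p f ^ (p : ℝ)) ^ (1 / (p : ℝ))

/-- The fractional Bessel-Sobolev space `W^{s/2,p}_{Δ_a}`. -/
def fracSobolev {n : ℕ} (a : Fin n → ℝ) (s : ℝ) (p : ℝ≥0) : Set (Space n → ℝ) :=
  {f | MemLp f p (wMeasure a) ∧ fracNorm a s p f < ∞}

end BesselSobolev

end

/-!
The proof follows the classical scheme of mollification, with the Bessel convolution in the role of
the ordinary one. Everything is expressed through the *chords*
`√(xᵢ² + tᵢ² - 2 xᵢ tᵢ cos θᵢ)`: the Bessel translation `T^t f (x)` is the mean of `f` over the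
points `move x t θ` with these coordinates, the angles `θ` being distributed according to a
probability measure on `(0, π)ⁿ` (`translation_eq`). Two facts about one chord carry the theory.

* Reversibility (`lintegral_chord_swap`, `lintegral_move_swap`): starting from the law `x ^ a dx`,
  the pair of the initial and the translated point is exchangeable. In polar coordinates of a
  half-plane with the measure `v ^ (b - 1) du dv`, a one-dimensional translation by `t` becomes the
  shift `u ↦ u - t`, and the reflection `u ↦ t - u` exchanges the distances to `(0, 0)` and `(t, 0)`.
* Commutativity (`map_chord_chord_comm`, `law_comm`): the even moments of the chord are, up to
  normalization, the Taylor coefficients of a product of two Bessel functions, one depending on `x`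
  and one on `t` (`besselCoeff_mul_chordMoment`). Hence the moments of a point translated twice are
  symmetric in the two translations, and a law on a bounded interval is determined by its moments.

Reversibility makes averages of translations contractions of `L^p_a` up to the mass of the averaging
measure, which yields Young's inequality for the Bessel convolution (`eLpNorm_conv_le`) and the
convergence of averages which concentrate at the origin (`tendsto_eLpNorm_sub_avg`). Commutativity
makes averages commute with each other, with convolutions, and so with spherical differences
(`sdiff_avg`, `sdiff_conv`).

The mollifiers are the normalized Gaussians `η`. At the chord points a Gaussian is a damped ordinary
translate of itself, hence the Bessel translates of `η` and its convolutions with compactly supported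
continuous functions are superpositions of translates of a Schwartz function; they are invariant
under the coordinate reflections, and therefore lie in `S_e` (`exists_evenSchwartz_conv`). An
integration by parts in the angle shows `Δ_a T^t η = T^t Δ_a η`
(`besselLaplace_translation_gaussian`).

*Inclusions.* For `φ ∈ S_e` the quotients `∂ᵢφ / xᵢ` decay rapidly, so `Δ_a φ` does, and integration
by parts against `x ^ a` identifies it with the weak Bessel-Laplacian (`integral_besselLaplace_mul`).
The mean chord differs from `xᵢ` by at most `tᵢ² / xᵢ`; with the second order Taylor expansion this
gives `‖Δ_{sph,r,a} φ‖_{p,a} ≤ K min (1, r²)` (`exists_eLpNorm_sphericalDiff_le`), and the seminorm is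
finite because `0 < s < 2`.

*Density.* Given `f`, first a mollifier `η` is fixed, then a compactly supported continuous `k` close
to `f` in `L^p_a`; the approximation is `k * η`. In `W^{1,p}`, the translates of `η` being test
functions, `(Δ_a f) * η = f * Δ_a η` (`conv_mollifier_eq`), so that `Δ_a (k * η) = k * Δ_a η` differs
from `(Δ_a f) * η` by `(f - k) * Δ_a η`, which is small since `Δ_a η ∈ L^1_a`. In the fractional
space, with `D_r = Δ_{sph,r,a}`,
`D_r (f - k * η) = (D_r f - (D_r f) * η) + (f - k) * D_r η`. The second term is at most
`K min (1, r²) ‖f - k‖_{p,a}`. For the first term the norm tends to zero for each `r` and is bounded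
by `2 ‖D_r f‖_{p,a}`, so that the Gagliardo integrals tend to zero by dominated convergence
(`tendsto_lintegral_radialTerm_sub_avg`).
-/

noncomputable section

namespace BesselSobolev

section

/-! ### The one-dimensional Bessel translation: angles and chords -/

/-- The law of the angle in the one-dimensional Bessel translation: the probability measure on
`(0, π)` with density proportional to `sin ^ (b - 1)`. -/
def angleMeasure (b : ℝ) : Measure ℝ :=
  (volume.restrict (Ioo 0 Real.pi)).withDensity
    fun θ => ENNReal.ofReal (translationConst b * Real.sin θ ^ (b - 1))

/-- The measure `r ^ b dr` on the open half-line. -/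
def halfLineMeasure (b : ℝ) : Measure ℝ :=
  (volume.restrict (Ioi 0)).withDensity fun r => ENNReal.ofReal (r ^ b)

/-- The third side of a triangle with sides `x`, `t` enclosing the angle `θ`. -/
def chord (x t θ : ℝ) : ℝ := Real.sqrt (x ^ 2 + t ^ 2 - 2 * x * t * Real.cos θ)

@[fun_prop]
lemma continuous_chord : Continuous fun z : ℝ × ℝ × ℝ => chord z.1 z.2.1 z.2.2 := by
  unfold chord; fun_prop

lemma chord_nonneg (x t θ : ℝ) : 0 ≤ chord x t θ := Real.sqrt_nonneg _

lemma chord_comm (x t θ : ℝ) : chord x t θ = chord t x θ := by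
  unfold chord; congr 1; ring

lemma chord_eq (x t θ : ℝ) :
    chord x t θ = Real.sqrt ((x * Real.cos θ - t) ^ 2 + (x * Real.sin θ) ^ 2) := by
  unfold chord; congr 1
  linear_combination (x ^ 2) * (-(Real.sin_sq_add_cos_sq θ))

lemma chord_sq (x t θ : ℝ) :
    chord x t θ ^ 2 = x ^ 2 + t ^ 2 - 2 * x * t * Real.cos θ := by
  have h : 0 ≤ x ^ 2 + t ^ 2 - 2 * x * t * Real.cos θ := by
    have : x ^ 2 + t ^ 2 - 2 * x * t * Real.cos θ =
      (x * Real.cos θ - t) ^ 2 + (x * Real.sin θ) ^ 2 := by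
        linear_combination (x ^ 2) * (-(Real.sin_sq_add_cos_sq θ))
    rw [this]; positivity
  unfold chord; rw [Real.sq_sqrt h]

lemma translationConst_pos {b : ℝ} (hb : 0 < b) : 0 < translationConst b := by
  unfold translationConst
  have := Real.Gamma_pos_of_pos (show 0 < (b + 1) / 2 by linarith)
  have := Real.Gamma_pos_of_pos (show 0 < b / 2 by linarith)
  have := Real.pi_pos
  positivity

lemma lintegral_angleMeasure {b : ℝ} (F : ℝ → ℝ≥0∞) (hF : Measurable F) :
    ∫⁻ θ, F θ ∂(angleMeasure b) = ∫⁻ θ in Ioo 0 Real.pi,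
      ENNReal.ofReal (translationConst b * Real.sin θ ^ (b - 1)) * F θ := by
  unfold angleMeasure
  rw [lintegral_withDensity_eq_lintegral_mul _ (by fun_prop) hF]
  rfl

lemma lintegral_halfLineMeasure {b : ℝ} (F : ℝ → ℝ≥0∞) (hF : Measurable F) :
    ∫⁻ r, F r ∂(halfLineMeasure b) = ∫⁻ r in Ioi 0, ENNReal.ofReal (r ^ b) * F r := by
  unfold halfLineMeasure
  rw [lintegral_withDensity_eq_lintegral_mul _ (by fun_prop) hF]
  rfl

instance (b : ℝ) : SFinite (halfLineMeasure b) := by unfold halfLineMeasure; infer_instance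
instance (b : ℝ) : SFinite (angleMeasure b) := by unfold angleMeasure; infer_instance

/-- Polar coordinates in the upper half-plane with the measure `v ^ (b - 1) du dv`. -/
lemma lintegral_halfPlane_polar (b : ℝ) (F : ℝ × ℝ → ℝ≥0∞) (hF : Measurable F) :
    ∫⁻ z, F z ∂((volume : Measure ℝ).prod (halfLineMeasure (b - 1))) =
      ∫⁻ r in Ioi 0, ∫⁻ θ in Ioo 0 Real.pi,
        ENNReal.ofReal (r ^ b) * (ENNReal.ofReal (Real.sin θ ^ (b - 1)) *
          F (r * Real.cos θ, r * Real.sin θ)) := by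
  unfold halfLineMeasure
  have h1 : Measurable fun z : ℝ × ℝ => ENNReal.ofReal (z.2 ^ (b - 1)) := by fun_prop
  rw [prod_withDensity_right (by fun_prop), lintegral_withDensity_eq_lintegral_mul _ h1 hF,
    show (volume : Measure ℝ).prod ((volume : Measure ℝ).restrict (Ioi 0)) =
      (volume : Measure (ℝ × ℝ)).restrict (univ ×ˢ Ioi 0) by
        rw [Measure.volume_eq_prod, ← Measure.prod_restrict, Measure.restrict_univ],
    ← lintegral_indicator (MeasurableSet.univ.prod measurableSet_Ioi),
    ← lintegral_comp_polarCoord_symm]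
  rw [polarCoord_target, Measure.volume_eq_prod, ← Measure.prod_restrict]
  rw [lintegral_prod]
  swap
  · apply Measurable.aemeasurable
    refine Measurable.mul (by fun_prop) ?_
    refine (Measurable.indicator (h1.mul hF) (MeasurableSet.univ.prod measurableSet_Ioi)).comp ?_
    exact continuous_polarCoord_symm.measurable
  refine setLIntegral_congr_fun measurableSet_Ioi fun r hr => ?_
  have hr' : (0 : ℝ) < r := hr
  rw [show Ioo 0 Real.pi = Ioo (-Real.pi) Real.pi ∩ Ioi 0 by
    ext θ; simp only [mem_Ioo, mem_inter_iff, mem_Ioi]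
    have := Real.pi_pos
    constructor
    · rintro ⟨h, h'⟩; exact ⟨⟨by linarith, h'⟩, h⟩
    · rintro ⟨⟨h, h'⟩, h''⟩; exact ⟨h'', h'⟩]
  rw [inter_comm, ← setLIntegral_indicator measurableSet_Ioi]
  refine setLIntegral_congr_fun measurableSet_Ioo fun θ hθ => ?_
  simp only [polarCoord_symm_apply, indicator_apply, mem_prod, mem_univ, true_and, mem_Ioi,
    smul_eq_mul, Pi.mul_apply]
  by_cases h : 0 < θ
  · have hs : 0 < Real.sin θ := Real.sin_pos_of_pos_of_lt_pi h hθ.2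
    rw [if_pos (mul_pos hr' hs), if_pos h, Real.mul_rpow hr'.le hs.le,
      ENNReal.ofReal_mul (by positivity), ← mul_assoc, ← mul_assoc, ← mul_assoc,
      ← ENNReal.ofReal_mul hr'.le]
    congr 3
    nth_rw 1 [← Real.rpow_one r]
    rw [← Real.rpow_add hr']; congr 1; ring
  · have hs : Real.sin θ ≤ 0 :=
      Real.sin_nonpos_of_nonpos_of_neg_pi_le (not_lt.1 h) hθ.1.le
    rw [if_neg h, if_neg (by nlinarith), mul_zero]

lemma lintegral_exp_neg_sq_mul_rpow {b : ℝ} (hb : 0 < b) :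
    ∫⁻ r in Ioi 0, ENNReal.ofReal (r ^ (b - 1)) * ENNReal.ofReal (Real.exp (-r ^ 2)) =
      ENNReal.ofReal (1 / 2 * Real.Gamma (b / 2)) := by
  have h := integral_rpow_mul_exp_neg_rpow (p := 2) (q := b - 1) (by norm_num) (by linarith)
  rw [show (b - 1 + 1) / 2 = b / 2 by ring] at h
  rw [← h, ofReal_integral_eq_lintegral_ofReal]
  · refine setLIntegral_congr_fun measurableSet_Ioi fun r hr => ?_
    have hr' : (0 : ℝ) < r := hr
    rw [← ENNReal.ofReal_mul (by positivity)]
    norm_num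
  · refine Integrable.of_integral_ne_zero ?_
    rw [h]
    have := Real.Gamma_pos_of_pos (show 0 < b / 2 by linarith)
    positivity
  · refine (ae_restrict_iff' measurableSet_Ioi).2 (ae_of_all _ fun r hr => ?_)
    have hr' : (0 : ℝ) < r := hr
    simp only [Pi.zero_apply]; positivity

/-- The normalization of the angular law; evaluated by integrating a Gaussian over the half-plane
in Cartesian and in polar coordinates. -/
lemma lintegral_sin_rpow {b : ℝ} (hb : 0 < b) :
    ∫⁻ θ in Ioo 0 Real.pi, ENNReal.ofReal (Real.sin θ ^ (b - 1)) =
      ENNReal.ofReal (translationConst b)⁻¹ := by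
  have h := lintegral_halfPlane_polar b
    (fun z => ENNReal.ofReal (Real.exp (-z.1 ^ 2)) * ENNReal.ofReal (Real.exp (-z.2 ^ 2)))
    (by fun_prop)
  rw [lintegral_prod_mul (f := fun u : ℝ => ENNReal.ofReal (Real.exp (-u ^ 2)))
      (g := fun v : ℝ => ENNReal.ofReal (Real.exp (-v ^ 2))) (by fun_prop) (by fun_prop),
    lintegral_halfLineMeasure _ (by fun_prop), lintegral_exp_neg_sq_mul_rpow hb] at h
  have hg : ∫⁻ x : ℝ, ENNReal.ofReal (Real.exp (-x ^ 2)) = ENNReal.ofReal (Real.sqrt Real.pi) := by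
    have := integral_gaussian 1
    simp only [neg_mul, one_mul, div_one] at this
    rw [← this, ofReal_integral_eq_lintegral_ofReal]
    · simpa using integrable_exp_neg_mul_sq (b := 1) (by norm_num)
    · exact ae_of_all _ fun x => by simp only [Pi.zero_apply]; positivity
  have hr : ∫⁻ r in Ioi 0, ∫⁻ θ in Ioo 0 Real.pi,
        ENNReal.ofReal (r ^ b) * (ENNReal.ofReal (Real.sin θ ^ (b - 1)) *
          (ENNReal.ofReal (Real.exp (-(r * Real.cos θ) ^ 2)) *
            ENNReal.ofReal (Real.exp (-(r * Real.sin θ) ^ 2)))) =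
      ENNReal.ofReal (1 / 2 * Real.Gamma ((b + 1) / 2)) *
        ∫⁻ θ in Ioo 0 Real.pi, ENNReal.ofReal (Real.sin θ ^ (b - 1)) := by
    rw [← lintegral_exp_neg_sq_mul_rpow (by linarith : 0 < b + 1),
      ← lintegral_mul_const _ (by fun_prop)]
    refine lintegral_congr fun r => ?_
    rw [← lintegral_const_mul _ (by fun_prop)]
    refine lintegral_congr fun θ => ?_
    rw [← ENNReal.ofReal_mul (Real.exp_pos _).le, ← Real.exp_add,
      show -(r * Real.cos θ) ^ 2 + -(r * Real.sin θ) ^ 2 = - r ^ 2 by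
        linear_combination (-r ^ 2) * Real.sin_sq_add_cos_sq θ, add_sub_cancel_right]
    ring
  simp only at h
  rw [hr, hg] at h
  have hG := Real.Gamma_pos_of_pos (show 0 < (b + 1) / 2 by linarith)
  have hG' := Real.Gamma_pos_of_pos (show 0 < b / 2 by linarith)
  have hpi := Real.pi_pos
  rw [← ENNReal.ofReal_mul (by positivity)] at h
  have h0 : ENNReal.ofReal (1 / 2 * Real.Gamma ((b + 1) / 2)) ≠ 0 := by
    simp only [ne_eq, ENNReal.ofReal_eq_zero, not_le]; positivity
  refine (ENNReal.mul_right_inj h0 ENNReal.ofReal_ne_top).1 ?_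
  rw [← h, ← ENNReal.ofReal_mul (by positivity)]
  congr 1
  unfold translationConst
  field_simp

lemma isProbabilityMeasure_angleMeasure {b : ℝ} (hb : 0 < b) :
    IsProbabilityMeasure (angleMeasure b) := by
  constructor
  rw [← lintegral_one, lintegral_angleMeasure _ measurable_const]
  have hC := translationConst_pos hb
  simp only [mul_one]
  simp_rw [ENNReal.ofReal_mul hC.le]
  rw [lintegral_const_mul _ (by fun_prop), lintegral_sin_rpow hb, ← ENNReal.ofReal_mul hC.le,
    mul_inv_cancel₀ hC.ne', ENNReal.ofReal_one]

/-- The law `x ^ b dx` of the radius together with the angular law is, in Cartesian coordinates, a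
multiple of the half-plane measure `v ^ (b - 1) du dv`. -/
lemma lintegral_halfLine_angle {b : ℝ} (hb : 0 < b) (F : ℝ × ℝ → ℝ≥0∞) (hF : Measurable F) :
    ∫⁻ x, ∫⁻ θ, F (x * Real.cos θ, x * Real.sin θ) ∂(angleMeasure b) ∂(halfLineMeasure b) =
      ENNReal.ofReal (translationConst b) *
        ∫⁻ z, F z ∂((volume : Measure ℝ).prod (halfLineMeasure (b - 1))) := by
  have hm : Measurable fun z : ℝ × ℝ => F (z.1 * Real.cos z.2, z.1 * Real.sin z.2) :=
    hF.comp (by fun_prop)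
  rw [lintegral_halfPlane_polar b F hF,
    lintegral_halfLineMeasure _ hm.lintegral_prod_right',
    ← lintegral_const_mul' _ _ ENNReal.ofReal_ne_top]
  refine lintegral_congr fun r => ?_
  have hm' : Measurable fun θ => F (r * Real.cos θ, r * Real.sin θ) :=
    hm.comp (measurable_prodMk_left (x := r))
  simp only
  rw [lintegral_angleMeasure _ hm',
    ← lintegral_const_mul' _ _ ENNReal.ofReal_ne_top,
    ← lintegral_const_mul' _ _ ENNReal.ofReal_ne_top]
  refine lintegral_congr fun θ => ?_
  rw [ENNReal.ofReal_mul (translationConst_pos hb).le]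
  ring

/-- Reversibility of the one-dimensional Bessel translation with respect to `x ^ b dx`. In the
half-plane the translation by `t` is the shift `u ↦ u - t`, and the reflection `u ↦ t - u`
exchanges the distances to `(0, 0)` and to `(t, 0)`. -/
lemma lintegral_chord_swap {b : ℝ} (hb : 0 < b) (t : ℝ) (F : ℝ × ℝ → ℝ≥0∞)
    (hF : Measurable F) :
    ∫⁻ x, ∫⁻ θ, F (x, chord x t θ) ∂(angleMeasure b) ∂(halfLineMeasure b) =
      ∫⁻ x, ∫⁻ θ, F (chord x t θ, x) ∂(angleMeasure b) ∂(halfLineMeasure b) := by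
  have key : ∀ G : ℝ × ℝ → ℝ≥0∞, Measurable G →
      ∫⁻ x, ∫⁻ θ, G (x, chord x t θ) ∂(angleMeasure b) ∂(halfLineMeasure b) =
      ENNReal.ofReal (translationConst b) *
        ∫⁻ v, ∫⁻ u, G (Real.sqrt (u ^ 2 + v ^ 2), Real.sqrt ((u - t) ^ 2 + v ^ 2))
          ∂volume ∂(halfLineMeasure (b - 1)) := by
    intro G hG
    have hm : Measurable fun z : ℝ × ℝ =>
        G (Real.sqrt (z.1 ^ 2 + z.2 ^ 2), Real.sqrt ((z.1 - t) ^ 2 + z.2 ^ 2)) :=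
      hG.comp (by fun_prop)
    rw [← lintegral_prod_symm' _ hm, ← lintegral_halfLine_angle hb _ hm]
    have hx : ∀ᵐ x ∂(halfLineMeasure b), 0 < x := by
      unfold halfLineMeasure
      exact (withDensity_absolutelyContinuous _ _).ae_le (ae_restrict_mem measurableSet_Ioi)
    refine lintegral_congr_ae (hx.mono fun x hx => lintegral_congr fun θ => ?_)
    rw [chord_eq, show (x * Real.cos θ) ^ 2 + (x * Real.sin θ) ^ 2 = x ^ 2 by
      linear_combination (x ^ 2) * Real.sin_sq_add_cos_sq θ, Real.sqrt_sq hx.le]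
  rw [key F hF, key (fun z => F (z.2, z.1)) (hF.comp measurable_swap)]
  congr 1
  refine lintegral_congr fun v => ?_
  rw [← lintegral_sub_left_eq_self _ t]
  refine lintegral_congr fun u => ?_
  congr 4
  · ring
  · ring

end

section

/-! ### Even moments of the chord -/

lemma integral_angleMeasure {b : ℝ} (hb : 0 < b) (f : ℝ → ℝ) :
    ∫ θ, f θ ∂(angleMeasure b) =
      ∫ θ in Ioo 0 Real.pi, translationConst b * Real.sin θ ^ (b - 1) * f θ := by
  unfold angleMeasure
  rw [integral_withDensity_eq_integral_toReal_smul (by fun_prop)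
    (ae_of_all _ fun _ => ENNReal.ofReal_lt_top)]
  refine setIntegral_congr_fun measurableSet_Ioo fun θ hθ => ?_
  have hs := Real.sin_pos_of_pos_of_lt_pi hθ.1 hθ.2
  have := translationConst_pos hb
  simp only [smul_eq_mul]
  rw [ENNReal.toReal_ofReal (by positivity)]

lemma integrableOn_sin_rpow {b : ℝ} (hb : 0 < b) :
    IntegrableOn (fun θ => Real.sin θ ^ (b - 1)) (Ioo 0 Real.pi) := by
  refine (lintegral_ofReal_ne_top_iff_integrable
    (Measurable.aestronglyMeasurable (by fun_prop)) ?_).1 ?_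
  · refine (ae_restrict_iff' measurableSet_Ioo).2 (ae_of_all _ fun θ hθ => ?_)
    have hs := Real.sin_pos_of_pos_of_lt_pi hθ.1 hθ.2
    simp only [Pi.zero_apply]; positivity
  · rw [lintegral_sin_rpow hb]; exact ENNReal.ofReal_ne_top

lemma integrable_angleMeasure {b : ℝ} (hb : 0 < b) {f : ℝ → ℝ} (hf : Continuous f) :
    Integrable f (angleMeasure b) := by
  have := isProbabilityMeasure_angleMeasure hb
  obtain ⟨C, hC⟩ := (isCompact_Icc (a := (0 : ℝ)) (b := Real.pi)).exists_bound_of_continuousOn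
    hf.continuousOn
  refine Integrable.of_bound hf.aestronglyMeasurable C ?_
  unfold angleMeasure
  refine (withDensity_absolutelyContinuous _ _).ae_le ?_
  exact (ae_restrict_iff' measurableSet_Ioo).2 (ae_of_all _ fun θ hθ => hC θ (Ioo_subset_Icc_self hθ))

/-- Integration by parts in the angle: the integral of the derivative of `sin ^ b * G` vanishes. -/
lemma integral_angleMeasure_by_parts {b : ℝ} (hb : 0 < b) {G G' : ℝ → ℝ}
    (hG : ∀ θ, HasDerivAt G (G' θ) θ) (hG' : Continuous G') :
    ∫ θ, (b * Real.cos θ * G θ + Real.sin θ * G' θ) ∂(angleMeasure b) = 0 := by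
  have hGc : Continuous G := continuous_iff_continuousAt.2 fun θ => (hG θ).continuousAt
  have hint : IntegrableOn (fun θ => Real.sin θ ^ (b - 1) *
      (b * Real.cos θ * G θ + Real.sin θ * G' θ)) (Ioo 0 Real.pi) := by
    have hc : Continuous fun θ => b * Real.cos θ * G θ + Real.sin θ * G' θ := by fun_prop
    obtain ⟨C, hC⟩ := (isCompact_Icc (a := (0 : ℝ)) (b := Real.pi)).exists_bound_of_continuousOn
      hc.continuousOn
    refine (integrableOn_sin_rpow hb).mul_bdd (c := C) hc.aestronglyMeasurable ?_
    exact (ae_restrict_iff' measurableSet_Ioo).2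
      (ae_of_all _ fun θ hθ => hC θ (Ioo_subset_Icc_self hθ))
  have h := intervalIntegral.integral_eq_sub_of_hasDerivAt_of_le (a := 0) (b := Real.pi)
    (f := fun θ => Real.sin θ ^ b * G θ)
    (f' := fun θ => Real.sin θ ^ (b - 1) * (b * Real.cos θ * G θ + Real.sin θ * G' θ))
    Real.pi_pos.le
    ((Real.continuous_sin.rpow_const fun _ => Or.inr hb.le).mul hGc).continuousOn
    (fun θ hθ => by
      have hs := Real.sin_pos_of_pos_of_lt_pi hθ.1 hθ.2
      have h1 := ((Real.hasDerivAt_sin θ).rpow_const (p := b) (Or.inl hs.ne')).mul (hG θ)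
      refine h1.congr_deriv ?_
      have h2 : Real.sin θ ^ b = Real.sin θ ^ (b - 1) * Real.sin θ := by
        rw [← Real.rpow_add_one hs.ne', sub_add_cancel]
      rw [h2]; ring)
    ((intervalIntegrable_iff_integrableOn_Ioo_of_le Real.pi_pos.le).2 hint)
  rw [integral_angleMeasure hb]
  simp only [mul_assoc] at h ⊢
  rw [integral_const_mul, ← integral_Ioc_eq_integral_Ioo,
    ← intervalIntegral.integral_of_le Real.pi_pos.le, h]
  simp [Real.zero_rpow hb.ne']

/-- The even moments of the chord. -/
def chordMoment (b : ℝ) (k : ℕ) (x t : ℝ) : ℝ :=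
  ∫ θ, (x ^ 2 + t ^ 2 - 2 * x * t * Real.cos θ) ^ k ∂(angleMeasure b)

lemma chordMoment_zero {b : ℝ} (hb : 0 < b) (x t : ℝ) : chordMoment b 0 x t = 1 := by
  have := isProbabilityMeasure_angleMeasure hb
  simp [chordMoment]

lemma chordMoment_one {b : ℝ} (hb : 0 < b) (x t : ℝ) :
    chordMoment b 1 x t = x ^ 2 + t ^ 2 := by
  have := isProbabilityMeasure_angleMeasure hb
  have h := integral_angleMeasure_by_parts hb (G := fun _ => 1) (G' := fun _ => 0)
    (fun θ => hasDerivAt_const θ 1) continuous_const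
  simp only [mul_one, mul_zero, add_zero, integral_const_mul, mul_eq_zero, hb.ne', false_or] at h
  simp only [chordMoment, pow_one]
  rw [integral_sub (by simp) (integrable_angleMeasure hb (by fun_prop)), integral_const_mul, h]
  simp

/-- The three-term recursion of the even moments of the chord. -/
lemma chordMoment_succ_succ {b : ℝ} (hb : 0 < b) (m : ℕ) (x t : ℝ) :
    (b + m + 1) * chordMoment b (m + 2) x t =
      (b + 2 * (m + 1)) * (x ^ 2 + t ^ 2) * chordMoment b (m + 1) x t -
        (m + 1) * (x ^ 2 - t ^ 2) ^ 2 * chordMoment b m x t := by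
  have h := integral_angleMeasure_by_parts hb
    (G := fun θ => (x ^ 2 + t ^ 2 - 2 * x * t * Real.cos θ) ^ (m + 1))
    (G' := fun θ => (m + 1) * (x ^ 2 + t ^ 2 - 2 * x * t * Real.cos θ) ^ m *
      (2 * x * t * Real.sin θ))
    (fun θ => by
      have := ((((Real.hasDerivAt_cos θ).const_mul (2 * x * t)).const_sub (x ^ 2 + t ^ 2)).pow
        (m + 1))
      refine this.congr_deriv ?_
      push_cast [Nat.add_sub_cancel]; ring) (by fun_prop)
  have h2 := congrArg (fun z => 2 * x * t * z) h
  simp only [mul_zero] at h2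
  rw [← integral_const_mul] at h2
  have h3 : ∀ θ, 2 * x * t * (b * Real.cos θ * (x ^ 2 + t ^ 2 - 2 * x * t * Real.cos θ) ^ (m + 1) +
      Real.sin θ * ((m + 1) * (x ^ 2 + t ^ 2 - 2 * x * t * Real.cos θ) ^ m *
      (2 * x * t * Real.sin θ))) =
      (b + 2 * (m + 1)) * (x ^ 2 + t ^ 2) * (x ^ 2 + t ^ 2 - 2 * x * t * Real.cos θ) ^ (m + 1) -
      (m + 1) * (x ^ 2 - t ^ 2) ^ 2 * (x ^ 2 + t ^ 2 - 2 * x * t * Real.cos θ) ^ m -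
      (b + m + 1) * (x ^ 2 + t ^ 2 - 2 * x * t * Real.cos θ) ^ (m + 2) := by
    intro θ
    linear_combination ((m + 1) * (2 * x * t) ^ 2 *
      (x ^ 2 + t ^ 2 - 2 * x * t * Real.cos θ) ^ m) * Real.sin_sq_add_cos_sq θ
  simp_rw [h3] at h2
  rw [integral_sub (integrable_angleMeasure hb (by fun_prop))
    (integrable_angleMeasure hb (by fun_prop)), integral_sub
    (integrable_angleMeasure hb (by fun_prop)) (integrable_angleMeasure hb (by fun_prop)),
    integral_const_mul, integral_const_mul, integral_const_mul] at h2
  unfold chordMoment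
  linarith

/-- The Taylor coefficients in `z ^ 2` of the (suitably scaled) Bessel function attached to `b`. -/
def besselCoeff (b : ℝ) : ℕ → ℝ
  | 0 => 1
  | i + 1 => besselCoeff b i / ((i + 1) * (i + 1 + (b - 1) / 2))

lemma besselCoeff_pos {b : ℝ} (hb : 0 < b) (i : ℕ) : 0 < besselCoeff b i := by
  induction i with
  | zero => simp [besselCoeff]
  | succ i ih =>
    have : 0 < (i : ℝ) + 1 + (b - 1) / 2 := by
      have : (0 : ℝ) ≤ i := i.cast_nonneg
      linarith
    unfold besselCoeff; positivity

lemma besselCoeff_succ {b : ℝ} (hb : 0 < b) (i : ℕ) :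
    besselCoeff b i = (i + 1) * (i + 1 + (b - 1) / 2) * besselCoeff b (i + 1) := by
  have : 0 < (i : ℝ) + 1 + (b - 1) / 2 := by
    have : (0 : ℝ) ≤ i := i.cast_nonneg
    linarith
  have h1 : 0 < (i : ℝ) + 1 := by positivity
  rw [besselCoeff, mul_div_cancel₀ _ (mul_pos h1 this).ne']

/-- The generating series `∑ eᵢ Xⁱ zⁱ` with `eᵢ` the Bessel coefficients. -/
def besselSeries (b X : ℝ) : PowerSeries ℝ := PowerSeries.mk fun i => besselCoeff b i * X ^ i

/-- Multiplying a Cauchy product by `X` shifts the index of the first factor; the weights `w` allow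
the Bessel operator `i (i + (b - 1) / 2)` to appear twice. -/
lemma mul_sum_antidiagonal_left {b : ℝ} (hb : 0 < b) (k : ℕ) (X : ℝ) (w h : ℕ → ℝ) :
    X * ∑ z ∈ Finset.HasAntidiagonal.antidiagonal k, w (z.1 + 1) * (besselCoeff b z.1 * X ^ z.1) * h z.2 =
      ∑ z ∈ Finset.HasAntidiagonal.antidiagonal (k + 1),
        z.1 * (z.1 + (b - 1) / 2) * w z.1 * (besselCoeff b z.1 * X ^ z.1) * h z.2 := by
  rw [Finset.Nat.antidiagonal_succ, Finset.sum_cons, Finset.mul_sum]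
  simp only [Finset.sum_map, CharP.cast_eq_zero, zero_mul, zero_add, Function.Embedding.prodMap,
    Function.Embedding.coeFn_mk, Prod.map, Nat.succ_eq_add_one, Function.Embedding.refl_apply]
  refine Finset.sum_congr rfl fun z _ => ?_
  rw [besselCoeff_succ hb z.1]; push_cast; ring

lemma mul_sum_antidiagonal_right {b : ℝ} (hb : 0 < b) (k : ℕ) (X : ℝ) (w h : ℕ → ℝ) :
    X * ∑ z ∈ Finset.HasAntidiagonal.antidiagonal k, h z.1 * (w (z.2 + 1) * (besselCoeff b z.2 * X ^ z.2)) =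
      ∑ z ∈ Finset.HasAntidiagonal.antidiagonal (k + 1),
        h z.1 * (z.2 * (z.2 + (b - 1) / 2) * w z.2 * (besselCoeff b z.2 * X ^ z.2)) := by
  have := mul_sum_antidiagonal_left hb k X w h
  rw [← Finset.Nat.sum_antidiagonal_swap, ← Finset.Nat.sum_antidiagonal_swap (n := k + 1)] at this
  simp only [Prod.fst_swap, Prod.snd_swap] at this
  simp only [mul_comm (h _)]
  exact this

/-- The coefficients of the product of two Bessel series obey the recursion of
`chordMoment_succ_succ`, up to normalization. -/
lemma coeff_besselSeries_mul_succ_succ {b : ℝ} (hb : 0 < b) (m : ℕ) (X T : ℝ) :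
    (b + m + 1) * ((m + 2) * (m + 2 + (b - 1) / 2) * ((m + 1) * (m + 1 + (b - 1) / 2))) *
        PowerSeries.coeff (m + 2) (besselSeries b X * besselSeries b T) =
      (b + 2 * (m + 1)) * (X + T) * ((m + 1) * (m + 1 + (b - 1) / 2)) *
          PowerSeries.coeff (m + 1) (besselSeries b X * besselSeries b T) -
        (m + 1) * (X - T) ^ 2 * PowerSeries.coeff m (besselSeries b X * besselSeries b T) := by
  simp only [PowerSeries.coeff_mul, besselSeries, PowerSeries.coeff_mk]
  set e := besselCoeff b
  have x1 := mul_sum_antidiagonal_left hb (m + 1) X (fun _ => 1) (fun j => e j * T ^ j)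
  have t1 := mul_sum_antidiagonal_right hb (m + 1) T (fun _ => 1) (fun j => e j * X ^ j)
  have x0 := mul_sum_antidiagonal_left hb m X (fun _ => 1) (fun j => e j * T ^ j)
  have t0 := mul_sum_antidiagonal_right hb m T (fun _ => 1) (fun j => e j * X ^ j)
  have xx := mul_sum_antidiagonal_left hb (m + 1) X (fun i => (i - 1 : ℝ) * (i - 1 + (b - 1) / 2))
    (fun j => e j * T ^ j)
  have tt := mul_sum_antidiagonal_right hb (m + 1) T (fun i => (i - 1 : ℝ) * (i - 1 + (b - 1) / 2))
    (fun j => e j * X ^ j)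
  have xt := mul_sum_antidiagonal_left hb (m + 1) X (fun _ => 1)
    (fun j => j * (j + (b - 1) / 2) * (e j * T ^ j))
  simp only [one_mul, mul_one, Nat.cast_add, Nat.cast_one, add_sub_cancel_right] at x1 t1 x0 t0 xx tt xt
  rw [← x0] at xx
  rw [← t0] at tt
  rw [← t0] at xt
  have e1 : (b + 2 * (m + 1)) * (X + T) * ((m + 1) * (m + 1 + (b - 1) / 2)) *
      ∑ z ∈ Finset.HasAntidiagonal.antidiagonal (m + 1), e z.1 * X ^ z.1 * (e z.2 * T ^ z.2) =
      (b + 2 * (m + 1)) * ((m + 1) * (m + 1 + (b - 1) / 2)) *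
      ((X * ∑ z ∈ Finset.HasAntidiagonal.antidiagonal (m + 1), e z.1 * X ^ z.1 * (e z.2 * T ^ z.2)) +
      (T * ∑ z ∈ Finset.HasAntidiagonal.antidiagonal (m + 1), e z.1 * X ^ z.1 * (e z.2 * T ^ z.2))) := by ring
  have e2 : (m + 1) * (X - T) ^ 2 *
      ∑ z ∈ Finset.HasAntidiagonal.antidiagonal m, e z.1 * X ^ z.1 * (e z.2 * T ^ z.2) =
      (m + 1) * ((X * (X * ∑ z ∈ Finset.HasAntidiagonal.antidiagonal m, e z.1 * X ^ z.1 * (e z.2 * T ^ z.2))) -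
      2 * (X * (T * ∑ z ∈ Finset.HasAntidiagonal.antidiagonal m, e z.1 * X ^ z.1 * (e z.2 * T ^ z.2))) +
      (T * (T * ∑ z ∈ Finset.HasAntidiagonal.antidiagonal m, e z.1 * X ^ z.1 * (e z.2 * T ^ z.2)))) := by ring
  rw [e1, e2, x1, t1, xx, tt, xt]
  simp only [Finset.mul_sum, ← Finset.sum_add_distrib, ← Finset.sum_sub_distrib]
  refine Finset.sum_congr rfl fun z hz => ?_
  have hz' : (z.1 : ℝ) + z.2 = m + 2 := by exact_mod_cast Finset.HasAntidiagonal.mem_antidiagonal.1 hz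
  obtain ⟨i, j⟩ := z
  simp only at hz' ⊢
  have : (m : ℝ) = i + j - 2 := by linarith
  rw [this]
  ring

/-- Closed form of the even moments of the chord. -/
lemma besselCoeff_mul_chordMoment {b : ℝ} (hb : 0 < b) (k : ℕ) (x t : ℝ) :
    besselCoeff b k * chordMoment b k x t =
      PowerSeries.coeff k (besselSeries b (x ^ 2) * besselSeries b (t ^ 2)) := by
  induction k using Nat.strong_induction_on with
  | _ k ih =>
    match k with
    | 0 => simp [chordMoment_zero hb, besselSeries, besselCoeff, PowerSeries.coeff_mul]
    | 1 =>
      simp [chordMoment_one hb, besselSeries, besselCoeff, PowerSeries.coeff_mul,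
        Finset.Nat.antidiagonal_succ]
      ring
    | m + 2 =>
      have h1 := ih m (by omega)
      have h2 := ih (m + 1) (by omega)
      have hr := coeff_besselSeries_mul_succ_succ hb m (x ^ 2) (t ^ 2)
      rw [← h1, ← h2] at hr
      have hc := chordMoment_succ_succ hb m x t
      have e1 := besselCoeff_succ hb m
      have e2 := besselCoeff_succ hb (m + 1)
      push_cast at e2
      have hm : (0 : ℝ) ≤ m := m.cast_nonneg
      have hA : (b + m + 1) * ((m + 2) * (m + 2 + (b - 1) / 2) *
        ((m + 1) * (m + 1 + (b - 1) / 2))) ≠ 0 := by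
        have : 0 < (m : ℝ) + 1 + (b - 1) / 2 := by linarith
        have : 0 < (m : ℝ) + 2 + (b - 1) / 2 := by linarith
        positivity
      refine mul_left_cancel₀ hA ?_
      rw [hr, e1, e2]
      linear_combination ((m + 2) * (m + 2 + (b - 1) / 2) *
        ((m + 1) * (m + 1 + (b - 1) / 2))) * besselCoeff b (m + 1 + 1) * hc

end

section

/-! ### Commutativity of the one-dimensional translations -/

/-- Two finite measures on a bounded interval with the same moments are equal. -/
lemma measure_eq_of_moments {μ ν : Measure ℝ} [IsFiniteMeasure μ] [IsFiniteMeasure ν] {M : ℝ}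
    (hμ : ∀ᵐ x ∂μ, x ∈ Icc 0 M) (hν : ∀ᵐ x ∂ν, x ∈ Icc 0 M)
    (h : ∀ k : ℕ, ∫ x, x ^ k ∂μ = ∫ x, x ^ k ∂ν) : μ = ν := by
  have hint : ∀ (ρ : Measure ℝ) [IsFiniteMeasure ρ], (∀ᵐ x ∂ρ, x ∈ Icc 0 M) →
      ∀ g : ℝ → ℝ, Continuous g → Integrable g ρ := by
    intro ρ _ hρ g hg
    obtain ⟨C, hC⟩ := (isCompact_Icc (a := (0 : ℝ)) (b := M)).exists_bound_of_continuousOn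
      hg.continuousOn
    exact Integrable.of_bound hg.aestronglyMeasurable C (hρ.mono fun x hx => hC x hx)
  have hpoly : ∀ q : Polynomial ℝ, ∫ x, q.eval x ∂μ = ∫ x, q.eval x ∂ν := by
    intro q
    simp_rw [Polynomial.eval_eq_sum_range]
    rw [integral_finsetSum _ fun i _ => hint μ hμ _ (by fun_prop),
      integral_finsetSum _ fun i _ => hint ν hν _ (by fun_prop)]
    simp_rw [integral_const_mul, h]
  refine ext_of_forall_integral_eq_of_IsFiniteMeasure fun f => ?_
  have hdist : ∀ ε > 0, |∫ x, f x ∂μ - ∫ x, f x ∂ν| ≤ ε * (μ.real univ + ν.real univ) := by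
    intro ε hε
    obtain ⟨q, hq⟩ := exists_polynomial_near_of_continuousOn 0 M f f.continuous.continuousOn ε hε
    have hb : ∀ (ρ : Measure ℝ) [IsFiniteMeasure ρ], (∀ᵐ x ∂ρ, x ∈ Icc 0 M) →
        |∫ x, f x ∂ρ - ∫ x, q.eval x ∂ρ| ≤ ε * ρ.real univ := by
      intro ρ _ hρ
      rw [← integral_sub (hint ρ hρ _ f.continuous) (hint ρ hρ _ q.continuous)]
      exact norm_integral_le_of_norm_le_const (C := ε) (hρ.mono fun x hx => by
        rw [Real.norm_eq_abs, abs_sub_comm]; exact (hq x hx).le)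
    have h1 := hb μ hμ
    have h2 := hb ν hν
    rw [hpoly q] at h1
    rw [abs_sub_comm] at h2
    calc _ ≤ _ := abs_sub_le _ (∫ x, q.eval x ∂ν) _
      _ ≤ _ := by linarith
  by_contra hne
  have hpos : 0 < |∫ x, f x ∂μ - ∫ x, f x ∂ν| := abs_pos.2 (sub_ne_zero.2 hne)
  have hm : 0 ≤ μ.real univ + ν.real univ := by positivity
  have := hdist (|∫ x, f x ∂μ - ∫ x, f x ∂ν| / (2 * (μ.real univ + ν.real univ + 1)))
    (by positivity)
  rw [div_mul_eq_mul_div, le_div_iff₀ (by positivity)] at this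
  nlinarith

lemma chord_le (x t θ : ℝ) : chord x t θ ≤ |x| + |t| := by
  refine Real.sqrt_le_iff.2 ⟨by positivity, ?_⟩
  have h1 : |2 * x * t * Real.cos θ| ≤ 2 * |x| * |t| := by
    rw [abs_mul, abs_mul, abs_mul, abs_two]
    exact mul_le_of_le_one_right (by positivity) (Real.abs_cos_le_one θ)
  nlinarith [neg_abs_le (2 * x * t * Real.cos θ), sq_abs x, sq_abs t]

/-- The moments of a twice translated point, as coefficients of a product of three Bessel series,
which is visibly symmetric. -/
lemma integral_chord_chord {b : ℝ} (hb : 0 < b) (x t y : ℝ) (k : ℕ) :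
    besselCoeff b k * ∫ z : ℝ × ℝ, (chord (chord x t z.1) y z.2 ^ 2) ^ k
        ∂((angleMeasure b).prod (angleMeasure b)) =
      PowerSeries.coeff k (besselSeries b (x ^ 2) * besselSeries b (t ^ 2) *
        besselSeries b (y ^ 2)) := by
  have := isProbabilityMeasure_angleMeasure hb
  have hint : Integrable (fun z : ℝ × ℝ => (chord (chord x t z.1) y z.2 ^ 2) ^ k)
      ((angleMeasure b).prod (angleMeasure b)) := by
    refine Integrable.of_bound (Measurable.aestronglyMeasurable (by fun_prop))
      (((|x| + |t| + |y|) ^ 2) ^ k) (ae_of_all _ fun z => ?_)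
    rw [Real.norm_of_nonneg (by positivity)]
    have h1 := chord_le x t z.1
    have h2 := chord_le (chord x t z.1) y z.2
    rw [abs_of_nonneg (chord_nonneg _ _ _)] at h2
    have h3 := chord_nonneg (chord x t z.1) y z.2
    gcongr
    linarith
  rw [integral_prod _ hint]
  have h1 : ∀ θ, ∫ θ', (chord (chord x t θ) y θ' ^ 2) ^ k ∂(angleMeasure b) =
      chordMoment b k (chord x t θ) y := by
    intro θ; simp only [chord_sq, chordMoment]
  simp_rw [h1]
  rw [← integral_const_mul]
  simp_rw [besselCoeff_mul_chordMoment hb, PowerSeries.coeff_mul k]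
  simp_rw [besselSeries, PowerSeries.coeff_mk, chord_sq]
  rw [integral_finsetSum _ fun i _ => integrable_angleMeasure hb (by fun_prop)]
  refine Finset.sum_congr rfl fun z _ => ?_
  rw [integral_mul_const, integral_const_mul]
  congr 1
  exact besselCoeff_mul_chordMoment hb z.1 x t

/-- The one-dimensional Bessel translations commute: iterated translations in either order have
the same law, since the laws of the squares have the same moments. -/
lemma map_chord_chord_comm {b : ℝ} (hb : 0 < b) (x t y : ℝ) :
    ((angleMeasure b).prod (angleMeasure b)).map (fun z => chord (chord x t z.1) y z.2) =
      ((angleMeasure b).prod (angleMeasure b)).map (fun z => chord (chord x y z.1) t z.2) := by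
  have := isProbabilityMeasure_angleMeasure hb
  have hm : ∀ t y, Measurable fun z : ℝ × ℝ => chord (chord x t z.1) y z.2 := fun t y => by fun_prop
  have hsq : ((angleMeasure b).prod (angleMeasure b)).map
        (fun z => chord (chord x t z.1) y z.2 ^ 2) =
      ((angleMeasure b).prod (angleMeasure b)).map
        (fun z => chord (chord x y z.1) t z.2 ^ 2) := by
    have hI : ∀ t y, ∀ᵐ s ∂((angleMeasure b).prod (angleMeasure b)).map
        (fun z => chord (chord x t z.1) y z.2 ^ 2), s ∈ Icc 0 ((|x| + |t| + |y|) ^ 2) := by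
      intro t y
      refine (ae_map_iff ((hm t y).pow_const 2).aemeasurable measurableSet_Icc).2 ?_
      refine ae_of_all _ fun z => ⟨by positivity, ?_⟩
      have h1 := chord_le x t z.1
      have h2 := chord_le (chord x t z.1) y z.2
      rw [abs_of_nonneg (chord_nonneg _ _ _)] at h2
      have h3 := chord_nonneg (chord x t z.1) y z.2
      gcongr
      linarith
    have h2 := hI y t
    rw [show |x| + |y| + |t| = |x| + |t| + |y| by ring] at h2
    refine measure_eq_of_moments (hI t y) h2 fun k => ?_
    rw [integral_map ((hm t y).pow_const 2).aemeasurable (by fun_prop),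
      integral_map ((hm y t).pow_const 2).aemeasurable (by fun_prop)]
    refine mul_left_cancel₀ (besselCoeff_pos hb k).ne' ?_
    rw [integral_chord_chord hb, integral_chord_chord hb, mul_right_comm]
  have h := congrArg (Measure.map Real.sqrt) hsq
  rw [Measure.map_map (by fun_prop) ((hm t y).pow_const 2),
    Measure.map_map (by fun_prop) ((hm y t).pow_const 2)] at h
  simpa only [Function.comp_def, Real.sqrt_sq (chord_nonneg _ _ _)] using h

/-- The angular law is invariant under `θ ↦ π - θ`. -/
lemma map_pi_sub_angleMeasure (b : ℝ) :
    (angleMeasure b).map (fun θ => Real.pi - θ) = angleMeasure b := by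
  have hm : Measurable fun θ : ℝ => Real.pi - θ := by fun_prop
  refine Measure.ext_of_lintegral _ fun F hF => ?_
  rw [lintegral_map hF hm, lintegral_angleMeasure (fun θ => F (Real.pi - θ)) (hF.comp hm),
    lintegral_angleMeasure _ hF,
    ← lintegral_indicator measurableSet_Ioo, ← lintegral_indicator measurableSet_Ioo,
    ← lintegral_sub_left_eq_self _ Real.pi]
  refine lintegral_congr fun θ => ?_
  simp only [indicator_apply, mem_Ioo, sub_pos, sub_lt_self_iff, Real.sin_pi_sub, sub_sub_cancel]
  simp only [and_comm]

end

section

/-! ### Bessel translations in several variables -/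

lemma lintegral_pi_prod {n : ℕ} (μ : Fin n → Measure ℝ) [∀ i, SigmaFinite (μ i)]
    (f : Fin n → ℝ → ℝ≥0∞) (hf : ∀ i, Measurable (f i)) :
    ∫⁻ x, ∏ i, f i (x i) ∂(Measure.pi μ) = ∏ i, ∫⁻ y, f i y ∂(μ i) := by
  induction n with
  | zero => simp
  | succ n ih =>
    have hm := measurePreserving_piFinSuccAbove μ 0
    have := hm.symm.lintegral_comp (f := fun x : Fin (n + 1) → ℝ => ∏ i, f i (x i))
      (Finset.measurable_prod _ fun i _ => (hf i).comp (measurable_pi_apply i))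
    rw [← this]
    simp only [MeasurableEquiv.piFinSuccAbove_symm_apply, Fin.prod_univ_succ, Fin.insertNthEquiv_apply,
      Fin.insertNth_zero', Fin.cons_zero, Fin.cons_succ, Fin.zero_succAbove]
    rw [lintegral_prod_mul (f := f 0) (g := fun y : Fin n → ℝ => ∏ i : Fin n, f i.succ (y i))
      (hf 0).aemeasurable (Finset.measurable_prod _ fun i _ =>
        (hf i.succ).comp (measurable_pi_apply i)).aemeasurable, ih _ _ fun i => hf i.succ]

lemma pi_withDensity {n : ℕ} (μ : Fin n → Measure ℝ) [∀ i, SigmaFinite (μ i)]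
    (f : Fin n → ℝ → ℝ≥0∞) (hf : ∀ i, Measurable (f i))
    [∀ i, SigmaFinite ((μ i).withDensity (f i))] :
    Measure.pi (fun i => (μ i).withDensity (f i)) =
      (Measure.pi μ).withDensity fun x => ∏ i, f i (x i) := by
  refine Measure.pi_eq fun s hs => ?_
  rw [withDensity_apply _ (MeasurableSet.univ_pi hs), Measure.restrict_pi_pi,
    lintegral_pi_prod _ _ hf]
  exact Finset.prod_congr rfl fun i _ => (withDensity_apply _ (hs i)).symm

instance sigmaFinite_halfLineMeasure (b : ℝ) : SigmaFinite (halfLineMeasure b) := by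
  unfold halfLineMeasure
  exact SigmaFinite.withDensity_ofReal _

instance sigmaFinite_angleMeasure (b : ℝ) : SigmaFinite (angleMeasure b) := by
  unfold angleMeasure
  exact SigmaFinite.withDensity_ofReal _

variable {n : ℕ}

/-- The law of the angles in the `n`-dimensional Bessel translation. -/
def angles (a : Fin n → ℝ) : Measure (Fin n → ℝ) := Measure.pi fun i => angleMeasure (a i)

/-- The point whose value enters the Bessel translation by `t` at `x` for the angles `θ`. -/
def move (x t : Space n) (θ : Fin n → ℝ) : Space n :=
  WithLp.toLp 2 fun i => chord (x i) (t i) (θ i)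

lemma isProbabilityMeasure_angles {a : Fin n → ℝ} (ha : ∀ i, 0 < a i) :
    IsProbabilityMeasure (angles a) := by
  have := fun i => isProbabilityMeasure_angleMeasure (ha i)
  unfold angles; infer_instance

instance (a : Fin n → ℝ) : SigmaFinite (angles a) := by unfold angles; infer_instance

lemma continuous_move :
    Continuous fun z : Space n × Space n × (Fin n → ℝ) => move z.1 z.2.1 z.2.2 := by
  unfold move chord; fun_prop

@[fun_prop]
lemma Measurable.move {α : Type*} [MeasurableSpace α] {f g : α → Space n} {h : α → Fin n → ℝ}
    (hf : Measurable f) (hg : Measurable g) (hh : Measurable h) :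
    Measurable fun x => move (f x) (g x) (h x) :=
  continuous_move.measurable.comp (hf.prodMk (hg.prodMk hh))

lemma move_comm (x t : Space n) (θ : Fin n → ℝ) : move x t θ = move t x θ := by
  unfold move; simp only [chord_comm]

/-- The Bessel translation is the mean of `f` over random points. The density of the angular law
contains the normalizing constant. -/
lemma translation_eq {a : Fin n → ℝ} (ha : ∀ i, 0 < a i) (t : Space n) (f : Space n → ℝ)
    (x : Space n) : translation a t f x = ∫ θ, f (move x t θ) ∂(angles a) := by
  have h : angles a = ((volume : Measure (Fin n → ℝ)).restrict
      (univ.pi fun _ : Fin n => Ioo (0 : ℝ) Real.pi)).withDensity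
      fun θ => ∏ i, ENNReal.ofReal (translationConst (a i) * Real.sin (θ i) ^ (a i - 1)) := by
    have : ∀ i, SigmaFinite ((volume.restrict (Ioo 0 Real.pi)).withDensity
      fun θ => ENNReal.ofReal (translationConst (a i) * Real.sin θ ^ (a i - 1))) :=
      fun i => sigmaFinite_angleMeasure (a i)
    unfold angles angleMeasure
    rw [pi_withDensity _ (fun i θ => ENNReal.ofReal (translationConst (a i) *
      Real.sin θ ^ (a i - 1))) (fun i => by fun_prop), volume_pi, Measure.restrict_pi_pi]
  rw [h, integral_withDensity_eq_integral_toReal_smul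
    (Finset.measurable_prod _ fun i _ => by fun_prop)
    (ae_of_all _ fun _ => ENNReal.prod_lt_top fun i _ => ENNReal.ofReal_lt_top)]
  unfold translation
  rw [← integral_const_mul]
  refine setIntegral_congr_fun (MeasurableSet.univ_pi fun _ => measurableSet_Ioo) fun θ hθ => ?_
  simp only [smul_eq_mul, ENNReal.toReal_prod]
  have : ∀ i, (ENNReal.ofReal (translationConst (a i) * Real.sin (θ i) ^ (a i - 1))).toReal =
      translationConst (a i) * Real.sin (θ i) ^ (a i - 1) := fun i => by
    have hs := Real.sin_pos_of_pos_of_lt_pi (hθ i trivial).1 (hθ i trivial).2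
    have := translationConst_pos (ha i)
    exact ENNReal.toReal_ofReal (by positivity)
  simp only [this, Finset.prod_mul_distrib, move, chord]
  ring

lemma measurableSet_orthant : MeasurableSet (orthant n) := by
  unfold orthant
  simp only [ofPred_forall]
  exact MeasurableSet.iInter fun i => measurableSet_lt measurable_const (by fun_prop)

@[fun_prop]
lemma measurable_weight (a : Fin n → ℝ) : Measurable (weight a) := by
  unfold weight; fun_prop

lemma weight_nonneg (a : Fin n → ℝ) {x : Space n} (hx : x ∈ orthant n) : 0 ≤ weight a x :=
  Finset.prod_nonneg fun i _ => Real.rpow_nonneg (hx i).le _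

/-- The measure `x ^ a dx` is a product of measures on half-lines, transported to Euclidean space.
-/
lemma wMeasure_eq_map (a : Fin n → ℝ) :
    wMeasure a = (Measure.pi fun i => halfLineMeasure (a i)).map (WithLp.toLp 2) := by
  have : ∀ i, SigmaFinite ((volume.restrict (Ioi 0)).withDensity
      fun r => ENNReal.ofReal (r ^ a i)) :=
      fun i => sigmaFinite_halfLineMeasure (a i)
  unfold halfLineMeasure
  rw [pi_withDensity _ (fun i r => ENNReal.ofReal (r ^ a i)) (fun i => by fun_prop),
    ← Measure.restrict_pi_pi, ← volume_pi]
  have hmp := PiLp.volume_preserving_toLp (Fin n)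
  refine Measure.ext_of_lintegral _ fun F hF => ?_
  have hd : Measurable fun x : Fin n → ℝ => ∏ i, ENNReal.ofReal (x i ^ a i) :=
    Finset.measurable_prod _ fun i _ => by fun_prop
  rw [lintegral_map hF (by fun_prop), lintegral_withDensity_eq_lintegral_mul _ hd
    (g := fun x => F (WithLp.toLp 2 x)) (hF.comp (by fun_prop)), wMeasure, lintegral_withDensity_eq_lintegral_mul _ (by fun_prop) hF,
    ← lintegral_indicator measurableSet_orthant,
    ← lintegral_indicator (MeasurableSet.univ_pi fun _ => measurableSet_Ioi),
    ← hmp.lintegral_comp (Measurable.indicator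
      ((Measurable.ennreal_ofReal (measurable_weight a)).mul hF) measurableSet_orthant)]
  refine lintegral_congr fun x => ?_
  by_cases h : ∀ i, 0 < x i
  · rw [indicator_of_mem (show WithLp.toLp 2 x ∈ orthant n from h),
      indicator_of_mem (show x ∈ univ.pi fun _ => Ioi 0 from fun i _ => h i)]
    simp only [Pi.mul_apply]
    congr 1
    exact ENNReal.ofReal_prod_of_nonneg fun i _ => Real.rpow_nonneg (h i).le _
  · rw [indicator_of_notMem (show WithLp.toLp 2 x ∉ orthant n from h),
      indicator_of_notMem (show x ∉ univ.pi fun _ => Ioi 0 from fun h' => h fun i => h' i trivial)]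

instance (a : Fin n → ℝ) : SigmaFinite (wMeasure a) := by
  unfold wMeasure; exact SigmaFinite.withDensity_ofReal _

lemma ae_mem_orthant (a : Fin n → ℝ) : ∀ᵐ x ∂(wMeasure a), x ∈ orthant n :=
  (withDensity_absolutelyContinuous _ _).ae_le (ae_restrict_mem measurableSet_orthant)

lemma lintegral_pi_prod_pi {α β γ : Type*} [MeasurableSpace α] [MeasurableSpace β]
    [MeasurableSpace γ] (μ : Fin n → Measure α) (ν : Fin n → Measure β) [∀ i, SigmaFinite (μ i)]
    [∀ i, SigmaFinite (ν i)] (f : Fin n → α × β → γ) (hf : ∀ i, Measurable (f i))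
    [∀ i, SigmaFinite (((μ i).prod (ν i)).map (f i))] (F : (Fin n → γ) → ℝ≥0∞)
    (hF : Measurable F) :
    ∫⁻ x, ∫⁻ y, F (fun i => f i (x i, y i)) ∂(Measure.pi ν) ∂(Measure.pi μ) =
      ∫⁻ z, F z ∂(Measure.pi fun i => ((μ i).prod (ν i)).map (f i)) := by
  have hm := measurePreserving_arrowProdEquivProdArrow α β (Fin n) μ ν
  have hg : Measurable fun z : (Fin n → α) × (Fin n → β) => F (fun i => f i (z.1 i, z.2 i)) :=
    hF.comp (measurable_pi_lambda _ fun i => (hf i).comp (by fun_prop))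
  have hf' : Measurable fun (x : Fin n → α × β) i => f i (x i) :=
    measurable_pi_lambda _ fun i => (hf i).comp (measurable_pi_apply i)
  rw [← lintegral_prod _ hg.aemeasurable, ← hm.lintegral_comp hg,
    ← Measure.pi_map_pi (fun i => (hf i).aemeasurable),
    lintegral_map hF hf']
  rfl

/-- Reversibility of the Bessel translation with respect to `x ^ a dx`. -/
lemma lintegral_move_swap {a : Fin n → ℝ} (ha : ∀ i, 0 < a i) (t : Space n)
    (F : Space n × Space n → ℝ≥0∞) (hF : Measurable F) :
    ∫⁻ x, ∫⁻ θ, F (x, move x t θ) ∂(angles a) ∂(wMeasure a) =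
      ∫⁻ x, ∫⁻ θ, F (move x t θ, x) ∂(angles a) ∂(wMeasure a) := by
  have := fun i => isProbabilityMeasure_angleMeasure (ha i)
  have hm : ∀ i, Measurable fun z : ℝ × ℝ => (z.1, chord z.1 (t i) z.2) := fun i => by fun_prop
  have hsf : ∀ i, SigmaFinite (((halfLineMeasure (a i)).prod (angleMeasure (a i))).map
      fun z => (z.1, chord z.1 (t i) z.2)) := fun i => by
    refine SigmaFinite.of_map _ (f := Prod.fst) measurable_fst.aemeasurable ?_
    rw [Measure.map_map measurable_fst (hm i)]
    simp only [Function.comp_def]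
    rw [show (fun x : ℝ × ℝ => x.1) = Prod.fst from rfl, Measure.map_fst_prod, measure_univ,
      one_smul]
    infer_instance
  have hswap : ∀ i, ((halfLineMeasure (a i)).prod (angleMeasure (a i))).map
      (fun z => (chord z.1 (t i) z.2, z.1)) =
      ((halfLineMeasure (a i)).prod (angleMeasure (a i))).map
      fun z => (z.1, chord z.1 (t i) z.2) := fun i => by
    refine Measure.ext_of_lintegral _ fun G hG => ?_
    rw [lintegral_map hG (by fun_prop), lintegral_map hG (by fun_prop),
      lintegral_prod _ (Measurable.aemeasurable (by fun_prop)),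
      lintegral_prod _ (Measurable.aemeasurable (by fun_prop))]
    exact (lintegral_chord_swap (ha i) (t i) G hG).symm
  have hsf' : ∀ i, SigmaFinite (((halfLineMeasure (a i)).prod (angleMeasure (a i))).map
      fun z => (chord z.1 (t i) z.2, z.1)) := fun i => by rw [hswap]; exact hsf i
  have key : ∀ G : Space n × Space n → ℝ≥0∞, Measurable G →
      ∫⁻ x, ∫⁻ θ, G (x, move x t θ) ∂(angles a) ∂(wMeasure a) =
      ∫⁻ x, ∫⁻ θ, G (WithLp.toLp 2 x, WithLp.toLp 2 fun i => chord (x i) (t i) (θ i))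
        ∂(angles a) ∂(Measure.pi fun i => halfLineMeasure (a i)) := by
    intro G hG
    have h1 : Measurable fun z : Space n × (Fin n → ℝ) => G (z.1, move z.1 t z.2) :=
      hG.comp (by fun_prop)
    rw [wMeasure_eq_map, lintegral_map h1.lintegral_prod_right' (by fun_prop)]
    rfl
  rw [key F hF, key (fun z => F (z.2, z.1)) (hF.comp measurable_swap)]
  have h2 : Measurable fun z : Fin n → ℝ × ℝ =>
      F (WithLp.toLp 2 fun i => (z i).1, WithLp.toLp 2 fun i => (z i).2) := hF.comp (by fun_prop)
  unfold angles
  refine (lintegral_pi_prod_pi _ _ (fun i z => (z.1, chord z.1 (t i) z.2)) hm _ h2).trans ?_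
  refine Eq.trans ?_ (lintegral_pi_prod_pi _ _ (fun i z => (chord z.1 (t i) z.2, z.1))
    (fun i => by fun_prop) _ h2).symm
  simp_rw [hswap]

/-- The Bessel translations commute. -/
lemma lintegral_move_move_comm {a : Fin n → ℝ} (ha : ∀ i, 0 < a i) (x t y : Space n)
    (F : Space n → ℝ≥0∞) (hF : Measurable F) :
    ∫⁻ θ, ∫⁻ θ', F (move (move x t θ) y θ') ∂(angles a) ∂(angles a) =
      ∫⁻ θ, ∫⁻ θ', F (move (move x y θ) t θ') ∂(angles a) ∂(angles a) := by
  have := fun i => isProbabilityMeasure_angleMeasure (ha i)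
  have hp : ∀ t y : Space n, ∀ i, SigmaFinite (((angleMeasure (a i)).prod (angleMeasure (a i))).map
      fun z : ℝ × ℝ => chord (chord (x i) (t i) z.1) (y i) z.2) := fun t y i => by
    have := Measure.isProbabilityMeasure_map (μ := (angleMeasure (a i)).prod (angleMeasure (a i)))
      (f := fun z : ℝ × ℝ => chord (chord (x i) (t i) z.1) (y i) z.2)
      (Measurable.aemeasurable (by fun_prop))
    infer_instance
  have hF' : Measurable fun z : Fin n → ℝ => F (WithLp.toLp 2 z) := hF.comp (by fun_prop)
  have := hp t y
  have := hp y t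
  unfold angles
  refine (lintegral_pi_prod_pi _ _ (fun i (z : ℝ × ℝ) => chord (chord (x i) (t i) z.1) (y i) z.2)
    (fun i => by fun_prop) _ hF').trans ?_
  refine Eq.trans ?_ (lintegral_pi_prod_pi _ _
    (fun i (z : ℝ × ℝ) => chord (chord (x i) (y i) z.1) (t i) z.2)
    (fun i => by fun_prop) _ hF').symm
  simp_rw [fun i => map_chord_chord_comm (ha i) (x i) (t i) (y i)]

/-- The law of the angles is invariant under the reflection of one angle. -/
lemma map_update_pi_sub_angles {a : Fin n → ℝ} (ha : ∀ i, 0 < a i) (i : Fin n) :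
    (angles a).map (fun θ j => if j = i then Real.pi - θ j else θ j) = angles a := by
  have := fun i => isProbabilityMeasure_angleMeasure (ha i)
  have h1 : ∀ j, (angleMeasure (a j)).map (fun θ => if j = i then Real.pi - θ else θ) =
      angleMeasure (a j) := fun j => by
    by_cases h : j = i
    · simpa [h] using map_pi_sub_angleMeasure (a i)
    · simp [h]
  have h : ∀ j, SigmaFinite ((angleMeasure (a j)).map fun θ =>
      if j = i then Real.pi - θ else θ) := fun j => by
    rw [h1]; infer_instance
  unfold angles
  rw [Measure.pi_map_pi (f := fun j θ => if j = i then Real.pi - θ else θ)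
    (fun j => Measurable.aemeasurable (by split_ifs <;> fun_prop))]
  simp_rw [h1]

lemma integrable_angles {a : Fin n → ℝ} (ha : ∀ i, 0 < a i) {f : (Fin n → ℝ) → ℝ}
    (hf : Continuous f) : Integrable f (angles a) := by
  have := isProbabilityMeasure_angles ha
  have h2 := fun i => isProbabilityMeasure_angleMeasure (ha i)
  have hK : IsCompact (univ.pi fun _ : Fin n => Icc (0 : ℝ) Real.pi) :=
    isCompact_univ_pi fun _ => isCompact_Icc
  obtain ⟨C, hC⟩ := hK.exists_bound_of_continuousOn hf.continuousOn
  refine Integrable.of_bound hf.measurable.aestronglyMeasurable C ?_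
  have h1 : ∀ᵐ θ ∂(angles a), ∀ i, θ i ∈ Icc (0 : ℝ) Real.pi := by
    refine ae_all_iff.2 fun i => ?_
    have h3 : ∀ᵐ θ ∂(angleMeasure (a i)), θ ∈ Icc (0 : ℝ) Real.pi := by
      unfold angleMeasure
      exact (withDensity_absolutelyContinuous _ _).ae_le
        ((ae_restrict_mem measurableSet_Ioo).mono fun _ h => Ioo_subset_Icc_self h)
    exact (Measure.tendsto_eval_ae_ae (μ := fun i => angleMeasure (a i)) (i := i)).eventually h3
  exact h1.mono fun θ h => hC θ fun i _ => h i

lemma integral_angles_eval {a : Fin n → ℝ} (ha : ∀ i, 0 < a i) (i : Fin n) {F : ℝ → ℝ}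
    (hF : Measurable F) : ∫ θ, F (θ i) ∂(angles a) = ∫ θ, F θ ∂(angleMeasure (a i)) := by
  have := fun i => isProbabilityMeasure_angleMeasure (ha i)
  rw [← (measurePreserving_eval (fun i => angleMeasure (a i)) i).map_eq,
    integral_map (measurable_pi_apply i).aemeasurable hF.aestronglyMeasurable]
  rfl

end

section

/-! ### Averages of Bessel translations -/

variable {n : ℕ}

/-- The average of `f` over the Bessel translations by vectors distributed according to `μ`. -/
def avg (a : Fin n → ℝ) (μ : Measure (Space n)) (f : Space n → ℝ) (x : Space n) : ℝ :=
  ∫ z, f (move x z.1 z.2) ∂(μ.prod (angles a))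

/-- The version of `avg` for functions with values in `[0, ∞]`. -/
def lavg (a : Fin n → ℝ) (μ : Measure (Space n)) (F : Space n → ℝ≥0∞) (x : Space n) : ℝ≥0∞ :=
  ∫⁻ z, F (move x z.1 z.2) ∂(μ.prod (angles a))

section
variable {a : Fin n → ℝ} {μ ν : Measure (Space n)}

@[fun_prop]
lemma measurable_lavg [SFinite μ] {F : Space n → ℝ≥0∞} (hF : Measurable F) :
    Measurable (lavg a μ F) := by
  unfold lavg
  have h : Measurable fun z : Space n × Space n × (Fin n → ℝ) => F (move z.1 z.2.1 z.2.2) :=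
    hF.comp (by fun_prop)
  exact h.lintegral_prod_right'

@[fun_prop]
lemma measurable_avg [SFinite μ] {f : Space n → ℝ} (hf : Measurable f) :
    Measurable (avg a μ f) := by
  unfold avg
  have h : StronglyMeasurable fun z : Space n × Space n × (Fin n → ℝ) =>
    f (move z.1 z.2.1 z.2.2) := (hf.comp (by fun_prop)).stronglyMeasurable
  exact h.integral_prod_right'.measurable

lemma enorm_avg_le (f : Space n → ℝ) (x : Space n) :
    ‖avg a μ f x‖ₑ ≤ lavg a μ (fun y => ‖f y‖ₑ) x := enorm_integral_le_lintegral_enorm _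

lemma lavg_dirac (t : Space n) {F : Space n → ℝ≥0∞} (hF : Measurable F) (x : Space n) :
    lavg a (Measure.dirac t) F x = ∫⁻ θ, F (move x t θ) ∂(angles a) := by
  unfold lavg
  rw [Measure.dirac_prod, lintegral_map (by fun_prop) (by fun_prop)]

lemma lavg_eq [SFinite μ] {F : Space n → ℝ≥0∞} (hF : Measurable F) (x : Space n) :
    lavg a μ F x = ∫⁻ t, lavg a (Measure.dirac t) F x ∂μ := by
  simp_rw [lavg_dirac _ hF]
  unfold lavg
  rw [lintegral_prod _ (Measurable.aemeasurable (by fun_prop))]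

lemma avg_dirac (ha : ∀ i, 0 < a i) (t : Space n) {f : Space n → ℝ} (hf : Measurable f)
    (x : Space n) : avg a (Measure.dirac t) f x = translation a t f x := by
  unfold avg
  rw [Measure.dirac_prod, translation_eq ha, integral_map (by fun_prop)
    (Measurable.aestronglyMeasurable (by fun_prop))]

lemma lavg_dirac_comm (x t : Space n) {F : Space n → ℝ≥0∞} (hF : Measurable F) :
    lavg a (Measure.dirac t) F x = lavg a (Measure.dirac x) F t := by
  rw [lavg_dirac _ hF, lavg_dirac _ hF]
  simp_rw [move_comm x t]

lemma translation_comm (ha : ∀ i, 0 < a i) (x t : Space n) (f : Space n → ℝ) :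
    translation a t f x = translation a x f t := by
  rw [translation_eq ha, translation_eq ha]
  simp_rw [move_comm x t]

/-- Reversibility, integrated over the translation vectors. -/
lemma lintegral_lavg_swap (ha : ∀ i, 0 < a i) [SFinite μ] (F : Space n × Space n → ℝ≥0∞)
    (hF : Measurable F) :
    ∫⁻ x, ∫⁻ z, F (x, move x z.1 z.2) ∂(μ.prod (angles a)) ∂(wMeasure a) =
      ∫⁻ x, ∫⁻ z, F (move x z.1 z.2, x) ∂(μ.prod (angles a)) ∂(wMeasure a) := by
  have key : ∀ G : Space n × Space n → ℝ≥0∞, Measurable G →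
      ∫⁻ x, ∫⁻ z, G (x, move x z.1 z.2) ∂(μ.prod (angles a)) ∂(wMeasure a) =
      ∫⁻ t, ∫⁻ x, ∫⁻ θ, G (x, move x t θ) ∂(angles a) ∂(wMeasure a) ∂μ := by
    intro G hG
    have h1 : Measurable fun z : (Space n × Space n) × (Fin n → ℝ) =>
        G (z.1.1, move z.1.1 z.1.2 z.2) := hG.comp (by fun_prop)
    rw [lintegral_lintegral_swap (μ := μ)]
    · refine lintegral_congr fun x => ?_
      rw [lintegral_prod _ (Measurable.aemeasurable (by fun_prop))]
    · exact (h1.lintegral_prod_right'.comp measurable_swap).aemeasurable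
  rw [key F hF, key (fun z => F (z.2, z.1)) (hF.comp measurable_swap)]
  exact lintegral_congr fun t => lintegral_move_swap ha t F hF

lemma lintegral_lavg (ha : ∀ i, 0 < a i) [SFinite μ] {F : Space n → ℝ≥0∞} (hF : Measurable F) :
    ∫⁻ x, lavg a μ F x ∂(wMeasure a) = μ univ * ∫⁻ x, F x ∂(wMeasure a) := by
  have := isProbabilityMeasure_angles ha
  unfold lavg
  rw [lintegral_lavg_swap ha (fun z => F z.2) (hF.comp measurable_snd)]
  simp only [lintegral_const]
  rw [lintegral_mul_const _ hF, ← univ_prod_univ, Measure.prod_prod, measure_univ (μ := angles a),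
    mul_one, mul_comm]

/-- Self-adjointness of the Bessel translation on nonnegative functions. -/
lemma lintegral_mul_lavg_dirac (ha : ∀ i, 0 < a i) (t : Space n) {F G : Space n → ℝ≥0∞}
    (hF : Measurable F) (hG : Measurable G) :
    ∫⁻ x, F x * lavg a (Measure.dirac t) G x ∂(wMeasure a) =
      ∫⁻ x, lavg a (Measure.dirac t) F x * G x ∂(wMeasure a) := by
  have h := lintegral_move_swap ha t (fun z => F z.1 * G z.2) (by fun_prop)
  simp_rw [lavg_dirac _ hF, lavg_dirac _ hG]
  have h1 : ∀ x, ∫⁻ θ, F x * G (move x t θ) ∂(angles a) =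
      F x * ∫⁻ θ, G (move x t θ) ∂(angles a) := fun x =>
    lintegral_const_mul _ (hG.comp (by fun_prop))
  have h2 : ∀ x, ∫⁻ θ, F (move x t θ) * G x ∂(angles a) =
      (∫⁻ θ, F (move x t θ) ∂(angles a)) * G x := fun x =>
    lintegral_mul_const _ (hF.comp (by fun_prop))
  simpa only [h1, h2] using h

/-- Random translations pull null sets back to null sets, so averages are defined on almost
everywhere classes. -/
lemma quasiMeasurePreserving_move (ha : ∀ i, 0 < a i) [SFinite μ] :
    Measure.QuasiMeasurePreserving
      (fun z : Space n × Space n × (Fin n → ℝ) => move z.1 z.2.1 z.2.2)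
      ((wMeasure a).prod (μ.prod (angles a))) (wMeasure a) := by
  refine ⟨by fun_prop, Measure.AbsolutelyContinuous.mk fun s hs h0 => ?_⟩
  rw [Measure.map_apply (by fun_prop) hs, ← lintegral_indicator_one (hs.preimage (by fun_prop)),
    lintegral_prod _ (Measurable.aemeasurable
      ((measurable_one.indicator (hs.preimage (by fun_prop)))))]
  have := lintegral_lavg ha (μ := μ) (F := s.indicator 1) (measurable_one.indicator hs)
  rw [lintegral_indicator_one hs, h0, mul_zero] at this
  exact this

lemma avg_congr_ae (ha : ∀ i, 0 < a i) [SFinite μ] {f g : Space n → ℝ} (h : f =ᵐ[wMeasure a] g) :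
    avg a μ f =ᵐ[wMeasure a] avg a μ g := by
  have := Measure.ae_ae_of_ae_prod ((quasiMeasurePreserving_move ha (μ := μ)).ae_eq_comp h)
  exact this.mono fun x hx => integral_congr_ae hx

/-- Hölder's inequality against the constant `1`, in a form that covers `p = 1` and arbitrary total
mass. -/
lemma lintegral_rpow_le_of_one_le {α : Type*} [MeasurableSpace α] {ρ : Measure α}
    {p : ℝ} (hp : 1 ≤ p) {G : α → ℝ≥0∞} (hG : AEMeasurable G ρ) :
    (∫⁻ z, G z ∂ρ) ^ p ≤ ρ univ ^ (p - 1) * ∫⁻ z, G z ^ p ∂ρ := by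
  have hp0 : 0 < p := by linarith
  have h := eLpNorm'_le_eLpNorm'_mul_rpow_measure_univ one_pos hp hG.aestronglyMeasurable
  simp only [eLpNorm', enorm_eq_self, ENNReal.rpow_one, ne_eq, one_ne_zero,
    not_false_eq_true, div_self] at h
  calc _ ≤ _ := ENNReal.rpow_le_rpow h hp0.le
    _ = _ := by
      rw [ENNReal.mul_rpow_of_nonneg _ _ hp0.le, ← ENNReal.rpow_mul, ← ENNReal.rpow_mul,
        one_div_mul_cancel hp0.ne', ENNReal.rpow_one, mul_comm]
      congr 2
      field_simp

/-- Averages of Bessel translations are bounded on `L^p_a`. -/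
lemma lintegral_lavg_rpow_le (ha : ∀ i, 0 < a i) [IsFiniteMeasure μ] {p : ℝ} (hp : 1 ≤ p)
    {F : Space n → ℝ≥0∞} (hF : Measurable F) :
    ∫⁻ x, lavg a μ F x ^ p ∂(wMeasure a) ≤ μ univ ^ p * ∫⁻ x, F x ^ p ∂(wMeasure a) := by
  have := isProbabilityMeasure_angles ha
  have h1 : (μ.prod (angles a)) univ = μ univ := by
    rw [← univ_prod_univ, Measure.prod_prod, measure_univ (μ := angles a), mul_one]
  calc _ ≤ ∫⁻ x, μ univ ^ (p - 1) * lavg a μ (fun y => F y ^ p) x ∂(wMeasure a) := by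
        refine lintegral_mono fun x => ?_
        rw [← h1]
        exact lintegral_rpow_le_of_one_le hp (hF.comp (by fun_prop)).aemeasurable
    _ = _ := by
      rw [lintegral_const_mul _ (by fun_prop), lintegral_lavg ha (by fun_prop), ← mul_assoc]
      congr 1
      by_cases h0 : μ univ = 0
      · rw [h0, mul_zero, ENNReal.zero_rpow_of_pos (by linarith)]
      · nth_rw 2 [← ENNReal.rpow_one (μ univ)]
        rw [← ENNReal.rpow_add _ _ h0 (measure_ne_top _ _), sub_add_cancel]

lemma eLpNorm_le_of_enorm_le_lavg (ha : ∀ i, 0 < a i) [IsFiniteMeasure μ] {p : ℝ≥0} (hp : 1 ≤ p)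
    {f g : Space n → ℝ} (hf : Measurable f)
    (h : ∀ᵐ x ∂(wMeasure a), ‖g x‖ₑ ≤ lavg a μ (fun y => ‖f y‖ₑ) x) :
    eLpNorm g p (wMeasure a) ≤ μ univ * eLpNorm f p (wMeasure a) := by
  have hp0 : (p : ℝ≥0) ≠ 0 := (zero_lt_one.trans_le hp).ne'
  have hp0' : (0 : ℝ) < p := NNReal.coe_pos.2 (pos_iff_ne_zero.2 hp0)
  rw [eLpNorm_nnreal_eq_lintegral hp0, eLpNorm_nnreal_eq_lintegral hp0]
  calc _ ≤ (∫⁻ x, lavg a μ (fun y => ‖f y‖ₑ) x ^ (p : ℝ) ∂(wMeasure a)) ^ (1 / (p : ℝ)) := by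
        gcongr ?_ ^ _
        exact lintegral_mono_ae (h.mono fun x hx => ENNReal.rpow_le_rpow hx p.coe_nonneg)
    _ ≤ (μ univ ^ (p : ℝ) * ∫⁻ x, ‖f x‖ₑ ^ (p : ℝ) ∂(wMeasure a)) ^ (1 / (p : ℝ)) := by
        gcongr ?_ ^ _
        exact lintegral_lavg_rpow_le ha (by exact_mod_cast hp) hf.enorm
    _ = _ := by
        rw [ENNReal.mul_rpow_of_nonneg _ _ (by positivity), ← ENNReal.rpow_mul,
          mul_one_div_cancel hp0'.ne', ENNReal.rpow_one]

lemma eLpNorm_avg_le (ha : ∀ i, 0 < a i) [IsFiniteMeasure μ] {p : ℝ≥0} (hp : 1 ≤ p)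
    {f : Space n → ℝ} (hf : Measurable f) :
    eLpNorm (avg a μ f) p (wMeasure a) ≤ μ univ * eLpNorm f p (wMeasure a) :=
  eLpNorm_le_of_enorm_le_lavg ha hp hf (ae_of_all _ (enorm_avg_le f))

lemma ae_lt_top_lavg (ha : ∀ i, 0 < a i) [IsFiniteMeasure μ] {p : ℝ} (hp : 1 ≤ p)
    {F : Space n → ℝ≥0∞} (hF : Measurable F) (h : ∫⁻ x, F x ^ p ∂(wMeasure a) ≠ ∞) :
    ∀ᵐ x ∂(wMeasure a), lavg a μ F x < ∞ := by
  have h1 : ∫⁻ x, lavg a μ F x ^ p ∂(wMeasure a) ≠ ∞ :=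
    ((lintegral_lavg_rpow_le ha hp hF).trans_lt (ENNReal.mul_lt_top
      (ENNReal.rpow_lt_top_of_nonneg (by linarith) (measure_ne_top _ _)) h.lt_top)).ne
  refine (ae_lt_top (by fun_prop) h1).mono fun x hx => ?_
  exact (ENNReal.rpow_lt_top_iff_of_pos (by linarith)).1 hx

lemma lintegral_enorm_rpow_ne_top {p : ℝ≥0} (hp : 1 ≤ p) {f : Space n → ℝ}
    (h : MemLp f p (wMeasure a)) : ∫⁻ x, ‖f x‖ₑ ^ (p : ℝ) ∂(wMeasure a) ≠ ∞ := by
  have hp0 : (p : ℝ≥0) ≠ 0 := (zero_lt_one.trans_le hp).ne'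
  rw [← eLpNorm_nnreal_pow_eq_lintegral hp0]
  exact ENNReal.rpow_ne_top_of_nonneg p.coe_nonneg h.2.ne

lemma integrable_of_lavg_lt_top {f : Space n → ℝ} (hf : Measurable f) {x : Space n}
    (h : lavg a μ (fun y => ‖f y‖ₑ) x < ∞) :
    Integrable (fun z : Space n × (Fin n → ℝ) => f (move x z.1 z.2)) (μ.prod (angles a)) :=
  ⟨(hf.comp (by fun_prop)).aestronglyMeasurable, h⟩

lemma ae_integrable_move (ha : ∀ i, 0 < a i) [IsFiniteMeasure μ] {p : ℝ≥0} (hp : 1 ≤ p)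
    {f : Space n → ℝ} (hf : Measurable f) (h : MemLp f p (wMeasure a)) :
    ∀ᵐ x ∂(wMeasure a), Integrable (fun z : Space n × (Fin n → ℝ) => f (move x z.1 z.2))
      (μ.prod (angles a)) :=
  (ae_lt_top_lavg ha (p := p) (by exact_mod_cast hp) hf.enorm
    (lintegral_enorm_rpow_ne_top hp h)).mono fun _ hx => integrable_of_lavg_lt_top hf hx

lemma memLp_avg (ha : ∀ i, 0 < a i) [IsFiniteMeasure μ] {p : ℝ≥0} (hp : 1 ≤ p)
    {f : Space n → ℝ} (hf : Measurable f) (h : MemLp f p (wMeasure a)) :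
    MemLp (avg a μ f) p (wMeasure a) :=
  ⟨(measurable_avg hf).aestronglyMeasurable, (eLpNorm_avg_le ha hp hf).trans_lt
    (ENNReal.mul_lt_top (measure_lt_top _ _) h.2)⟩

lemma avg_sub {f g : Space n → ℝ} {x : Space n}
    (hf : Integrable (fun z : Space n × (Fin n → ℝ) => f (move x z.1 z.2)) (μ.prod (angles a)))
    (hg : Integrable (fun z : Space n × (Fin n → ℝ) => g (move x z.1 z.2)) (μ.prod (angles a))) :
    avg a μ (fun y => f y - g y) x = avg a μ f x - avg a μ g x := integral_sub hf hg

lemma avg_const_mul (c : ℝ) (f : Space n → ℝ) (x : Space n) :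
    avg a μ (fun y => c * f y) x = c * avg a μ f x := integral_const_mul _ _

/-- The law of the twice translated point. -/
def law (a : Fin n → ℝ) (μ ν : Measure (Space n)) (x : Space n) : Measure (Space n) :=
  ((μ.prod (angles a)).prod (ν.prod (angles a))).map
    fun z => move (move x z.1.1 z.1.2) z.2.1 z.2.2

lemma lintegral_law [SFinite μ] [SFinite ν] {F : Space n → ℝ≥0∞} (hF : Measurable F)
    (x : Space n) : ∫⁻ y, F y ∂(law a μ ν x) = lavg a μ (lavg a ν F) x := by
  unfold law lavg
  rw [lintegral_map hF (by fun_prop), lintegral_prod _ (Measurable.aemeasurable (by fun_prop))]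

lemma law_comm (ha : ∀ i, 0 < a i) [SFinite μ] [SFinite ν] (x : Space n) :
    law a μ ν x = law a ν μ x := by
  refine Measure.ext_of_lintegral _ fun F hF => ?_
  have key : ∀ (μ ν : Measure (Space n)) [SFinite μ] [SFinite ν], ∫⁻ y, F y ∂(law a μ ν x) =
      ∫⁻ t, ∫⁻ s, ∫⁻ θ, ∫⁻ θ', F (move (move x t θ) s θ') ∂(angles a) ∂(angles a) ∂ν ∂μ := by
    intro μ ν _ _
    rw [lintegral_law hF]
    unfold lavg
    have h1 : Measurable fun z : (Space n × (Fin n → ℝ)) × (Space n × (Fin n → ℝ)) =>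
      F (move (move x z.1.1 z.1.2) z.2.1 z.2.2) := hF.comp (by fun_prop)
    rw [lintegral_prod _ h1.lintegral_prod_right'.aemeasurable]
    refine lintegral_congr fun t => ?_
    have h2 : ∀ θ, ∫⁻ z, F (move (move x t θ) z.1 z.2) ∂(ν.prod (angles a)) =
        ∫⁻ s, ∫⁻ θ', F (move (move x t θ) s θ') ∂(angles a) ∂ν := fun θ =>
      lintegral_prod _ (hF.comp (by fun_prop)).aemeasurable
    simp only [h2]
    rw [lintegral_lintegral_swap]
    have h3 : Measurable fun z : ((Fin n → ℝ) × Space n) × (Fin n → ℝ) =>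
      F (move (move x t z.1.1) z.1.2 z.2) := hF.comp (by fun_prop)
    exact h3.lintegral_prod_right'.aemeasurable
  rw [key μ ν, key ν μ, lintegral_lintegral_swap]
  · refine lintegral_congr fun s => lintegral_congr fun t => ?_
    exact lintegral_move_move_comm ha x t s F hF
  · have h3 : Measurable fun z : ((Space n × Space n) × (Fin n → ℝ)) × (Fin n → ℝ) =>
      F (move (move x z.1.1.1 z.1.2) z.1.1.2 z.2) := hF.comp (by fun_prop)
    exact h3.lintegral_prod_right'.lintegral_prod_right'.aemeasurable

lemma avg_avg_eq [SFinite μ] [SFinite ν] {f : Space n → ℝ} (hf : Measurable f) {x : Space n}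
    (h : lavg a μ (lavg a ν fun y => ‖f y‖ₑ) x < ∞) :
    avg a μ (avg a ν f) x = ∫ y, f y ∂(law a μ ν x) := by
  unfold law
  rw [integral_map (by fun_prop) hf.aestronglyMeasurable, integral_prod]
  · rfl
  · refine ⟨(hf.comp (by fun_prop)).aestronglyMeasurable, ?_⟩
    rw [HasFiniteIntegral, lintegral_prod _ (Measurable.aemeasurable (by fun_prop))]
    exact h

lemma avg_comm_of_lt_top (ha : ∀ i, 0 < a i) [SFinite μ] [SFinite ν] {f : Space n → ℝ}
    (hf : Measurable f) {x : Space n} (h : lavg a μ (lavg a ν fun y => ‖f y‖ₑ) x < ∞) :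
    avg a μ (avg a ν f) x = avg a ν (avg a μ f) x := by
  rw [avg_avg_eq hf h, avg_avg_eq hf, law_comm ha]
  rwa [← lintegral_law hf.enorm, law_comm ha, lintegral_law hf.enorm]

/-- Averages of Bessel translations commute on `L^p_a`. -/
lemma avg_comm (ha : ∀ i, 0 < a i) [IsFiniteMeasure μ] [IsFiniteMeasure ν] {p : ℝ≥0} (hp : 1 ≤ p)
    {f : Space n → ℝ} (hf : Measurable f) (h : MemLp f p (wMeasure a)) :
    avg a μ (avg a ν f) =ᵐ[wMeasure a] avg a ν (avg a μ f) := by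
  have hp' : (1 : ℝ) ≤ p := by exact_mod_cast hp
  have h1 : ∫⁻ x, lavg a ν (fun y => ‖f y‖ₑ) x ^ (p : ℝ) ∂(wMeasure a) ≠ ∞ :=
    ((lintegral_lavg_rpow_le ha hp' hf.enorm).trans_lt (ENNReal.mul_lt_top
      (ENNReal.rpow_lt_top_of_nonneg (by linarith) (measure_ne_top _ _))
      (lintegral_enorm_rpow_ne_top hp h).lt_top)).ne
  exact (ae_lt_top_lavg (μ := μ) ha hp' (by fun_prop) h1).mono
    fun x hx => avg_comm_of_lt_top ha hf hx
end

end

section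

/-! ### Averages that concentrate at the origin -/

variable {n : ℕ}

/-- The triangle inequality: the third side differs from one side by at most the other. -/
lemma abs_chord_sub_le {x : ℝ} (hx : 0 ≤ x) (t θ : ℝ) : |chord x t θ - x| ≤ |t| := by
  have h1 := chord_le x t θ
  rw [abs_of_nonneg hx] at h1
  have h3 : |2 * x * t * Real.cos θ| ≤ 2 * x * |t| := by
    rw [abs_mul, abs_mul, abs_mul, abs_two, abs_of_nonneg hx]
    exact mul_le_of_le_one_right (by positivity) (Real.abs_cos_le_one θ)
  have h2 : x - |t| ≤ chord x t θ := by
    refine Real.le_sqrt_of_sq_le ?_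
    nlinarith [le_abs_self (2 * x * t * Real.cos θ), sq_abs t]
  rw [abs_le]; constructor <;> linarith

lemma norm_move_sub_le {x : Space n} (hx : x ∈ orthant n) (t : Space n) (θ : Fin n → ℝ) :
    ‖move x t θ - x‖ ≤ ‖t‖ := by
  rw [EuclideanSpace.norm_eq, EuclideanSpace.norm_eq]
  refine Real.sqrt_le_sqrt (Finset.sum_le_sum fun i _ => ?_)
  simp only [move, PiLp.sub_apply, Real.norm_eq_abs]
  exact pow_le_pow_left₀ (abs_nonneg _) (abs_chord_sub_le (hx i).le _ _) 2

section
variable {a : Fin n → ℝ}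

lemma continuous_weight (ha : ∀ i, 0 < a i) : Continuous (weight a) := by
  unfold weight
  refine continuous_finsetProd _ fun i _ => ?_
  exact (Real.continuous_rpow_const (ha i).le).comp (by fun_prop)

lemma isLocallyFiniteMeasure_wMeasure (ha : ∀ i, 0 < a i) :
    IsLocallyFiniteMeasure (wMeasure a) := by
  unfold wMeasure
  exact IsLocallyFiniteMeasure.withDensity_ofReal (continuous_weight ha)

lemma measurePreserving_move (ha : ∀ i, 0 < a i) (t : Space n) :
    MeasurePreserving (fun z : Space n × (Fin n → ℝ) => move z.1 t z.2)
      ((wMeasure a).prod (angles a)) (wMeasure a) := by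
  refine ⟨by fun_prop, Measure.ext_of_lintegral _ fun F hF => ?_⟩
  have := isProbabilityMeasure_angles ha
  rw [lintegral_map hF (by fun_prop), lintegral_prod _ (Measurable.aemeasurable (by fun_prop)),
    lintegral_move_swap ha t (fun z => F z.2) (by fun_prop)]
  simp

lemma measurePreserving_fst_angles (ha : ∀ i, 0 < a i) :
    MeasurePreserving (Prod.fst : Space n × (Fin n → ℝ) → Space n)
      ((wMeasure a).prod (angles a)) (wMeasure a) := by
  have := isProbabilityMeasure_angles ha
  exact measurePreserving_fst

/-- The `L^p` distance between `f` at a point and `f` at its random translation by `t`; it bounds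
the distance of `f` to its Bessel translation. -/
def gap (a : Fin n → ℝ) (p : ℝ≥0) (f : Space n → ℝ) (t : Space n) : ℝ≥0∞ :=
  eLpNorm (fun z : Space n × (Fin n → ℝ) => f z.1 - f (move z.1 t z.2)) p
    ((wMeasure a).prod (angles a))

lemma gap_le_add (ha : ∀ i, 0 < a i) {p : ℝ≥0} (hp : 1 ≤ p) {f g : Space n → ℝ}
    (hf : Measurable f) (hg : Measurable g) (t : Space n) :
    gap a p f t ≤ gap a p g t + 2 * eLpNorm (f - g) p (wMeasure a) := by
  have hp' : (1 : ℝ≥0∞) ≤ p := by exact_mod_cast hp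
  have hs : AEStronglyMeasurable (f - g) (wMeasure a) := (hf.sub hg).aestronglyMeasurable
  have e1 := eLpNorm_comp_measurePreserving (p := (p : ℝ≥0∞)) hs (measurePreserving_fst_angles ha)
  have e2 := eLpNorm_comp_measurePreserving (p := (p : ℝ≥0∞)) hs (measurePreserving_move ha t)
  unfold gap
  have : (fun z : Space n × (Fin n → ℝ) => f z.1 - f (move z.1 t z.2)) =
      (fun z => g z.1 - g (move z.1 t z.2)) + (((f - g) ∘ Prod.fst) -
        ((f - g) ∘ fun z => move z.1 t z.2)) := by
    ext z; simp only [Pi.add_apply, Pi.sub_apply, Function.comp_apply]; ring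
  rw [this]
  refine (eLpNorm_add_le (Measurable.aestronglyMeasurable (by fun_prop))
    (Measurable.aestronglyMeasurable (by fun_prop)) hp').trans ?_
  gcongr
  refine (eLpNorm_sub_le (Measurable.aestronglyMeasurable (by fun_prop))
    (Measurable.aestronglyMeasurable (by fun_prop)) hp').trans ?_
  rw [e1, e2, two_mul]

lemma gap_le (ha : ∀ i, 0 < a i) {p : ℝ≥0} (hp : 1 ≤ p) {f : Space n → ℝ}
    (hf : Measurable f) (t : Space n) : gap a p f t ≤ 2 * eLpNorm f p (wMeasure a) := by
  have := gap_le_add ha hp hf (g := 0) measurable_zero t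
  simpa [gap] using this

lemma exists_gap_le_of_hasCompactSupport (ha : ∀ i, 0 < a i) {p : ℝ≥0} (hp : 1 ≤ p)
    {g : Space n → ℝ} (hg : Continuous g) (hgs : HasCompactSupport g) {ε : ℝ≥0∞} (hε : ε ≠ 0) :
    ∃ r > 0, ∀ t : Space n, ‖t‖ ≤ r → gap a p g t ≤ ε := by
  have := isLocallyFiniteMeasure_wMeasure ha
  have := isProbabilityMeasure_angles ha
  have hp0 : (p : ℝ≥0∞) ≠ 0 := by simpa using (zero_lt_one.trans_le hp).ne'
  obtain ⟨R, hR⟩ := hgs.isCompact.isBounded.subset_closedBall 0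
  set B : Set (Space n × (Fin n → ℝ)) := Metric.closedBall 0 (R + 1) ×ˢ univ
  have hB : ((wMeasure a).prod (angles a)) B < ∞ := by
    rw [Measure.prod_prod, measure_univ, mul_one]
    exact (isCompact_closedBall _ _).measure_lt_top
  set K := ((wMeasure a).prod (angles a)) B ^ (1 / (p : ℝ))
  have hK : K < ∞ := ENNReal.rpow_lt_top_of_nonneg (by positivity) hB.ne
  obtain ⟨δ, hδ, hδK⟩ : ∃ δ : ℝ, 0 < δ ∧ ENNReal.ofReal δ * K ≤ ε := by
    obtain ⟨δ, hδ, h⟩ := ENNReal.exists_nnreal_pos_mul_lt hK.ne hε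
    exact ⟨δ, by exact_mod_cast hδ, by rw [ENNReal.ofReal_coe_nnreal]; exact h.le⟩
  obtain ⟨r, hr, hr'⟩ := Metric.uniformContinuous_iff.1
    (hg.uniformContinuous_of_tendsto_cocompact (x := 0) hgs.is_zero_at_infty) δ hδ
  refine ⟨min (r / 2) 1, by positivity, fun t ht => ?_⟩
  have hae : ∀ᵐ z ∂((wMeasure a).prod (angles a)), z.1 ∈ orthant n :=
    (measurePreserving_fst_angles ha).quasiMeasurePreserving.ae (ae_mem_orthant a)
  calc gap a p g t ≤ eLpNorm (B.indicator fun _ => δ) p ((wMeasure a).prod (angles a)) := by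
        refine eLpNorm_mono_ae (hae.mono fun z hz => ?_)
        have hm := (norm_move_sub_le hz t z.2).trans ht
        by_cases hzB : z ∈ B
        · rw [indicator_of_mem hzB, Real.norm_of_nonneg hδ.le, ← dist_eq_norm]
          refine (hr' ?_).le
          rw [dist_comm, dist_eq_norm]
          exact hm.trans_lt ((min_le_left _ _).trans_lt (by linarith))
        · have hz1 : R + 1 < ‖z.1‖ := by
            by_contra h
            exact hzB ⟨by simpa using h, trivial⟩
          have h0 : ∀ w : Space n, R < ‖w‖ → g w = 0 := fun w hw => by
            refine image_eq_zero_of_notMem_tsupport fun hmem => ?_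
            have := hR hmem
            rw [mem_closedBall_zero_iff] at this
            linarith
          have h2 : R < ‖move z.1 t z.2‖ := by
            have := norm_sub_norm_le z.1 (move z.1 t z.2)
            rw [norm_sub_rev] at this
            have := hm.trans (min_le_right _ _)
            linarith
          rw [h0 z.1 (by linarith), h0 _ h2, indicator_of_notMem hzB, sub_self]
    _ = ENNReal.ofReal δ * K := by
        rw [eLpNorm_indicator_const (Metric.isClosed_closedBall.measurableSet.prod
          MeasurableSet.univ) hp0 ENNReal.coe_ne_top, ENNReal.coe_toReal,
          Real.enorm_of_nonneg hδ.le]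
    _ ≤ ε := hδK

/-- Strong continuity at `0` of the Bessel translations in `L^p_a`. -/
lemma exists_gap_le (ha : ∀ i, 0 < a i) {p : ℝ≥0} (hp : 1 ≤ p) {f : Space n → ℝ}
    (hf : Measurable f) (hfp : MemLp f p (wMeasure a)) {ε : ℝ≥0∞} (hε : ε ≠ 0) :
    ∃ r > 0, ∀ t : Space n, ‖t‖ ≤ r → gap a p f t ≤ ε := by
  have := isLocallyFiniteMeasure_wMeasure ha
  have hε2 : ε / 2 / 2 ≠ 0 := by simp [ENNReal.div_eq_zero_iff, hε]
  obtain ⟨g, hgs, hfg, hg, -⟩ := hfp.exists_hasCompactSupport_eLpNorm_sub_le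
    ENNReal.coe_ne_top hε2
  obtain ⟨r, hr, h⟩ := exists_gap_le_of_hasCompactSupport ha hp hg hgs
    (ε := ε / 2) (by simp [ENNReal.div_eq_zero_iff, hε])
  refine ⟨r, hr, fun t ht => (gap_le_add ha hp hf hg.measurable t).trans ?_⟩
  calc _ ≤ ε / 2 + 2 * (ε / 2 / 2) := by gcongr; exact h t ht
    _ = ε := by rw [ENNReal.mul_div_cancel (by norm_num) (by norm_num), ENNReal.add_halves]

/-- Jensen's inequality for the mean over the translations. -/
lemma eLpNorm_sub_avg_rpow_le (ha : ∀ i, 0 < a i) {μ : Measure (Space n)}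
    [IsProbabilityMeasure μ] {p : ℝ≥0} (hp : 1 ≤ p) {f : Space n → ℝ}
    (hf : Measurable f) (hfp : MemLp f p (wMeasure a)) :
    eLpNorm (fun x => f x - avg a μ f x) p (wMeasure a) ^ (p : ℝ) ≤
      ∫⁻ t, gap a p f t ^ (p : ℝ) ∂μ := by
  have := isProbabilityMeasure_angles ha
  have hp0 : p ≠ 0 := (zero_lt_one.trans_le hp).ne'
  unfold gap
  simp_rw [eLpNorm_nnreal_pow_eq_lintegral hp0]
  calc _ ≤ ∫⁻ x, ∫⁻ z, ‖f x - f (move x z.1 z.2)‖ₑ ^ (p : ℝ) ∂(μ.prod (angles a))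
        ∂(wMeasure a) := by
        refine lintegral_mono_ae ((ae_integrable_move (μ := μ) ha hp hf hfp).mono fun x hx => ?_)
        have h1 : f x - avg a μ f x = ∫ z, (f x - f (move x z.1 z.2)) ∂(μ.prod (angles a)) := by
          rw [integral_sub (integrable_const _) hx]
          simp [avg]
        rw [h1]
        have h2 := lintegral_rpow_le_of_one_le (ρ := μ.prod (angles a)) (p := p)
          (by exact_mod_cast hp) (G := fun z => ‖f x - f (move x z.1 z.2)‖ₑ)
          (Measurable.aemeasurable (by fun_prop))
        rw [measure_univ, ENNReal.one_rpow, one_mul] at h2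
        exact (ENNReal.rpow_le_rpow (enorm_integral_le_lintegral_enorm _) p.coe_nonneg).trans h2
    _ = _ := by
        have h3 : Measurable fun z : (Space n × Space n) × (Fin n → ℝ) =>
          ‖f z.1.1 - f (move z.1.1 z.1.2 z.2)‖ₑ ^ (p : ℝ) := by fun_prop
        have h4 : ∀ x, ∫⁻ z, ‖f x - f (move x z.1 z.2)‖ₑ ^ (p : ℝ) ∂(μ.prod (angles a)) =
            ∫⁻ t, ∫⁻ θ, ‖f x - f (move x t θ)‖ₑ ^ (p : ℝ) ∂(angles a) ∂μ := fun x =>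
          lintegral_prod _ (Measurable.aemeasurable (by fun_prop))
        simp_rw [h4]
        rw [lintegral_lintegral_swap h3.lintegral_prod_right'.aemeasurable]
        refine lintegral_congr fun t => ?_
        rw [lintegral_prod _ (Measurable.aemeasurable (by fun_prop))]

/-- Averages over translations that concentrate at `0` are an approximate identity in `L^p_a`. -/
lemma tendsto_eLpNorm_sub_avg (ha : ∀ i, 0 < a i) {μ : ℕ → Measure (Space n)}
    [∀ j, IsProbabilityMeasure (μ j)]
    (hμ : ∀ r > 0, Filter.Tendsto (fun j => μ j {t | r < ‖t‖}) Filter.atTop (nhds 0))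
    {p : ℝ≥0} (hp : 1 ≤ p) {f : Space n → ℝ}
    (hf : Measurable f) (hfp : MemLp f p (wMeasure a)) :
    Filter.Tendsto (fun j => eLpNorm (fun x => f x - avg a (μ j) f x) p (wMeasure a))
      Filter.atTop (nhds 0) := by
  have hp0 : (0 : ℝ) < p := NNReal.coe_pos.2 (zero_lt_one.trans_le hp)
  suffices h : Filter.Tendsto (fun j =>
      eLpNorm (fun x => f x - avg a (μ j) f x) p (wMeasure a) ^ (p : ℝ))
      Filter.atTop (nhds 0) by
    have h2 := h.ennrpow_const (1 / (p : ℝ))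
    simpa only [← ENNReal.rpow_mul, mul_one_div_cancel hp0.ne', ENNReal.rpow_one,
      ENNReal.zero_rpow_of_pos (one_div_pos.2 hp0)] using h2
  set B : ℝ≥0∞ := (2 * eLpNorm f p (wMeasure a)) ^ (p : ℝ)
  have hB : B ≠ ∞ := ENNReal.rpow_ne_top_of_nonneg p.coe_nonneg
    (ENNReal.mul_ne_top (by norm_num) hfp.2.ne)
  refine ENNReal.tendsto_nhds_zero.2 fun ε hε => ?_
  have hε2 : (ε / 2) ^ (1 / (p : ℝ)) ≠ 0 := by
    have : 0 < (p : ℝ)⁻¹ := by positivity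
    simp [ENNReal.rpow_eq_zero_iff, hε.ne', hp0, this.not_gt, ENNReal.div_eq_zero_iff]
  obtain ⟨r, hr, h⟩ := exists_gap_le ha hp hf hfp hε2
  have h3 := ENNReal.Tendsto.const_mul (a := B) (hμ r hr) (Or.inr hB)
  rw [mul_zero] at h3
  filter_upwards [ENNReal.tendsto_nhds_zero.1 h3 (ε / 2) (ENNReal.half_pos hε.ne')] with j hj
  have hms : MeasurableSet {t : Space n | r < ‖t‖} := measurableSet_lt measurable_const (by fun_prop)
  calc _ ≤ ∫⁻ t, gap a p f t ^ (p : ℝ) ∂(μ j) := eLpNorm_sub_avg_rpow_le ha hp hf hfp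
    _ ≤ ∫⁻ t, (ε / 2 + {t : Space n | r < ‖t‖}.indicator (fun _ => B) t) ∂(μ j) := by
        refine lintegral_mono fun t => ?_
        by_cases ht : r < ‖t‖
        · rw [indicator_of_mem (show t ∈ {t : Space n | r < ‖t‖} from ht)]
          exact (ENNReal.rpow_le_rpow (gap_le ha hp hf t) p.coe_nonneg).trans le_add_self
        · refine le_trans ?_ le_self_add
          have := ENNReal.rpow_le_rpow (h t (not_lt.1 ht)) p.coe_nonneg
          rwa [← ENNReal.rpow_mul, one_div_mul_cancel hp0.ne', ENNReal.rpow_one] at this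
    _ = ε / 2 + B * μ j {t | r < ‖t‖} := by
        rw [lintegral_add_left measurable_const, lintegral_const, measure_univ, mul_one,
          lintegral_indicator_const hms]
    _ ≤ ε / 2 + ε / 2 := by gcongr
    _ = ε := ENNReal.add_halves ε
end

end

section

/-! ### The Bessel convolution -/

variable {n : ℕ}

/-- The Bessel convolution `∫ f(y) T^x h(y) y ^ a dy`. -/
def conv (a : Fin n → ℝ) (f h : Space n → ℝ) (x : Space n) : ℝ :=
  ∫ y, f y * translation a x h y ∂(wMeasure a)

section
variable {a : Fin n → ℝ} {μ : Measure (Space n)}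

lemma measurable_translation_uncurry (ha : ∀ i, 0 < a i) {h : Space n → ℝ} (hh : Measurable h) :
    Measurable fun z : Space n × Space n => translation a z.1 h z.2 := by
  simp_rw [translation_eq ha]
  have h1 : StronglyMeasurable fun z : (Space n × Space n) × (Fin n → ℝ) =>
      h (move z.1.2 z.1.1 z.2) := (hh.comp (by fun_prop)).stronglyMeasurable
  exact h1.integral_prod_right'.measurable

lemma measurable_translation (ha : ∀ i, 0 < a i) (x : Space n) {h : Space n → ℝ}
    (hh : Measurable h) : Measurable (translation a x h) :=
  (measurable_translation_uncurry ha hh).comp measurable_prodMk_left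

lemma measurable_conv (ha : ∀ i, 0 < a i) {f h : Space n → ℝ} (hf : Measurable f)
    (hh : Measurable h) : Measurable (conv a f h) := by
  have h1 : StronglyMeasurable fun z : Space n × Space n => f z.2 * translation a z.1 h z.2 :=
    ((hf.comp measurable_snd).mul (measurable_translation_uncurry ha hh)).stronglyMeasurable
  exact h1.integral_prod_right'.measurable

lemma enorm_translation_le (ha : ∀ i, 0 < a i) (x : Space n) {h : Space n → ℝ}
    (hh : Measurable h) (y : Space n) :
    ‖translation a x h y‖ₑ ≤ lavg a (Measure.dirac x) (fun z => ‖h z‖ₑ) y := by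
  rw [← avg_dirac ha x hh]; exact enorm_avg_le _ _

/-- The convolution of nonnegative functions is an average of translations of one factor, weighted
by the other. -/
lemma lintegral_mul_lavg_dirac_eq (ha : ∀ i, 0 < a i) {F H : Space n → ℝ≥0∞}
    (hF : Measurable F) (hH : Measurable H) (x : Space n) :
    ∫⁻ y, F y * lavg a (Measure.dirac x) H y ∂(wMeasure a) =
      lavg a ((wMeasure a).withDensity H) F x := by
  rw [lintegral_mul_lavg_dirac ha x hF hH, lavg_eq hF, lintegral_withDensity_eq_lintegral_mul _ hH]
  · simp_rw [fun y => lavg_dirac_comm (a := a) y x hF]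
    exact lintegral_congr fun y => mul_comm _ _
  · have h1 : Measurable fun z : Space n × (Fin n → ℝ) => F (move x z.1 z.2) :=
      hF.comp (by fun_prop)
    simp_rw [lavg_dirac _ hF]
    exact h1.lintegral_prod_right'

lemma lintegral_enorm_mul_translation_le (ha : ∀ i, 0 < a i) {f h : Space n → ℝ}
    (hf : Measurable f) (hh : Measurable h) (x : Space n) :
    ∫⁻ y, ‖f y * translation a x h y‖ₑ ∂(wMeasure a) ≤
      lavg a ((wMeasure a).withDensity fun y => ‖h y‖ₑ) (fun y => ‖f y‖ₑ) x := by
  rw [← lintegral_mul_lavg_dirac_eq ha hf.enorm hh.enorm]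
  refine lintegral_mono fun y => ?_
  rw [enorm_mul]
  gcongr
  exact enorm_translation_le ha x hh y

lemma integrable_mul_translation (ha : ∀ i, 0 < a i) {f h : Space n → ℝ}
    (hf : Measurable f) (hh : Measurable h) {x : Space n}
    (hx : lavg a ((wMeasure a).withDensity fun y => ‖h y‖ₑ) (fun y => ‖f y‖ₑ) x < ∞) :
    Integrable (fun y => f y * translation a x h y) (wMeasure a) :=
  ⟨(hf.mul (measurable_translation ha x hh)).aestronglyMeasurable,
    (lintegral_enorm_mul_translation_le ha hf hh x).trans_lt hx⟩

lemma isFiniteMeasure_withDensity_enorm {h : Space n → ℝ} (hh : Integrable h (wMeasure a)) :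
    IsFiniteMeasure ((wMeasure a).withDensity fun y => ‖h y‖ₑ) :=
  isFiniteMeasure_withDensity hh.2.ne

lemma withDensity_enorm_univ (h : Space n → ℝ) :
    ((wMeasure a).withDensity fun y => ‖h y‖ₑ) univ = eLpNorm h 1 (wMeasure a) := by
  rw [withDensity_apply _ MeasurableSet.univ, Measure.restrict_univ, eLpNorm_one_eq_lintegral_enorm]

/-- The integral that defines the convolution converges absolutely at almost every point. -/
lemma ae_lt_top_conv (ha : ∀ i, 0 < a i) {p : ℝ≥0} (hp : 1 ≤ p) {f h : Space n → ℝ}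
    (hf : Measurable f) (hfp : MemLp f p (wMeasure a)) (hi : Integrable h (wMeasure a)) :
    ∀ᵐ x ∂(wMeasure a),
      lavg a ((wMeasure a).withDensity fun y => ‖h y‖ₑ) (fun y => ‖f y‖ₑ) x < ∞ := by
  have := isFiniteMeasure_withDensity_enorm hi
  exact ae_lt_top_lavg ha (p := p) (by exact_mod_cast hp) hf.enorm
    (lintegral_enorm_rpow_ne_top hp hfp)

/-- Young's inequality `‖f * h‖_p ≤ ‖h‖_1 ‖f‖_p` for the Bessel convolution. -/
lemma eLpNorm_conv_le (ha : ∀ i, 0 < a i) {p : ℝ≥0} (hp : 1 ≤ p) {f h : Space n → ℝ}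
    (hf : Measurable f) (hh : Measurable h) (hi : Integrable h (wMeasure a)) :
    eLpNorm (conv a f h) p (wMeasure a) ≤
      eLpNorm h 1 (wMeasure a) * eLpNorm f p (wMeasure a) := by
  have := isFiniteMeasure_withDensity_enorm hi
  rw [← withDensity_enorm_univ]
  refine eLpNorm_le_of_enorm_le_lavg ha hp hf (ae_of_all _ fun x => ?_)
  exact (enorm_integral_le_lintegral_enorm _).trans (lintegral_enorm_mul_translation_le ha hf hh x)

lemma memLp_conv (ha : ∀ i, 0 < a i) {p : ℝ≥0} (hp : 1 ≤ p) {f h : Space n → ℝ}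
    (hf : Measurable f) (hfp : MemLp f p (wMeasure a)) (hh : Measurable h)
    (hi : Integrable h (wMeasure a)) : MemLp (conv a f h) p (wMeasure a) := by
  refine ⟨(measurable_conv ha hf hh).aestronglyMeasurable,
    (eLpNorm_conv_le ha hp hf hh hi).trans_lt (ENNReal.mul_lt_top ?_ hfp.2)⟩
  rw [eLpNorm_one_eq_lintegral_enorm]; exact hi.2

lemma conv_sub_left (ha : ∀ i, 0 < a i) {p : ℝ≥0} (hp : 1 ≤ p) {f g h : Space n → ℝ}
    (hf : Measurable f) (hfp : MemLp f p (wMeasure a)) (hg : Measurable g)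
    (hgp : MemLp g p (wMeasure a)) (hh : Measurable h) (hi : Integrable h (wMeasure a)) :
    conv a (fun x => f x - g x) h =ᵐ[wMeasure a] fun x => conv a f h x - conv a g h x := by
  filter_upwards [ae_lt_top_conv ha hp hf hfp hi, ae_lt_top_conv ha hp hg hgp hi] with x h1 h2
  unfold conv
  rw [← integral_sub (integrable_mul_translation ha hf hh h1)
    (integrable_mul_translation ha hg hh h2)]
  simp_rw [sub_mul]

/-- The signed form of reversibility. -/
lemma integral_move_swap (ha : ∀ i, 0 < a i) (t : Space n) {G : Space n × Space n → ℝ}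
    (hG : Measurable G) :
    ∫ z, G (z.1, move z.1 t z.2) ∂((wMeasure a).prod (angles a)) =
      ∫ z, G (move z.1 t z.2, z.1) ∂((wMeasure a).prod (angles a)) := by
  have h : ((wMeasure a).prod (angles a)).map (fun z => (z.1, move z.1 t z.2)) =
      ((wMeasure a).prod (angles a)).map (fun z => (move z.1 t z.2, z.1)) := by
    refine Measure.ext_of_lintegral _ fun F hF => ?_
    rw [lintegral_map hF (by fun_prop), lintegral_map hF (by fun_prop),
      lintegral_prod _ (Measurable.aemeasurable (by fun_prop)),
      lintegral_prod _ (Measurable.aemeasurable (by fun_prop)), lintegral_move_swap ha t F hF]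
  have h1 := integral_map (μ := (wMeasure a).prod (angles a))
    (φ := fun z => (z.1, move z.1 t z.2)) (f := G) (by fun_prop) hG.aestronglyMeasurable
  have h2 := integral_map (μ := (wMeasure a).prod (angles a))
    (φ := fun z => (move z.1 t z.2, z.1)) (f := G) (by fun_prop) hG.aestronglyMeasurable
  rw [← h1, ← h2, h]

/-- Convolution with a nonnegative kernel is an average of Bessel translations. -/
lemma conv_eq_avg (ha : ∀ i, 0 < a i) {f h : Space n → ℝ} (hf : Measurable f)
    (hh : Measurable h) (h0 : ∀ y, 0 ≤ h y) {x : Space n}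
    (hx : lavg a ((wMeasure a).withDensity fun y => ‖h y‖ₑ) (fun y => ‖f y‖ₑ) x < ∞) :
    conv a f h x = avg a ((wMeasure a).withDensity fun y => ‖h y‖ₑ) f x := by
  have hint : Integrable (fun z : Space n × (Fin n → ℝ) => f z.1 * h (move z.1 x z.2))
      ((wMeasure a).prod (angles a)) := by
    refine ⟨Measurable.aestronglyMeasurable (by fun_prop), ?_⟩
    rw [HasFiniteIntegral, lintegral_prod _ (Measurable.aemeasurable (by fun_prop))]
    rw [← lintegral_mul_lavg_dirac_eq ha hf.enorm hh.enorm] at hx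
    refine (le_of_eq (lintegral_congr fun y => ?_)).trans_lt hx
    rw [lavg_dirac _ hh.enorm, ← lintegral_const_mul _ (by fun_prop)]
    simp_rw [enorm_mul]
  have h1 : conv a f h x = ∫ z, f z.1 * h (move z.1 x z.2) ∂((wMeasure a).prod (angles a)) := by
    rw [integral_prod _ hint]
    unfold conv
    simp_rw [translation_eq ha, integral_const_mul]
  rw [h1, integral_move_swap ha x (G := fun z => f z.1 * h z.2) (by fun_prop)]
  unfold avg
  rw [prod_withDensity_left hh.enorm, integral_withDensity_eq_integral_toReal_smul
    (by fun_prop) (ae_of_all _ fun _ => enorm_lt_top)]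
  refine integral_congr_ae (ae_of_all _ fun z => ?_)
  simp only [toReal_enorm, smul_eq_mul, Real.norm_of_nonneg (h0 _), move_comm x z.1]
  ring

/-- Duality for the Bessel convolution. -/
lemma integral_conv_mul (ha : ∀ i, 0 < a i) {f h φ : Space n → ℝ} (hf : Measurable f)
    (hfi : Integrable f (wMeasure a)) (hh : Measurable h) (hi : Integrable h (wMeasure a))
    (hφ : Measurable φ) {C : ℝ} (hC : ∀ x, |φ x| ≤ C) :
    ∫ x, conv a f h x * φ x ∂(wMeasure a) = ∫ y, f y * conv a φ h y ∂(wMeasure a) := by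
  have hint : Integrable (fun z : Space n × Space n => f z.2 * translation a z.1 h z.2 * φ z.1)
      ((wMeasure a).prod (wMeasure a)) := by
    refine Integrable.mul_bdd (c := C) ?_
      (hφ.comp measurable_fst).aestronglyMeasurable (ae_of_all _ fun z => hC z.1)
    have hm : Measurable fun z : Space n × Space n => f z.2 * translation a z.1 h z.2 :=
      (hf.comp measurable_snd).mul (measurable_translation_uncurry ha hh)
    refine ⟨hm.aestronglyMeasurable, ?_⟩
    rw [HasFiniteIntegral, lintegral_prod _ hm.enorm.aemeasurable]
    have := isFiniteMeasure_withDensity_enorm hi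
    calc _ ≤ ∫⁻ x, lavg a ((wMeasure a).withDensity fun y => ‖h y‖ₑ) (fun y => ‖f y‖ₑ) x
          ∂(wMeasure a) := lintegral_mono fun x => lintegral_enorm_mul_translation_le ha hf hh x
      _ = _ := lintegral_lavg ha hf.enorm
      _ < ∞ := ENNReal.mul_lt_top (measure_lt_top _ _) hfi.2
  have h1 : ∀ x, conv a f h x * φ x =
      ∫ y, f y * translation a x h y * φ x ∂(wMeasure a) := fun x =>
    (integral_mul_const _ _).symm
  have h2 : ∀ y, f y * conv a φ h y =
      ∫ x, f y * translation a x h y * φ x ∂(wMeasure a) := fun y => by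
    unfold conv
    rw [← integral_const_mul]
    refine integral_congr_ae (ae_of_all _ fun x => ?_)
    simp only [translation_comm ha x y h]; ring
  simp_rw [h1, h2]
  exact integral_integral_swap hint

lemma lavg_le_of_bounded (ha : ∀ i, 0 < a i) [IsFiniteMeasure μ] {h : Space n → ℝ} {C : ℝ}
    (hC : ∀ x, |h x| ≤ C) (x : Space n) : lavg a μ (fun y => ‖h y‖ₑ) x ≤ ENNReal.ofReal C * μ univ := by
  have := isProbabilityMeasure_angles ha
  unfold lavg
  calc _ ≤ ∫⁻ z, ENNReal.ofReal C ∂(μ.prod (angles a)) := by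
        refine lintegral_mono fun z => ?_
        simp only [← ofReal_norm]
        exact ENNReal.ofReal_le_ofReal (hC _)
    _ = _ := by
        rw [lintegral_const, ← univ_prod_univ, Measure.prod_prod, measure_univ (μ := angles a),
          mul_one]

/-- Averages of Bessel translations may be moved to the second factor of a convolution. -/
lemma avg_conv (ha : ∀ i, 0 < a i) [IsFiniteMeasure μ] {f h : Space n → ℝ} (hf : Measurable f)
    (hh : Measurable h) {C : ℝ} (hC : ∀ x, |h x| ≤ C) {x : Space n}
    (hx : lavg a μ (lavg a ((wMeasure a).withDensity fun y => ‖h y‖ₑ) fun y => ‖f y‖ₑ) x < ∞) :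
    avg a μ (conv a f h) x = conv a f (avg a μ h) x := by
  -- Of the translated kernel only the joint measurability enters the exchange of the integrals.
  obtain ⟨T, hT⟩ : ∃ T : Space n × Space n → ℝ, ∀ x y, translation a x h y = T (x, y) :=
    ⟨fun z => translation a z.1 h z.2, fun _ _ => rfl⟩
  have hTm : Measurable T := by
    have := measurable_translation_uncurry ha hh
    simp only [hT] at this
    exact this
  have hint : Integrable (fun z : (Space n × (Fin n → ℝ)) × Space n =>
      f z.2 * T (move x z.1.1 z.1.2, z.2)) ((μ.prod (angles a)).prod (wMeasure a)) := by
    refine ⟨Measurable.aestronglyMeasurable (by fun_prop), ?_⟩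
    rw [HasFiniteIntegral, lintegral_prod _ (Measurable.aemeasurable (by fun_prop))]
    refine (lintegral_mono fun z => ?_).trans_lt hx
    simp only [← hT]
    exact lintegral_enorm_mul_translation_le ha hf hh _
  have hsw : avg a μ (conv a f h) x = ∫ y, ∫ z, f y * translation a (move x z.1 z.2) h y
      ∂(μ.prod (angles a)) ∂(wMeasure a) := by
    unfold avg conv
    simp only [hT]
    exact integral_integral_swap hint
  rw [hsw]
  refine integral_congr_ae (ae_of_all _ fun y => ?_)
  simp only
  rw [integral_const_mul]
  congr 1
  have h1 : ∫ z, translation a (move x z.1 z.2) h y ∂(μ.prod (angles a)) =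
      avg a μ (avg a (Measure.dirac y) h) x := by
    have h4 : ∀ w, translation a w h y = avg a (Measure.dirac y) h w := fun w => by
      rw [avg_dirac ha y hh, translation_comm ha]
    simp only [h4]
    rfl
  have h2 : Measurable (avg a μ h) := measurable_avg hh
  rw [h1, avg_comm_of_lt_top ha hh, avg_dirac ha y h2, translation_comm ha]
  · have h3 : ∀ w, lavg a (Measure.dirac y) (fun y => ‖h y‖ₑ) w ≤ ENNReal.ofReal C := fun w => by
      simpa using lavg_le_of_bounded (μ := Measure.dirac y) ha hC w
    have := isProbabilityMeasure_angles ha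
    calc _ ≤ ∫⁻ z, ENNReal.ofReal C ∂(μ.prod (angles a)) := lintegral_mono fun z => h3 _
      _ < ∞ := by
        rw [lintegral_const]
        exact ENNReal.mul_lt_top ENNReal.ofReal_lt_top (measure_lt_top _ _)

lemma ae_lt_top_lavg_conv (ha : ∀ i, 0 < a i) [IsFiniteMeasure μ] {p : ℝ≥0} (hp : 1 ≤ p)
    {f h : Space n → ℝ} (hf : Measurable f) (hfp : MemLp f p (wMeasure a))
    (hi : Integrable h (wMeasure a)) :
    ∀ᵐ x ∂(wMeasure a),
      lavg a μ (lavg a ((wMeasure a).withDensity fun y => ‖h y‖ₑ) fun y => ‖f y‖ₑ) x < ∞ := by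
  have := isFiniteMeasure_withDensity_enorm hi
  have hp' : (1 : ℝ) ≤ p := by exact_mod_cast hp
  have := lintegral_lavg_rpow_le (μ := (wMeasure a).withDensity fun y => ‖h y‖ₑ) ha hp' hf.enorm
  refine ae_lt_top_lavg ha hp' (measurable_lavg hf.enorm) (this.trans_lt (ENNReal.mul_lt_top
      (ENNReal.rpow_lt_top_of_nonneg (by linarith) (measure_ne_top _ _))
      (lintegral_enorm_rpow_ne_top hp hfp).lt_top)).ne

/-! ### The spherical difference -/

/-- The weighted surface measure of the sphere of radius `r` in the orthant. -/
def sphereLaw (a : Fin n → ℝ) (r : ℝ) : Measure (Space n) :=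
  ((sphereMeasure n).withDensity fun Θ => ENNReal.ofReal (weight a (Θ : Space n))).map
    fun Θ : Metric.sphere (0 : Space n) 1 => r • (Θ : Space n)

lemma ae_sphere_mem_orthant : ∀ᵐ Θ : Metric.sphere (0 : Space n) 1 ∂(sphereMeasure n), (Θ : Space n) ∈ orthant n :=
  ae_restrict_mem (measurable_subtype_coe measurableSet_orthant)

lemma weight_le_one (ha : ∀ i, 0 < a i) {x : Space n} (hx : x ∈ orthant n) (h1 : ‖x‖ ≤ 1) :
    weight a x ≤ 1 := by
  refine Finset.prod_le_one (fun i _ => Real.rpow_nonneg (hx i).le _) fun i _ => ?_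
  refine Real.rpow_le_one (hx i).le ?_ (ha i).le
  exact (le_abs_self _).trans ((PiLp.norm_apply_le x i).trans h1)

instance : IsFiniteMeasure (sphereMeasure n) := by unfold sphereMeasure; infer_instance

lemma integrable_weight_sphere (ha : ∀ i, 0 < a i) :
    Integrable (fun Θ : Metric.sphere (0 : Space n) 1 => weight a (Θ : Space n))
      (sphereMeasure n) := by
  refine Integrable.of_bound ((measurable_weight a).comp
    measurable_subtype_coe).aestronglyMeasurable 1 (ae_sphere_mem_orthant.mono fun Θ h => ?_)
  rw [Real.norm_of_nonneg (weight_nonneg a h)]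
  exact weight_le_one ha h (by simp)

/-- The total mass `∫ Θ ^ a dS(Θ)` as an extended nonnegative number. -/
def sphereMass (a : Fin n → ℝ) : ℝ≥0∞ :=
  ∫⁻ Θ, ENNReal.ofReal (weight a (Θ : Space n)) ∂(sphereMeasure n)

lemma sphereMass_ne_top (ha : ∀ i, 0 < a i) : sphereMass a ≠ ∞ :=
  (integrable_weight_sphere ha).lintegral_lt_top.ne

lemma sphereLaw_univ (r : ℝ) : sphereLaw a r univ = sphereMass a := by
  unfold sphereLaw sphereMass
  rw [Measure.map_apply (by fun_prop) MeasurableSet.univ, preimage_univ,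
    withDensity_apply _ MeasurableSet.univ, Measure.restrict_univ]

lemma isFiniteMeasure_sphereLaw (ha : ∀ i, 0 < a i) (r : ℝ) : IsFiniteMeasure (sphereLaw a r) :=
  ⟨by rw [sphereLaw_univ]; exact (sphereMass_ne_top ha).lt_top⟩

/-- At the points where the averages converge absolutely the defining integral may be split. -/
lemma sphericalDiff_eq (ha : ∀ i, 0 < a i) (r : ℝ) {f : Space n → ℝ} (hf : Measurable f)
    {x : Space n} (hx : Integrable (fun z : Space n × (Fin n → ℝ) => f (move x z.1 z.2))
      ((sphereLaw a r).prod (angles a))) :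
    sphericalDiff a r f x =
      1 / sphereArea a * (sphereArea a * f x - avg a (sphereLaw a r) f x) := by
  have hfin := isFiniteMeasure_sphereLaw ha r
  have hmw : Measurable fun Θ : Metric.sphere (0 : Space n) 1 =>
    ENNReal.ofReal (weight a (Θ : Space n)) :=
    ((measurable_weight a).comp measurable_subtype_coe).ennreal_ofReal
  have hmr : Measurable fun Θ : Metric.sphere (0 : Space n) 1 => r • (Θ : Space n) := by fun_prop
  have htm : Measurable fun t => translation a t f x :=
    (measurable_translation_uncurry ha hf).comp measurable_prodMk_right
  have hI := hx.integral_prod_left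
  simp only [← translation_eq ha] at hI
  have hI2 : Integrable (fun Θ : Metric.sphere (0 : Space n) 1 =>
      translation a (r • (Θ : Space n)) f x * weight a (Θ : Space n)) (sphereMeasure n) := by
    unfold sphereLaw at hI
    rw [integrable_map_measure htm.aestronglyMeasurable hmr.aemeasurable,
      integrable_withDensity_iff_integrable_smul' hmw
        (ae_of_all _ fun _ => ENNReal.ofReal_lt_top)] at hI
    refine hI.congr (ae_sphere_mem_orthant.mono fun Θ h => ?_)
    simp only [Function.comp_apply, smul_eq_mul, ENNReal.toReal_ofReal (weight_nonneg a h)]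
    ring
  unfold sphericalDiff
  congr 1
  simp_rw [sub_mul]
  rw [integral_sub ((integrable_weight_sphere ha).const_mul _) hI2, integral_const_mul]
  congr 1
  · rw [sphereArea, mul_comm]
  · unfold avg
    rw [integral_prod _ hx]
    simp only [← translation_eq ha]
    unfold sphereLaw
    rw [integral_map hmr.aemeasurable htm.aestronglyMeasurable,
      integral_withDensity_eq_integral_toReal_smul hmw
        (ae_of_all _ fun _ => ENNReal.ofReal_lt_top)]
    refine integral_congr_ae (ae_sphere_mem_orthant.mono fun Θ h => ?_)
    simp only [smul_eq_mul, ENNReal.toReal_ofReal (weight_nonneg a h)]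
    ring

/-- The spherical difference written with the averaging operator over the sphere. -/
def sdiff (a : Fin n → ℝ) (r : ℝ) (f : Space n → ℝ) (x : Space n) : ℝ :=
  1 / sphereArea a * (sphereArea a * f x - avg a (sphereLaw a r) f x)

lemma measurable_sdiff (ha : ∀ i, 0 < a i) (r : ℝ) {f : Space n → ℝ} (hf : Measurable f) :
    Measurable (sdiff a r f) := by
  have := isFiniteMeasure_sphereLaw ha r
  exact measurable_const.mul ((measurable_const.mul hf).sub (measurable_avg hf))

lemma sphericalDiff_ae_eq (ha : ∀ i, 0 < a i) (r : ℝ) {p : ℝ≥0} (hp : 1 ≤ p) {f : Space n → ℝ}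
    (hf : Measurable f) (hfp : MemLp f p (wMeasure a)) :
    sphericalDiff a r f =ᵐ[wMeasure a] sdiff a r f := by
  have := isFiniteMeasure_sphereLaw ha r
  exact (ae_integrable_move (μ := sphereLaw a r) ha hp hf hfp).mono
    fun x hx => sphericalDiff_eq ha r hf hx

/-- The spherical difference depends only on the almost everywhere class of the function, without
any integrability: the translated points of almost every point avoid a given null set. -/
lemma sphericalDiff_congr_ae (ha : ∀ i, 0 < a i) (r : ℝ) {f g : Space n → ℝ}
    (h : f =ᵐ[wMeasure a] g) : sphericalDiff a r f =ᵐ[wMeasure a] sphericalDiff a r g := by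
  have hfin := isFiniteMeasure_sphereLaw ha r
  have h1 := Measure.ae_ae_of_ae_prod
    ((quasiMeasurePreserving_move ha (μ := sphereLaw a r)).ae_eq_comp h)
  filter_upwards [h1, h] with x hx hx'
  have h2 := Measure.ae_ae_of_ae_prod hx
  have hmw : Measurable fun Θ : Metric.sphere (0 : Space n) 1 =>
    ENNReal.ofReal (weight a (Θ : Space n)) :=
    ((measurable_weight a).comp measurable_subtype_coe).ennreal_ofReal
  unfold sphereLaw at h2
  have h3 := ae_of_ae_map (by fun_prop) h2
  rw [ae_withDensity_iff hmw] at h3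
  unfold sphericalDiff
  congr 1
  refine integral_congr_ae ?_
  filter_upwards [h3, ae_sphere_mem_orthant] with Θ hΘ hmem
  have h0 : 0 < weight a (Θ : Space n) :=
    Finset.prod_pos fun i _ => Real.rpow_pos_of_pos (hmem i) _
  have h4 := hΘ (by simpa using h0)
  simp only [hx', translation_eq ha]
  congr 2
  exact integral_congr_ae h4
end

end

section

variable {n : ℕ} {a : Fin n → ℝ}

/-! ### Spherical differences of averages and convolutions -/

lemma sdiff_sub_ae (ha : ∀ i, 0 < a i) (r : ℝ) {p : ℝ≥0} (hp : 1 ≤ p) {f g : Space n → ℝ}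
    (hf : Measurable f) (hfp : MemLp f p (wMeasure a)) (hg : Measurable g)
    (hgp : MemLp g p (wMeasure a)) :
    sdiff a r (fun x => f x - g x) =ᵐ[wMeasure a] fun x => sdiff a r f x - sdiff a r g x := by
  have := isFiniteMeasure_sphereLaw ha r
  filter_upwards [ae_integrable_move (μ := sphereLaw a r) ha hp hf hfp,
    ae_integrable_move (μ := sphereLaw a r) ha hp hg hgp] with x hx hy
  simp only [sdiff, avg_sub hx hy]
  ring

/-- The norm of the spherical difference on `L^p`, up to a constant independent of the radius. -/
lemma exists_eLpNorm_sdiff_le (ha : ∀ i, 0 < a i) :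
    ∃ C : ℝ≥0∞, C ≠ ∞ ∧ ∀ (r : ℝ) {p : ℝ≥0} (_ : 1 ≤ p) {f : Space n → ℝ} (_ : Measurable f),
      eLpNorm (sdiff a r f) p (wMeasure a) ≤ C * eLpNorm f p (wMeasure a) := by
  refine ⟨‖1 / sphereArea a‖ₑ * (‖sphereArea a‖ₑ + sphereMass a),
    ENNReal.mul_ne_top enorm_ne_top (ENNReal.add_ne_top.2 ⟨enorm_ne_top, sphereMass_ne_top ha⟩),
    fun r p hp f hf => ?_⟩
  have := isFiniteMeasure_sphereLaw ha r
  have h1 : sdiff a r f = (1 / sphereArea a) • (sphereArea a • f - avg a (sphereLaw a r) f) := rfl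
  rw [h1, eLpNorm_const_smul, mul_assoc]
  gcongr
  refine (eLpNorm_sub_le (hf.const_smul _).aestronglyMeasurable
    (measurable_avg hf).aestronglyMeasurable (by exact_mod_cast hp)).trans ?_
  rw [eLpNorm_const_smul, add_mul]
  gcongr
  exact (eLpNorm_avg_le ha hp hf).trans_eq (by rw [sphereLaw_univ])

lemma memLp_sdiff (ha : ∀ i, 0 < a i) (r : ℝ) {p : ℝ≥0} (hp : 1 ≤ p) {f : Space n → ℝ}
    (hf : Measurable f) (hfp : MemLp f p (wMeasure a)) : MemLp (sdiff a r f) p (wMeasure a) := by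
  obtain ⟨C, hC, h⟩ := exists_eLpNorm_sdiff_le (a := a) ha
  exact ⟨(measurable_sdiff ha r hf).aestronglyMeasurable,
    (h r hp hf).trans_lt (ENNReal.mul_lt_top hC.lt_top hfp.2)⟩

/-- The spherical difference commutes with averaging. -/
lemma sdiff_avg (ha : ∀ i, 0 < a i) (r : ℝ) {μ : Measure (Space n)} [IsFiniteMeasure μ]
    {p : ℝ≥0} (hp : 1 ≤ p) {f : Space n → ℝ} (hf : Measurable f)
    (hfp : MemLp f p (wMeasure a)) :
    sdiff a r (avg a μ f) =ᵐ[wMeasure a] avg a μ (sdiff a r f) := by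
  have := isFiniteMeasure_sphereLaw ha r
  filter_upwards [avg_comm (μ := sphereLaw a r) (ν := μ) ha hp hf hfp,
    ae_integrable_move (μ := μ) ha hp (hf.const_mul (sphereArea a)) (hfp.const_mul _),
    ae_integrable_move (μ := μ) ha hp (measurable_avg (μ := sphereLaw a r) hf)
      (memLp_avg ha hp hf hfp)] with x h1 h2 h3
  have h4 : avg a μ (sdiff a r f) x =
      avg a μ (fun y => 1 / sphereArea a * (sphereArea a * f y - avg a (sphereLaw a r) f y)) x :=
    rfl
  rw [h4, avg_const_mul, avg_sub h2 h3, avg_const_mul, sdiff, h1]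

/-- The spherical difference of a convolution falls on the kernel. -/
lemma sdiff_conv (ha : ∀ i, 0 < a i) (r : ℝ) {p : ℝ≥0} (hp : 1 ≤ p) {f h : Space n → ℝ}
    (hf : Measurable f) (hfp : MemLp f p (wMeasure a)) (hh : Measurable h) {C : ℝ}
    (hC : ∀ x, |h x| ≤ C) (hi : Integrable h (wMeasure a)) :
    sdiff a r (conv a f h) =ᵐ[wMeasure a] conv a f (sdiff a r h) := by
  have hfin := isFiniteMeasure_sphereLaw ha r
  have hpa := isProbabilityMeasure_angles ha
  have ham : Measurable (avg a (sphereLaw a r) h) := measurable_avg hh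
  have hai : Integrable (avg a (sphereLaw a r) h) (wMeasure a) :=
    memLp_one_iff_integrable.1 (memLp_avg (p := 1) ha le_rfl hh (memLp_one_iff_integrable.2 hi))
  filter_upwards [ae_lt_top_lavg_conv (μ := sphereLaw a r) ha hp hf hfp hi,
    ae_lt_top_conv ha hp hf hfp hi, ae_lt_top_conv ha hp hf hfp hai] with x h1 h2 h3
  rw [sdiff, avg_conv ha hf hh hC h1]
  have hb : ∀ z, |avg a (sphereLaw a r) h z| ≤ C * (sphereLaw a r).real univ := fun z => by
    have h4 := norm_integral_le_of_norm_le_const (μ := (sphereLaw a r).prod (angles a))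
      (f := fun w => h (move z w.1 w.2)) (C := C) (ae_of_all _ fun w => hC _)
    refine h4.trans_eq ?_
    rw [measureReal_def, ← univ_prod_univ, Measure.prod_prod, measure_univ (μ := angles a), mul_one,
      measureReal_def]
  have key : ∀ y, translation a x (sdiff a r h) y = 1 / sphereArea a *
      (sphereArea a * translation a x h y - translation a x (avg a (sphereLaw a r) h) y) := by
    intro y
    simp only [translation_eq ha]
    unfold sdiff
    rw [integral_const_mul, integral_sub, integral_const_mul]
    · exact (Integrable.of_bound (Measurable.aestronglyMeasurable (by fun_prop)) C
        (ae_of_all _ fun θ => hC _)).const_mul _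
    · exact Integrable.of_bound (Measurable.aestronglyMeasurable (by fun_prop)) _
        (ae_of_all _ fun θ => hb _)
  have i1 := integrable_mul_translation ha hf hh h2
  have i2 := integrable_mul_translation ha hf ham h3
  have e1 : conv a f (sdiff a r h) x = ∫ y, 1 / sphereArea a *
      (sphereArea a * (f y * translation a x h y) -
        f y * translation a x (avg a (sphereLaw a r) h) y) ∂(wMeasure a) := by
    refine integral_congr_ae (ae_of_all _ fun y => ?_)
    simp only [key]
    ring
  rw [e1, integral_const_mul, integral_sub (i1.const_mul _) i2, integral_const_mul]
  rfl

lemma eLpNorm_sdiff_conv_le (ha : ∀ i, 0 < a i) (r : ℝ) {p : ℝ≥0} (hp : 1 ≤ p)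
    {f h : Space n → ℝ} (hf : Measurable f) (hfp : MemLp f p (wMeasure a)) (hh : Measurable h)
    {C : ℝ} (hC : ∀ x, |h x| ≤ C) (hi : Integrable h (wMeasure a)) :
    eLpNorm (sdiff a r (conv a f h)) p (wMeasure a) ≤
      eLpNorm (sdiff a r h) 1 (wMeasure a) * eLpNorm f p (wMeasure a) := by
  rw [eLpNorm_congr_ae (sdiff_conv ha r hp hf hfp hh hC hi)]
  exact eLpNorm_conv_le ha hp hf (measurable_sdiff ha r hh) (memLp_one_iff_integrable.1
    (memLp_sdiff (p := 1) ha r le_rfl hh (memLp_one_iff_integrable.2 hi)))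

end

section

variable {n : ℕ}


/-! ### Gaussians as Schwartz functions -/
section
variable {E : Type} [NormedAddCommGroup E] [InnerProductSpace ℝ E]

lemma hasFDerivAt_exp_neg_norm_sq (c : ℝ) (x : E) :
    HasFDerivAt (fun x : E => Real.exp (-c * ‖x‖ ^ 2))
      (Real.exp (-c * ‖x‖ ^ 2) • (-(2 * c)) • innerSL ℝ x) x := by
  have h := ((hasStrictFDerivAt_norm_sq x).hasFDerivAt.const_mul (-c)).exp
  convert h using 2
  ext y
  simp
  ring

lemma exists_pow_mul_exp_neg_le {c : ℝ} (hc : 0 < c) (k : ℕ) :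
    ∃ C, ∀ r : ℝ, 0 ≤ r → r ^ k * Real.exp (-c * r ^ 2) ≤ C := by
  have h1 : ∀ r : ℝ, 0 ≤ r → r ^ k * Real.exp (-c * r ^ 2) ≤ 1 + (k.factorial / c ^ k) := by
    intro r hr
    have hk : (c * r ^ 2) ^ k / k.factorial ≤ Real.exp (c * r ^ 2) :=
      Real.pow_div_factorial_le_exp _ (by positivity) k
    have hk' : r ^ (2 * k) ≤ k.factorial / c ^ k * Real.exp (c * r ^ 2) := by
      rw [div_mul_eq_mul_div, le_div_iff₀ (by positivity), pow_mul, ← mul_pow, mul_comm (r ^ 2)]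
      rwa [div_le_iff₀' (by positivity)] at hk
    have hr2 : r ^ k ≤ 1 + r ^ (2 * k) := by
      rw [mul_comm, pow_mul]
      nlinarith [sq_nonneg (r ^ k - 1)]
    have he : 1 ≤ Real.exp (c * r ^ 2) := Real.one_le_exp (by positivity)
    have : r ^ k ≤ (1 + (k.factorial / c ^ k)) * Real.exp (c * r ^ 2) := by linarith
    calc r ^ k * Real.exp (-c * r ^ 2) ≤
        (1 + (k.factorial / c ^ k)) * Real.exp (c * r ^ 2) * Real.exp (-c * r ^ 2) := by gcongr
      _ = _ := by rw [mul_assoc, ← Real.exp_add]; simp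
  exact ⟨_, h1⟩

/-- All derivatives of a Gaussian times a function of temperate growth decay rapidly. The vector
valued factor makes the induction on the order of the derivative close up. -/
lemma exists_decay_exp_neg_smul {c : ℝ} (hc : 0 < c) (m : ℕ) :
    ∀ {F : Type} [NormedAddCommGroup F] [NormedSpace ℝ F] {P : E → F}
      (_ : P.HasTemperateGrowth) (k : ℕ),
      ∃ C, ∀ x, ‖x‖ ^ k * ‖iteratedFDeriv ℝ m (fun x => Real.exp (-c * ‖x‖ ^ 2) • P x) x‖ ≤ C := by
  induction m with
  | zero =>
    intro F _ _ P hP k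
    obtain ⟨l, C, hC⟩ := hP.2 0
    obtain ⟨A, hA⟩ := exists_pow_mul_exp_neg_le hc k
    obtain ⟨B, hB⟩ := exists_pow_mul_exp_neg_le hc (k + l)
    refine ⟨|C| * (2 ^ (l - 1) * (A + B)), fun x => ?_⟩
    have hPx : ‖P x‖ ≤ |C| * (1 + ‖x‖) ^ l := by
      have := hC x
      rw [norm_iteratedFDeriv_zero] at this
      exact this.trans (by gcongr; exact le_abs_self C)
    have hbin : (1 + ‖x‖) ^ l ≤ 2 ^ (l - 1) * (1 ^ l + ‖x‖ ^ l) :=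
      add_pow_le zero_le_one (norm_nonneg x) l
    rw [norm_iteratedFDeriv_zero, norm_smul, Real.norm_of_nonneg (Real.exp_nonneg _)]
    calc ‖x‖ ^ k * (Real.exp (-c * ‖x‖ ^ 2) * ‖P x‖)
        ≤ ‖x‖ ^ k * (Real.exp (-c * ‖x‖ ^ 2) * (|C| * (2 ^ (l - 1) * (1 ^ l + ‖x‖ ^ l)))) := by
          gcongr
          exact hPx.trans (by gcongr)
      _ = |C| * (2 ^ (l - 1) * (‖x‖ ^ k * Real.exp (-c * ‖x‖ ^ 2)
          + ‖x‖ ^ (k + l) * Real.exp (-c * ‖x‖ ^ 2))) := by ring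
      _ ≤ _ := by
          gcongr
          · exact hA _ (norm_nonneg x)
          · exact hB _ (norm_nonneg x)
  | succ m ih =>
    intro F _ _ P hP k
    have hd : fderiv ℝ (fun x => Real.exp (-c * ‖x‖ ^ 2) • P x) = fun x =>
        Real.exp (-c * ‖x‖ ^ 2) • (fderiv ℝ P x + (-(2 * c)) •
          ContinuousLinearMap.smulRightL ℝ E F (innerSL ℝ x) (P x)) := by
      ext1 x
      have h := (hasFDerivAt_exp_neg_norm_sq c x).smul
        (hP.1.differentiable (by simp) x).hasFDerivAt
      refine h.fderiv.trans ?_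
      ext y
      simp
      rw [smul_smul, smul_smul]
      congr 1
      ring
    have hQ : Function.HasTemperateGrowth fun x => fderiv ℝ P x + (-(2 * c)) •
        ContinuousLinearMap.smulRightL ℝ E F (innerSL ℝ x) (P x) := by
      have hB : Function.HasTemperateGrowth fun x =>
          ContinuousLinearMap.smulRightL ℝ E F (innerSL ℝ x) (P x) :=
        ContinuousLinearMap.bilinear_hasTemperateGrowth (𝕜 := ℝ) _
          (innerSL ℝ : E →L[ℝ] (E →L[ℝ] ℝ)).hasTemperateGrowth hP
      refine Function.HasTemperateGrowth.add ?_
        ((Function.HasTemperateGrowth.const (-(2 * c))).smul hB)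
      refine ⟨hP.1.fderiv_right (by simp), fun j => ?_⟩
      obtain ⟨l, C, h⟩ := hP.2 (j + 1)
      exact ⟨l, C, fun x => by simpa [norm_iteratedFDeriv_fderiv] using h x⟩
    obtain ⟨C, hC⟩ := ih hQ k
    exact ⟨C, fun x => by rw [← norm_iteratedFDeriv_fderiv, hd]; exact hC x⟩

/-- The Gaussian `exp (-c ‖x‖²)` as a Schwartz function. -/
def gaussian (c : ℝ) (hc : 0 < c) : 𝓢(E, ℝ) where
  toFun x := Real.exp (-c * ‖x‖ ^ 2)
  smooth' := ((contDiff_const.mul (contDiff_norm_sq ℝ)).exp)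
  decay' k m := by
    have := exists_decay_exp_neg_smul (E := E) hc m (P := fun _ => (1 : ℝ)) (by fun_prop) k
    simpa using this

end

/-! ### Superpositions of translates of a Schwartz function -/
section
variable {E F : Type} {Ω : Type*} [NormedAddCommGroup E] [NormedSpace ℝ E] [MeasurableSpace Ω]
  {μ : Measure Ω} {h : Ω → ℝ} {z : Ω → E} {R : ℝ}

lemma integrable_superposition [NormedAddCommGroup F] [NormedSpace ℝ F]
    (hh : Integrable h μ) (hz : AEStronglyMeasurable z μ) (G : 𝓢(E, F)) (x : E) :
    Integrable (fun ω => h ω • G (x - z ω)) μ := by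
  obtain ⟨C, hC⟩ := G.decay 0 0
  refine hh.smul_bdd C (G.continuous.comp_aestronglyMeasurable
    (aestronglyMeasurable_const.sub hz)) (ae_of_all _ fun ω => ?_)
  simpa using hC.2 (x - z ω)

lemma hasFDerivAt_superposition [NormedAddCommGroup F] [NormedSpace ℝ F]
    (hh : Integrable h μ) (hz : AEStronglyMeasurable z μ) (G : 𝓢(E, F)) (x : E) :
    HasFDerivAt (fun x => ∫ ω, h ω • G (x - z ω) ∂μ)
      (∫ ω, h ω • SchwartzMap.fderivCLM ℝ E F G (x - z ω) ∂μ) x := by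
  obtain ⟨C, hC⟩ := (SchwartzMap.fderivCLM ℝ E F G).decay 0 0
  refine hasFDerivAt_integral_of_dominated_of_fderiv_le (s := univ) (bound := fun ω => |h ω| * C)
    (F' := fun x ω => h ω • SchwartzMap.fderivCLM ℝ E F G (x - z ω))
    Filter.univ_mem (.of_forall fun y => (integrable_superposition hh hz G y).1)
    (integrable_superposition hh hz G x)
    (integrable_superposition hh hz _ x).1 (ae_of_all _ fun ω y _ => ?_) (hh.abs.mul_const C)
    (ae_of_all _ fun ω y _ => ?_)
  · rw [norm_smul, Real.norm_eq_abs]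
    gcongr
    simpa using hC.2 (y - z ω)
  · have h1 : HasFDerivAt G (fderiv ℝ G (y - z ω)) (y - z ω) := G.differentiableAt.hasFDerivAt
    have h2 := (h1.comp y ((hasFDerivAt_id y).sub_const (z ω))).const_smul (h ω)
    exact h2

/-- Smoothness and decay of superpositions. The induction on the order of differentiation passes to
the derivative of `G`, whence the varying target space. -/
lemma exists_decay_superposition (hh : Integrable h μ) (hz : AEStronglyMeasurable z μ)
    (hR : ∀ᵐ ω ∂μ, ‖z ω‖ ≤ R) (m : ℕ) :
    ∀ {F : Type} [NormedAddCommGroup F] [NormedSpace ℝ F] (G : 𝓢(E, F)) (k : ℕ),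
      ContDiff ℝ m (fun x => ∫ ω, h ω • G (x - z ω) ∂μ) ∧
      ∃ C, ∀ x, ‖x‖ ^ k * ‖iteratedFDeriv ℝ m (fun x => ∫ ω, h ω • G (x - z ω) ∂μ) x‖ ≤ C := by
  induction m with
  | zero =>
    intro F _ _ G k
    refine ⟨contDiff_zero.2 (continuous_iff_continuousAt.2 fun x =>
      (hasFDerivAt_superposition hh hz G x).continuousAt), ?_⟩
    obtain ⟨A, hA⟩ := G.decay k 0
    obtain ⟨B, hB⟩ := G.decay 0 0
    simp only [norm_iteratedFDeriv_zero, pow_zero, one_mul] at hA hB ⊢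
    refine ⟨(2 ^ (k - 1) * (A + |R| ^ k * B)) * ∫ ω, |h ω| ∂μ, fun x => ?_⟩
    rw [← Real.norm_of_nonneg (pow_nonneg (norm_nonneg x) k), ← norm_smul, ← integral_smul,
      ← integral_const_mul]
    refine norm_integral_le_of_norm_le (hh.abs.const_mul _) (hR.mono fun ω hω => ?_)
    have h1 : ‖x‖ ^ k ≤ 2 ^ (k - 1) * (‖x - z ω‖ ^ k + |R| ^ k) := by
      refine le_trans ?_ (add_pow_le (norm_nonneg _) (abs_nonneg R) k)
      gcongr
      calc ‖x‖ = ‖(x - z ω) + z ω‖ := by simp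
        _ ≤ _ := (norm_add_le _ _).trans (by gcongr; exact hω.trans (le_abs_self R))
    rw [norm_smul, norm_smul, Real.norm_of_nonneg (pow_nonneg (norm_nonneg x) k),
      Real.norm_eq_abs]
    calc ‖x‖ ^ k * (|h ω| * ‖G (x - z ω)‖)
        ≤ (2 ^ (k - 1) * (‖x - z ω‖ ^ k + |R| ^ k)) * (|h ω| * ‖G (x - z ω)‖) := by gcongr
      _ = 2 ^ (k - 1) * (‖x - z ω‖ ^ k * ‖G (x - z ω)‖ + |R| ^ k * ‖G (x - z ω)‖) * |h ω| := by
        ring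
      _ ≤ _ := by
        gcongr
        · exact hA.2 _
        · exact hB.2 _
  | succ m ih =>
    intro F _ _ G k
    have hd : fderiv ℝ (fun x => ∫ ω, h ω • G (x - z ω) ∂μ) =
        fun x => ∫ ω, h ω • SchwartzMap.fderivCLM ℝ E F G (x - z ω) ∂μ :=
      funext fun x => (hasFDerivAt_superposition hh hz G x).fderiv
    obtain ⟨h1, C, hC⟩ := ih (SchwartzMap.fderivCLM ℝ E F G) k
    refine ⟨?_, C, fun x => ?_⟩
    · push_cast
      rw [contDiff_succ_iff_fderiv]
      refine ⟨fun x => (hasFDerivAt_superposition hh hz G x).differentiableAt, by simp, ?_⟩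
      rw [hd]
      exact h1
    · rw [← norm_iteratedFDeriv_fderiv, hd]
      exact hC x

/-- The superposition `∫ h(ω) G(x - z(ω)) dμ(ω)` of boundedly many translates of a Schwartz function
is a Schwartz function. -/
def superposition [NormedAddCommGroup F] [NormedSpace ℝ F] (hh : Integrable h μ)
    (hz : AEStronglyMeasurable z μ) (hR : ∀ᵐ ω ∂μ, ‖z ω‖ ≤ R) (G : 𝓢(E, F)) : 𝓢(E, F) where
  toFun x := ∫ ω, h ω • G (x - z ω) ∂μ
  smooth' := contDiff_infty.2 fun m => (exists_decay_superposition hh hz hR m G 0).1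
  decay' k m := (exists_decay_superposition hh hz hR m G k).2

end

end

section

variable {n : ℕ}

/-! ### Reflections and the even Schwartz class -/

/-- The reflection in the hyperplane `xᵢ = 0`. -/
def reflect (i : Fin n) : Space n →L[ℝ] Space n :=
  ContinuousLinearMap.id ℝ _ -
    (2 : ℝ) • (EuclideanSpace.proj i).smulRight (EuclideanSpace.single i (1 : ℝ))

lemma reflect_apply (i : Fin n) (x : Space n) (j : Fin n) :
    reflect i x j = if j = i then -x j else x j := by
  by_cases h : j = i
  · subst h
    simp [reflect]
    ring
  · simp [reflect, h]

lemma reflect_eq_self {i : Fin n} {x : Space n} (h : x i = 0) : reflect i x = x := by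
  ext j
  rw [reflect_apply]
  split_ifs with hj
  · rw [hj, h, neg_zero]
  · rfl

lemma reflect_single (i : Fin n) :
    reflect i (EuclideanSpace.single i (1 : ℝ)) = -EuclideanSpace.single i (1 : ℝ) := by
  ext j
  rw [reflect_apply]
  by_cases h : j = i <;> simp [h]

/-- A Schwartz function invariant under the coordinate reflections belongs to the even Schwartz
class: an odd order derivative changes sign at a fixed point of the reflection. -/
lemma mem_evenSchwartz_of_reflect {φ : 𝓢(Space n, ℝ)} (h : ∀ i x, φ (reflect i x) = φ x) :
    φ ∈ evenSchwartz n := by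
  intro m i x hx
  have h1 := (reflect i).iteratedFDeriv_comp_right (φ.smooth ⊤) x (i := 2 * m + 1)
    (WithTop.coe_le_coe.2 (le_top : ((2 * m + 1 : ℕ) : ℕ∞) ≤ ⊤))
  have h2 : (φ : Space n → ℝ) ∘ reflect i = φ := funext fun x => h i x
  rw [h2, reflect_eq_self hx] at h1
  have h3 := congrArg (fun M => M fun _ => EuclideanSpace.single i (1 : ℝ)) h1
  simp only [ContinuousMultilinearMap.compContinuousLinearMap_apply, reflect_single] at h3
  have h4 := (iteratedFDeriv ℝ (2 * m + 1) φ x).map_smul_univ (fun _ => (-1 : ℝ))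
    (fun _ => EuclideanSpace.single i (1 : ℝ))
  simp only [neg_smul, one_smul, Finset.prod_const, Finset.card_univ, Fintype.card_fin] at h4
  rw [h4, Odd.neg_one_pow ⟨m, rfl⟩] at h3
  simp only [neg_smul, one_smul] at h3
  linarith

lemma chord_neg (x t θ : ℝ) : chord (-x) t θ = chord x t (Real.pi - θ) := by
  unfold chord
  rw [Real.cos_pi_sub]
  congr 1
  ring

/-- A Bessel translate is even in each variable: changing the sign of `xᵢ` replaces the angle `θᵢ`
by its supplement. -/
lemma translation_reflect {a : Fin n → ℝ} (ha : ∀ i, 0 < a i) (i : Fin n) (x t : Space n)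
    {f : Space n → ℝ} (hf : Measurable f) :
    translation a t f (reflect i x) = translation a t f x := by
  rw [translation_eq ha, translation_eq ha]
  conv_rhs => rw [← map_update_pi_sub_angles ha i]
  rw [integral_map (Measurable.aemeasurable (measurable_pi_lambda _ fun j => by
    split_ifs <;> fun_prop)) (Measurable.aestronglyMeasurable (by fun_prop))]
  congr 1
  ext θ
  congr 1
  unfold move
  congr 1
  ext j
  rw [reflect_apply]
  dsimp only
  split_ifs with h
  · exact chord_neg _ _ _
  · rfl

/-! ### Translates of Gaussians -/

section
variable {a : Fin n → ℝ} {c : ℝ} (hc : 0 < c)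

lemma gaussian_apply {E : Type} [NormedAddCommGroup E] [InnerProductSpace ℝ E] (x : E) :
    gaussian c hc x = Real.exp (-c * ‖x‖ ^ 2) := rfl

lemma norm_move_sq (x t : Space n) (θ : Fin n → ℝ) :
    ‖move x t θ‖ ^ 2 = ∑ i, (x i ^ 2 + t i ^ 2 - 2 * x i * t i * Real.cos (θ i)) := by
  rw [EuclideanSpace.norm_sq_eq]
  refine Finset.sum_congr rfl fun i _ => ?_
  rw [Real.norm_eq_abs, sq_abs]
  exact chord_sq _ _ _

lemma gaussian_move (x t : Space n) (θ : Fin n → ℝ) :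
    gaussian c hc (move x t θ) =
      ∏ i, Real.exp (-c * (x i ^ 2 + t i ^ 2 - 2 * x i * t i * Real.cos (θ i))) := by
  rw [gaussian_apply, norm_move_sq, Finset.mul_sum, Real.exp_sum]

/-- The vector with the coordinates `tᵢ cos θᵢ`. -/
def shift (t : Space n) (θ : Fin n → ℝ) : Space n := WithLp.toLp 2 fun i => t i * Real.cos (θ i)

/-- The factor `exp (-c ∑ (tᵢ sin θᵢ)²)`. -/
def damp (c : ℝ) (t : Space n) (θ : Fin n → ℝ) : ℝ :=
  Real.exp (-c * ∑ i, (t i * Real.sin (θ i)) ^ 2)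

@[fun_prop]
lemma continuous_shift : Continuous fun z : Space n × (Fin n → ℝ) => shift z.1 z.2 := by
  unfold shift; fun_prop

@[fun_prop]
lemma continuous_damp : Continuous fun z : Space n × (Fin n → ℝ) => damp c z.1 z.2 := by
  unfold damp; fun_prop

lemma norm_shift_le (t : Space n) (θ : Fin n → ℝ) : ‖shift t θ‖ ≤ ‖t‖ := by
  rw [← sq_le_sq₀ (norm_nonneg _) (norm_nonneg _), EuclideanSpace.norm_sq_eq,
    EuclideanSpace.norm_sq_eq]
  refine Finset.sum_le_sum fun i _ => ?_
  simp only [shift, Real.norm_eq_abs, sq_abs, mul_pow]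
  exact mul_le_of_le_one_right (sq_nonneg _) (Real.cos_sq_le_one _)

lemma damp_nonneg (t : Space n) (θ : Fin n → ℝ) : 0 ≤ damp c t θ := Real.exp_nonneg _

lemma damp_le_one (hc : 0 < c) (t : Space n) (θ : Fin n → ℝ) : damp c t θ ≤ 1 := by
  unfold damp
  rw [Real.exp_le_one_iff, neg_mul, neg_nonpos]
  positivity

/-- At the chord points a centred Gaussian is a damped translate of itself. -/
lemma gaussian_move_eq_shift (x t : Space n) (θ : Fin n → ℝ) :
    gaussian c hc (move x t θ) = damp c t θ • gaussian c hc (x - shift t θ) := by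
  rw [gaussian_apply, gaussian_apply, norm_move_sq, smul_eq_mul, damp, ← Real.exp_add,
    EuclideanSpace.norm_sq_eq, ← mul_add, ← Finset.sum_add_distrib]
  congr 2
  refine Finset.sum_congr rfl fun i _ => ?_
  simp only [shift, PiLp.sub_apply, Real.norm_eq_abs, sq_abs]
  linear_combination -(t i) ^ 2 * Real.sin_sq_add_cos_sq (θ i)

lemma translation_gaussian_eq (ha : ∀ i, 0 < a i) (t x : Space n) :
    translation a t (gaussian c hc) x =
      ∫ θ, damp c t θ • gaussian c hc (x - shift t θ) ∂(angles a) := by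
  rw [translation_eq ha]
  simp only [gaussian_move_eq_shift]

lemma integrable_damp (ha : ∀ i, 0 < a i) (t : Space n) : Integrable (damp c t) (angles a) :=
  integrable_angles ha (by fun_prop)

/-- The Bessel translate of a Gaussian, as a Schwartz function. -/
def gaussianTranslate (ha : ∀ i, 0 < a i) (t : Space n) : 𝓢(Space n, ℝ) :=
  superposition (integrable_damp (c := c) ha t)
    (Continuous.aestronglyMeasurable (f := shift t) (by fun_prop))
    (ae_of_all _ (norm_shift_le t)) (gaussian c hc)

lemma coe_gaussianTranslate (ha : ∀ i, 0 < a i) (t : Space n) :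
    ⇑(gaussianTranslate hc ha t) = translation a t (gaussian c hc) :=
  funext fun x => (translation_gaussian_eq hc ha t x).symm

/-- The Bessel convolution of a compactly supported continuous function with a Gaussian is an even
Schwartz function. -/
lemma exists_evenSchwartz_conv (ha : ∀ i, 0 < a i) {f : Space n → ℝ} (hf : Continuous f)
    (hs : HasCompactSupport f) :
    ∃ φ ∈ evenSchwartz n, ⇑φ = conv a f (gaussian c hc) := by
  have hprob := isProbabilityMeasure_angles ha
  have hloc := isLocallyFiniteMeasure_wMeasure ha
  have hfin : IsFiniteMeasure ((wMeasure a).restrict (tsupport f)) :=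
    ⟨by rw [Measure.restrict_apply_univ]; exact hs.isCompact.measure_lt_top⟩
  obtain ⟨C, hC⟩ := hs.exists_bound_of_continuous hf
  obtain ⟨R, hR⟩ := hs.isCompact.isBounded.exists_norm_le
  have hint : Integrable (fun z : Space n × (Fin n → ℝ) => f z.1 * damp c z.1 z.2)
      (((wMeasure a).restrict (tsupport f)).prod (angles a)) := by
    refine Integrable.of_bound (Continuous.aestronglyMeasurable (by fun_prop)) C
      (ae_of_all _ fun z => ?_)
    rw [norm_mul]
    refine (mul_le_of_le_one_right (norm_nonneg _) ?_).trans (hC z.1)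
    rw [Real.norm_of_nonneg (damp_nonneg _ _)]
    exact damp_le_one hc _ _
  have hb : ∀ᵐ z ∂(((wMeasure a).restrict (tsupport f)).prod (angles a)),
      ‖shift z.1 z.2‖ ≤ R := by
    have h1 : ∀ᵐ y ∂((wMeasure a).restrict (tsupport f)), y ∈ tsupport f :=
      ae_restrict_mem (isClosed_tsupport f).measurableSet
    exact (Measure.quasiMeasurePreserving_fst.ae h1).mono fun z hz =>
      (norm_shift_le _ _).trans (hR _ hz)
  have hz : AEStronglyMeasurable (fun z : Space n × (Fin n → ℝ) => shift z.1 z.2)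
      (((wMeasure a).restrict (tsupport f)).prod (angles a)) :=
    Continuous.aestronglyMeasurable (by fun_prop)
  have hcoe : ⇑(superposition hint hz hb (gaussian c hc)) = conv a f (gaussian c hc) := by
    funext x
    have h1 := integrable_superposition hint hz (gaussian c hc) x
    have h2 : superposition hint hz hb (gaussian c hc) x =
        ∫ z, (f z.1 * damp c z.1 z.2) • gaussian c hc (x - shift z.1 z.2)
        ∂(((wMeasure a).restrict (tsupport f)).prod (angles a)) := rfl
    have h3 : ∫ y in tsupport f, f y * translation a x (gaussian c hc) y ∂(wMeasure a) =
        conv a f (gaussian c hc) x :=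
      setIntegral_eq_integral_of_forall_compl_eq_zero fun y hy => by
        rw [image_eq_zero_of_notMem_tsupport hy, zero_mul]
    rw [h2, integral_prod _ h1, ← h3]
    refine integral_congr_ae (ae_of_all _ fun y => ?_)
    simp only [mul_smul]
    rw [integral_smul, smul_eq_mul, translation_comm ha, translation_gaussian_eq hc ha]
  refine ⟨superposition hint hz hb (gaussian c hc), mem_evenSchwartz_of_reflect fun i x => ?_, hcoe⟩
  rw [hcoe]
  unfold conv
  have hm : Measurable (gaussian c hc : Space n → ℝ) := (gaussian c hc).continuous.measurable
  congr 1
  ext y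
  rw [translation_comm ha, translation_reflect ha i x y hm, translation_comm ha]

/-! ### The Bessel-Laplacian of a translated Gaussian -/

/-- The function `(4c²‖z‖² - 2c(n + |a|)) exp (-c ‖z‖²)`, which is the image of the Gaussian under the
Bessel-Laplace operator. -/
def gaussianLaplace (a : Fin n → ℝ) (c : ℝ) (z : Space n) : ℝ :=
  (∑ i, (4 * c ^ 2 * z i ^ 2 - 2 * c * (1 + a i))) * Real.exp (-c * ‖z‖ ^ 2)

lemma continuous_gaussianLaplace : Continuous (gaussianLaplace a c) := by
  unfold gaussianLaplace; fun_prop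

/-- The one-dimensional Bessel operator applied to the translate of a Gaussian. The two integrands
differ by a multiple of the derivative of `sin ^ b` times the Gaussian, which integrates to zero. -/
lemma integral_angleMeasure_gaussian {b : ℝ} (hb : 0 < b) (c x : ℝ) {y : ℝ} (hy : y ≠ 0) :
    ∫ θ, (4 * c ^ 2 * (y - x * Real.cos θ) ^ 2 - 2 * c +
        b / y * (-(2 * c) * (y - x * Real.cos θ))) *
        Real.exp (-c * (y ^ 2 + x ^ 2 - 2 * y * x * Real.cos θ)) ∂(angleMeasure b) =
      ∫ θ, (4 * c ^ 2 * (y ^ 2 + x ^ 2 - 2 * y * x * Real.cos θ) - 2 * c * (1 + b)) *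
        Real.exp (-c * (y ^ 2 + x ^ 2 - 2 * y * x * Real.cos θ)) ∂(angleMeasure b) := by
  set E : ℝ → ℝ := fun θ => Real.exp (-c * (y ^ 2 + x ^ 2 - 2 * y * x * Real.cos θ)) with hE
  have hE' : ∀ θ, HasDerivAt E (E θ * (-c * (-(2 * y * x * -Real.sin θ)))) θ := fun θ =>
    ((((Real.hasDerivAt_cos θ).const_mul (2 * y * x)).const_sub _).const_mul (-c)).exp
  have h0 := integral_angleMeasure_by_parts hb hE' (by fun_prop)
  rw [← sub_eq_zero, ← integral_sub (integrable_angleMeasure hb (by fun_prop))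
    (integrable_angleMeasure hb (by fun_prop)), ← mul_zero (2 * c * x / y), ← h0,
    ← integral_const_mul]
  congr 1
  ext θ
  simp only [hE]
  field_simp
  linear_combination (4 * c ^ 2 * y * x ^ 2) * (Real.sin_sq_add_cos_sq θ)

/-- For a product integrand, an identity for the integrals over one angle extends to all angles. -/
lemma integral_angles_mul_prod_congr (ha : ∀ i, 0 < a i) (i : Fin n) {A B : ℝ → ℝ}
    {E : Fin n → ℝ → ℝ} (h : ∫ θ, A θ * E i θ ∂(angleMeasure (a i)) =
      ∫ θ, B θ * E i θ ∂(angleMeasure (a i))) :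
    ∫ θ, A (θ i) * ∏ j, E j (θ j) ∂(angles a) = ∫ θ, B (θ i) * ∏ j, E j (θ j) ∂(angles a) := by
  have := fun i => isProbabilityMeasure_angleMeasure (ha i)
  have key : ∀ A : ℝ → ℝ, ∫ θ, A (θ i) * ∏ j, E j (θ j) ∂(angles a) =
      ∏ j, ∫ θ, (if j = i then A θ else 1) * E j θ ∂(angleMeasure (a j)) := fun A => by
    unfold angles
    rw [← integral_fintype_prod_eq_prod]
    congr 1
    ext θ
    rw [Finset.prod_mul_distrib]
    simp
  rw [key, key]
  refine Finset.prod_congr rfl fun j _ => ?_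
  by_cases hj : j = i
  · subst hj
    simpa using h
  · simp [hj]

lemma fderiv_gaussian (x v : Space n) :
    SchwartzMap.fderivCLM ℝ (Space n) ℝ (gaussian c hc) x v =
      -(2 * c) * inner ℝ x v * Real.exp (-c * ‖x‖ ^ 2) := by
  rw [SchwartzMap.fderivCLM_apply]
  have h : fderiv ℝ (gaussian c hc : Space n → ℝ) x = _ := (hasFDerivAt_exp_neg_norm_sq c x).fderiv
  rw [h]
  simp
  ring

lemma fderiv_fderiv_gaussian (x v : Space n) :
    SchwartzMap.fderivCLM ℝ (Space n) (Space n →L[ℝ] ℝ)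
      (SchwartzMap.fderivCLM ℝ (Space n) ℝ (gaussian c hc)) x v v =
      (4 * c ^ 2 * inner ℝ x v ^ 2 - 2 * c * ‖v‖ ^ 2) * Real.exp (-c * ‖x‖ ^ 2) := by
  rw [SchwartzMap.fderivCLM_apply]
  have h1 : HasFDerivAt (SchwartzMap.fderivCLM ℝ (Space n) ℝ (gaussian c hc))
      (fderiv ℝ (SchwartzMap.fderivCLM ℝ (Space n) ℝ (gaussian c hc)) x) x :=
    (SchwartzMap.differentiableAt _).hasFDerivAt
  have h2 : HasFDerivAt (fun y : Space n => SchwartzMap.fderivCLM ℝ (Space n) ℝ (gaussian c hc) y v) _ x :=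
    h1.clm_apply (hasFDerivAt_const v x)
  have h3 : HasFDerivAt (fun y : Space n => -(2 * c) * inner ℝ y v * Real.exp (-c * ‖y‖ ^ 2)) _ x :=
    ((((hasFDerivAt_id x).inner ℝ (hasFDerivAt_const v x)).const_mul (-(2 * c))).mul
      (hasFDerivAt_exp_neg_norm_sq c x))
  simp only [fderiv_gaussian] at h2
  have h4 := congrArg (fun L => L v) (h2.unique h3)
  simp at h4
  rw [h4]
  ring_nf

/-- The Bessel-Laplace operator, acting on the translates of a Gaussian, falls on the Gaussian. -/
lemma besselLaplace_translation_gaussian (ha : ∀ i, 0 < a i) (t : Space n) {y : Space n}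
    (hy : y ∈ orthant n) :
    besselLaplace a (translation a t (gaussian c hc)) y = translation a t (gaussianLaplace a c) y := by
  have hd := integrable_damp (c := c) ha t
  have hz : AEStronglyMeasurable (shift t) (angles a) :=
    Continuous.aestronglyMeasurable (by fun_prop)
  have hf : translation a t (gaussian c hc) =
      fun x => ∫ θ, damp c t θ • gaussian c hc (x - shift t θ) ∂(angles a) :=
    funext fun x => translation_gaussian_eq hc ha t x
  have hD : fderiv ℝ (translation a t (gaussian c hc)) = fun x => ∫ θ, damp c t θ •
      SchwartzMap.fderivCLM ℝ (Space n) ℝ (gaussian c hc) (x - shift t θ) ∂(angles a) := by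
    rw [hf]
    exact funext fun x => (hasFDerivAt_superposition hd hz _ x).fderiv
  have hDD : fderiv ℝ (fderiv ℝ (translation a t (gaussian c hc))) y = ∫ θ, damp c t θ •
      SchwartzMap.fderivCLM ℝ (Space n) (Space n →L[ℝ] ℝ)
      (SchwartzMap.fderivCLM ℝ (Space n) ℝ (gaussian c hc)) (y - shift t θ)
        ∂(angles a) := by
    rw [hD]
    exact (hasFDerivAt_superposition hd hz _ y).fderiv
  have hterm : ∀ i, iteratedFDeriv ℝ 2 (translation a t (gaussian c hc)) y
      (fun _ => EuclideanSpace.single i 1) + a i / y i *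
        fderiv ℝ (translation a t (gaussian c hc)) y (EuclideanSpace.single i 1) =
      ∫ θ, (4 * c ^ 2 * (y i ^ 2 + t i ^ 2 - 2 * y i * t i * Real.cos (θ i)) -
        2 * c * (1 + a i)) *
        gaussian c hc (move y t θ) ∂(angles a) := by
    intro i
    have hin : ∀ θ, inner ℝ (y - shift t θ) (EuclideanSpace.single i (1 : ℝ)) =
        y i - t i * Real.cos (θ i) := fun θ => by
      simp [EuclideanSpace.inner_single_right, shift]
    have e1 : fderiv ℝ (translation a t (gaussian c hc)) y (EuclideanSpace.single i 1) =
        ∫ θ, damp c t θ * (-(2 * c) * (y i - t i * Real.cos (θ i)) *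
          Real.exp (-c * ‖y - shift t θ‖ ^ 2)) ∂(angles a) := by
      rw [hD]
      have i1 := integrable_superposition hd hz
        (SchwartzMap.fderivCLM ℝ (Space n) ℝ (gaussian c hc)) y
      refine (ContinuousLinearMap.integral_apply i1 _).trans (integral_congr_ae (ae_of_all _
        fun θ => ?_))
      simp only [smul_apply, fderiv_gaussian, smul_eq_mul, hin]
    have e2 : iteratedFDeriv ℝ 2 (translation a t (gaussian c hc)) y
        (fun _ => EuclideanSpace.single i 1) =
        ∫ θ, damp c t θ * ((4 * c ^ 2 * (y i - t i * Real.cos (θ i)) ^ 2 - 2 * c) *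
          Real.exp (-c * ‖y - shift t θ‖ ^ 2)) ∂(angles a) := by
      rw [iteratedFDeriv_two_apply, hDD]
      have i1 := integrable_superposition hd hz
        (SchwartzMap.fderivCLM ℝ (Space n) (Space n →L[ℝ] ℝ)
          (SchwartzMap.fderivCLM ℝ (Space n) ℝ (gaussian c hc))) y
      rw [ContinuousLinearMap.integral_apply i1]
      refine (ContinuousLinearMap.integral_apply (i1.apply_continuousLinearMap _) _).trans
        (integral_congr_ae (ae_of_all _ fun θ => ?_))
      simp only [smul_apply, fderiv_fderiv_gaussian, smul_eq_mul, hin]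
      simp
    have e3 : ∀ θ, damp c t θ * Real.exp (-c * ‖y - shift t θ‖ ^ 2) =
        ∏ j, Real.exp (-c * (y j ^ 2 + t j ^ 2 - 2 * y j * t j * Real.cos (θ j))) := fun θ => by
      rw [← gaussian_move hc, gaussian_move_eq_shift]
      rfl
    have e4 := integral_angles_mul_prod_congr ha i
      (E := fun j θ => Real.exp (-c * (y j ^ 2 + t j ^ 2 - 2 * y j * t j * Real.cos θ)))
      (integral_angleMeasure_gaussian (ha i) c (t i) (hy i).ne')
    simp only [gaussian_move]
    rw [← e4, e1, e2, ← integral_const_mul, ← integral_add]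
    · refine integral_congr_ae (ae_of_all _ fun θ => ?_)
      simp only [← e3]
      ring
    · exact integrable_angles ha (by fun_prop)
    · exact integrable_angles ha (by fun_prop)
  unfold besselLaplace
  simp only [hterm]
  rw [translation_eq ha, ← integral_finsetSum]
  · congr 1
    ext θ
    rw [← Finset.sum_mul]
    unfold gaussianLaplace
    congr 2
    ext i
    rw [← chord_sq]
    rfl
  · intro i _
    simp only [gaussian_move]
    exact integrable_angles ha (by fun_prop)

end

end

section

variable {n : ℕ} {a : Fin n → ℝ}

/-! ### Rapidly decaying functions on the orthant -/

lemma weight_le_pow (ha : ∀ i, 0 < a i) {x : Space n} (hx : x ∈ orthant n) :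
    weight a x ≤ (1 + ‖x‖) ^ (∑ i, a i) := by
  rw [Real.rpow_sum_of_nonneg (by positivity) fun i _ => (ha i).le]
  refine Finset.prod_le_prod (fun i _ => Real.rpow_nonneg (hx i).le _) fun i _ => ?_
  refine Real.rpow_le_rpow (hx i).le ?_ (ha i).le
  have h1 : |x i| ≤ ‖x‖ := PiLp.norm_apply_le x i
  linarith [le_abs_self (x i)]

/-- Some negative power of `1 + ‖x‖` is integrable for `x ^ a dx`, since the weight grows at most
like a power. -/
lemma hasTemperateGrowth_wMeasure (ha : ∀ i, 0 < a i) : (wMeasure a).HasTemperateGrowth := by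
  obtain ⟨K, hK⟩ := exists_nat_ge (∑ i, a i)
  refine ⟨⟨K + (n + 1), ?_⟩⟩
  have h0 : Integrable (fun x : Space n => (1 + ‖x‖) ^ (-((n + 1 : ℕ) : ℝ))) volume :=
    integrable_one_add_norm (by simp)
  unfold wMeasure
  rw [integrable_withDensity_iff_integrable_smul₀'
    (measurable_weight a).ennreal_ofReal.aemeasurable (ae_of_all _ fun _ => ENNReal.ofReal_lt_top)]
  refine (h0.restrict (s := orthant n)).mono' ?_ ?_
  · refine Measurable.aestronglyMeasurable ?_
    have := measurable_weight a
    fun_prop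
  · refine (ae_restrict_mem measurableSet_orthant).mono fun x hx => ?_
    have h1 : 0 < 1 + ‖x‖ := by positivity
    rw [ENNReal.toReal_ofReal (weight_nonneg a hx), norm_smul,
      Real.norm_of_nonneg (weight_nonneg a hx), Real.norm_of_nonneg (Real.rpow_nonneg h1.le _)]
    have h2 : weight a x ≤ (1 + ‖x‖) ^ (K : ℝ) := (weight_le_pow ha hx).trans
      (Real.rpow_le_rpow_of_exponent_le (by simp) hK)
    refine (mul_le_mul_of_nonneg_right h2 (Real.rpow_nonneg h1.le _)).trans_eq ?_
    rw [← Real.rpow_add h1]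
    congr 1
    push_cast
    ring

/-- Functions which decay faster than every power on the orthant. -/
def RapidDecay (g : Space n → ℝ) : Prop :=
  ∀ N : ℕ, ∃ C, ∀ x ∈ orthant n, (1 + ‖x‖) ^ N * |g x| ≤ C

lemma RapidDecay.memLp (ha : ∀ i, 0 < a i) {g : Space n → ℝ} (hg : RapidDecay g)
    (hm : AEStronglyMeasurable g (wMeasure a)) (p : ℝ≥0∞) : MemLp g p (wMeasure a) := by
  obtain ⟨k, hk⟩ := (hasTemperateGrowth_wMeasure ha).exists_eLpNorm_lt_top p
  obtain ⟨C, hC⟩ := hg k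
  have h1 : MemLp (fun x : Space n => (1 + ‖x‖) ^ (-k : ℝ)) p (wMeasure a) :=
    ⟨Measurable.aestronglyMeasurable (by fun_prop), hk⟩
  refine h1.of_le_mul (c := C) hm ((ae_mem_orthant a).mono fun x hx => ?_)
  have h2 : 0 < 1 + ‖x‖ := by positivity
  rw [Real.norm_of_nonneg (Real.rpow_nonneg h2.le _), Real.rpow_neg h2.le, Real.rpow_natCast,
    ← div_eq_mul_inv, le_div_iff₀ (by positivity), mul_comm]
  exact hC x hx

lemma RapidDecay.add {f g : Space n → ℝ} (hf : RapidDecay f) (hg : RapidDecay g) :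
    RapidDecay fun x => f x + g x := fun N => by
  obtain ⟨A, hA⟩ := hf N
  obtain ⟨B, hB⟩ := hg N
  refine ⟨A + B, fun x hx => ?_⟩
  calc _ ≤ (1 + ‖x‖) ^ N * (|f x| + |g x|) := by gcongr; exact abs_add_le _ _
    _ ≤ _ := by rw [mul_add]; exact add_le_add (hA x hx) (hB x hx)

lemma RapidDecay.const_mul {f : Space n → ℝ} (hf : RapidDecay f) (c : ℝ) :
    RapidDecay fun x => c * f x := fun N => by
  obtain ⟨A, hA⟩ := hf N
  refine ⟨|c| * A, fun x hx => ?_⟩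
  rw [abs_mul, mul_left_comm]
  exact mul_le_mul_of_nonneg_left (hA x hx) (abs_nonneg c)

lemma RapidDecay.sum {ι : Type*} (s : Finset ι) {f : ι → Space n → ℝ}
    (hf : ∀ i ∈ s, RapidDecay (f i)) : RapidDecay fun x => ∑ i ∈ s, f i x := by
  classical
  induction s using Finset.induction_on with
  | empty => exact fun N => ⟨0, fun x _ => by simp⟩
  | insert i s hi ih =>
    simp only [Finset.sum_insert hi]
    exact (hf i (by simp)).add (ih fun j hj => hf j (by simp [hj]))

lemma RapidDecay.mul {f g : Space n → ℝ} (hf : RapidDecay f) (hg : RapidDecay g) :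
    RapidDecay fun x => f x * g x := fun N => by
  obtain ⟨A, hA⟩ := hf N
  obtain ⟨B, hB⟩ := hg 0
  refine ⟨A * B, fun x hx => ?_⟩
  rw [abs_mul, ← mul_assoc]
  have h1 := hA x hx
  have h2 := hB x hx
  rw [pow_zero, one_mul] at h2
  exact mul_le_mul h1 h2 (abs_nonneg _) (le_trans (by positivity) h1)

lemma SchwartzMap.exists_one_add_pow_mul_le {F : Type*} [NormedAddCommGroup F] [NormedSpace ℝ F]
    (φ : 𝓢(Space n, F)) (N : ℕ) : ∃ C, 0 ≤ C ∧ ∀ x, (1 + ‖x‖) ^ N * ‖φ x‖ ≤ C := by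
  obtain ⟨A, hA⟩ := φ.decay N 0
  obtain ⟨B, hB⟩ := φ.decay 0 0
  refine ⟨2 ^ (N - 1) * (B + A), mul_nonneg (by positivity) (add_nonneg hB.1.le hA.1.le), fun x => ?_⟩
  have hbin : (1 + ‖x‖) ^ N ≤ 2 ^ (N - 1) * (1 ^ N + ‖x‖ ^ N) :=
    add_pow_le zero_le_one (norm_nonneg x) N
  have h1 := hA.2 x
  have h2 := hB.2 x
  simp only [norm_iteratedFDeriv_zero, pow_zero, one_mul] at h1 h2
  calc (1 + ‖x‖) ^ N * ‖φ x‖ ≤ (2 ^ (N - 1) * (1 ^ N + ‖x‖ ^ N)) * ‖φ x‖ := by gcongr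
    _ = 2 ^ (N - 1) * (‖φ x‖ + ‖x‖ ^ N * ‖φ x‖) := by ring
    _ ≤ _ := by gcongr

lemma RapidDecay.of_schwartz (φ : 𝓢(Space n, ℝ)) : RapidDecay φ := fun N => by
  obtain ⟨C, _, hC⟩ := SchwartzMap.exists_one_add_pow_mul_le φ N
  exact ⟨C, fun x _ => hC x⟩

/-- The partial derivative of a Schwartz function. -/
def partialDeriv (i : Fin n) (φ : 𝓢(Space n, ℝ)) (x : Space n) : ℝ :=
  fderiv ℝ φ x (EuclideanSpace.single i 1)

/-- The second pure partial derivative of a Schwartz function. -/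
def partialDeriv₂ (i : Fin n) (φ : 𝓢(Space n, ℝ)) (x : Space n) : ℝ :=
  iteratedFDeriv ℝ 2 φ x (fun _ => EuclideanSpace.single i 1)

lemma partialDeriv₂_eq (i : Fin n) (φ : 𝓢(Space n, ℝ)) (x : Space n) :
    partialDeriv₂ i φ x =
      SchwartzMap.fderivCLM ℝ (Space n) (Space n →L[ℝ] ℝ) (SchwartzMap.fderivCLM ℝ (Space n) ℝ φ) x
        (EuclideanSpace.single i 1) (EuclideanSpace.single i 1) :=
  iteratedFDeriv_two_apply ..

lemma hasLineDerivAt_partialDeriv (i : Fin n) (φ : 𝓢(Space n, ℝ)) (x : Space n) :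
    HasLineDerivAt ℝ (partialDeriv i φ) (partialDeriv₂ i φ x) x (EuclideanSpace.single i 1) := by
  have h1 : HasFDerivAt (SchwartzMap.fderivCLM ℝ (Space n) ℝ φ)
      (SchwartzMap.fderivCLM ℝ (Space n) (Space n →L[ℝ] ℝ)
        (SchwartzMap.fderivCLM ℝ (Space n) ℝ φ) x) x :=
    (SchwartzMap.differentiableAt _).hasFDerivAt
  have h2 := (h1.clm_apply (hasFDerivAt_const (EuclideanSpace.single i (1 : ℝ)) x)).hasLineDerivAt
    (EuclideanSpace.single i 1)
  rw [add_apply, ContinuousLinearMap.flip_apply, ← partialDeriv₂_eq,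
    ContinuousLinearMap.comp_apply, zero_apply, map_zero, zero_add] at h2
  exact h2

lemma continuous_partialDeriv (i : Fin n) (φ : 𝓢(Space n, ℝ)) : Continuous (partialDeriv i φ) :=
  (SchwartzMap.fderivCLM ℝ (Space n) ℝ φ).continuous.clm_apply continuous_const

lemma continuous_partialDeriv₂ (i : Fin n) (φ : 𝓢(Space n, ℝ)) :
    Continuous (partialDeriv₂ i φ) := by
  simp only [funext (partialDeriv₂_eq i φ)]
  exact ((SchwartzMap.fderivCLM ℝ (Space n) (Space n →L[ℝ] ℝ)
    (SchwartzMap.fderivCLM ℝ (Space n) ℝ φ)).continuous.clm_apply continuous_const).clm_apply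
    continuous_const

lemma exists_partialDeriv_le (i : Fin n) (φ : 𝓢(Space n, ℝ)) (N : ℕ) :
    ∃ C, 0 ≤ C ∧ ∀ x, (1 + ‖x‖) ^ N * |partialDeriv i φ x| ≤ C := by
  obtain ⟨C, hC0, hC⟩ := SchwartzMap.exists_one_add_pow_mul_le (SchwartzMap.fderivCLM ℝ (Space n) ℝ φ) N
  refine ⟨C, hC0, fun x => le_trans ?_ (hC x)⟩
  gcongr
  have h := (SchwartzMap.fderivCLM ℝ (Space n) ℝ φ x).le_opNorm (EuclideanSpace.single i (1 : ℝ))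
  simpa [partialDeriv] using h

lemma exists_partialDeriv₂_le (i : Fin n) (φ : 𝓢(Space n, ℝ)) (N : ℕ) :
    ∃ C, 0 ≤ C ∧ ∀ x, (1 + ‖x‖) ^ N * |partialDeriv₂ i φ x| ≤ C := by
  obtain ⟨C, hC0, hC⟩ := SchwartzMap.exists_one_add_pow_mul_le
    (SchwartzMap.fderivCLM ℝ (Space n) (Space n →L[ℝ] ℝ) (SchwartzMap.fderivCLM ℝ (Space n) ℝ φ)) N
  refine ⟨C, hC0, fun x => le_trans ?_ (hC x)⟩
  gcongr
  rw [partialDeriv₂_eq]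
  have h := (SchwartzMap.fderivCLM ℝ (Space n) (Space n →L[ℝ] ℝ)
    (SchwartzMap.fderivCLM ℝ (Space n) ℝ φ) x).le_opNorm₂ (EuclideanSpace.single i (1 : ℝ))
    (EuclideanSpace.single i (1 : ℝ))
  simpa using h

lemma partialDeriv_eq_zero {φ : 𝓢(Space n, ℝ)} (hφ : φ ∈ evenSchwartz n) {i : Fin n}
    {x : Space n} (hx : x i = 0) : partialDeriv i φ x = 0 := by
  have h := hφ 0 i x hx
  rwa [iteratedFDeriv_one_apply] at h

/-- The quotient `∂ᵢφ / xᵢ` decays rapidly for even `φ`: by the mean value theorem it is bounded by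
the second derivative near the hyperplane, where `∂ᵢφ` vanishes. -/
lemma rapidDecay_partialDeriv_div {φ : 𝓢(Space n, ℝ)} (hφ : φ ∈ evenSchwartz n) (i : Fin n) :
    RapidDecay fun x => partialDeriv i φ x / x i := fun N => by
  obtain ⟨A, hA0, hA⟩ := exists_partialDeriv_le i φ N
  obtain ⟨B, hB0, hB⟩ := exists_partialDeriv₂_le i φ N
  refine ⟨A + 2 ^ N * B, fun x hx => ?_⟩
  have hxi := hx i
  rw [abs_div, abs_of_pos hxi, ← mul_div_assoc, div_le_iff₀ hxi]
  rcases le_total 1 (x i) with h1 | h1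
  · refine (hA x).trans ?_
    nlinarith [mul_nonneg (pow_nonneg zero_le_two N) hB0, mul_nonneg hA0 hxi.le]
  · set e : Space n := EuclideanSpace.single i 1
    have hd : ∀ s ∈ Icc (-x i) 0, HasDerivWithinAt (fun s : ℝ => partialDeriv i φ (x + s • e))
        (partialDeriv₂ i φ (x + s • e)) (Icc (-x i) 0) s := fun s _ => by
      have h2 := hasLineDerivAt_partialDeriv i φ (x + s • e)
      have h3 : HasDerivAt (fun t : ℝ => partialDeriv i φ (x + s • e + t • e))
        (partialDeriv₂ i φ (x + s • e)) (s - s) := by rw [sub_self]; exact h2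
      have h4 := h3.comp_sub_const s s
      refine (h4.congr_of_eventuallyEq (.of_forall fun t => ?_)).hasDerivWithinAt
      simp only
      congr 1
      module
    have hb : ∀ s ∈ Icc (-x i) 0, ‖partialDeriv₂ i φ (x + s • e)‖ ≤
        2 ^ N * B / (1 + ‖x‖) ^ N := fun s hs => by
      rw [le_div_iff₀ (by positivity), Real.norm_eq_abs, mul_comm]
      have h5 : 1 + ‖x‖ ≤ 2 * (1 + ‖x + s • e‖) := by
        have h6 : ‖x‖ ≤ ‖x + s • e‖ + ‖s • e‖ := norm_le_add_norm_add x (s • e)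
        have h7 : ‖s • e‖ ≤ 1 := by
          rw [norm_smul]
          simp only [e, PiLp.norm_single, norm_one, mul_one, Real.norm_eq_abs, abs_le]
          exact ⟨by linarith [hs.1], by linarith [hs.2]⟩
        have := norm_nonneg (x + s • e)
        linarith
      calc (1 + ‖x‖) ^ N * |partialDeriv₂ i φ (x + s • e)|
          ≤ (2 * (1 + ‖x + s • e‖)) ^ N * |partialDeriv₂ i φ (x + s • e)| := by gcongr
        _ = 2 ^ N * ((1 + ‖x + s • e‖) ^ N * |partialDeriv₂ i φ (x + s • e)|) := by
          rw [mul_pow, mul_assoc]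
        _ ≤ _ := by gcongr; exact hB _
    have hmv := (convex_Icc (-x i) (0 : ℝ)).norm_image_sub_le_of_norm_hasDerivWithin_le hd hb
      (left_mem_Icc.2 (by linarith)) (right_mem_Icc.2 (by linarith))
    have h0 : partialDeriv i φ (x + (-x i) • e) = 0 :=
      partialDeriv_eq_zero hφ (by simp [e])
    simp only [zero_smul, add_zero, h0, sub_zero, sub_neg_eq_add, zero_add, Real.norm_eq_abs,
      abs_of_pos hxi] at hmv
    calc (1 + ‖x‖) ^ N * |partialDeriv i φ x|
        ≤ (1 + ‖x‖) ^ N * (2 ^ N * B / (1 + ‖x‖) ^ N * x i) := by gcongr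
      _ = 2 ^ N * B * x i := by field_simp
      _ ≤ _ := by nlinarith [mul_nonneg hA0 hxi.le]

lemma rapidDecay_partialDeriv (i : Fin n) (φ : 𝓢(Space n, ℝ)) : RapidDecay (partialDeriv i φ) :=
  fun N => by
    obtain ⟨C, _, hC⟩ := exists_partialDeriv_le i φ N
    exact ⟨C, fun x _ => hC x⟩

lemma rapidDecay_partialDeriv₂ (i : Fin n) (φ : 𝓢(Space n, ℝ)) : RapidDecay (partialDeriv₂ i φ) :=
  fun N => by
    obtain ⟨C, _, hC⟩ := exists_partialDeriv₂_le i φ N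
    exact ⟨C, fun x _ => hC x⟩

/-- One summand of the Bessel-Laplace operator. -/
def besselDeriv (a : Fin n → ℝ) (i : Fin n) (φ : 𝓢(Space n, ℝ)) (x : Space n) : ℝ :=
  partialDeriv₂ i φ x + a i * (partialDeriv i φ x / x i)

lemma besselLaplace_eq (φ : 𝓢(Space n, ℝ)) :
    besselLaplace a φ = fun x => ∑ i, besselDeriv a i φ x := by
  funext x
  unfold besselLaplace besselDeriv partialDeriv partialDeriv₂
  refine Finset.sum_congr rfl fun i _ => ?_
  ring

lemma measurable_besselDeriv (i : Fin n) (φ : 𝓢(Space n, ℝ)) :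
    Measurable (besselDeriv a i φ) := by
  have h1 := (continuous_partialDeriv i φ).measurable
  have h2 := (continuous_partialDeriv₂ i φ).measurable
  unfold besselDeriv
  fun_prop

lemma rapidDecay_besselDeriv {φ : 𝓢(Space n, ℝ)} (hφ : φ ∈ evenSchwartz n) (i : Fin n) :
    RapidDecay (besselDeriv a i φ) :=
  (rapidDecay_partialDeriv₂ i φ).add ((rapidDecay_partialDeriv_div hφ i).const_mul (a i))

lemma measurable_besselLaplace (φ : 𝓢(Space n, ℝ)) : Measurable (besselLaplace a φ) := by
  rw [besselLaplace_eq]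
  exact Finset.measurable_fun_sum _ fun i _ => measurable_besselDeriv i φ

lemma rapidDecay_besselLaplace {φ : 𝓢(Space n, ℝ)} (hφ : φ ∈ evenSchwartz n) :
    RapidDecay (besselLaplace a φ) := by
  rw [besselLaplace_eq]
  exact RapidDecay.sum _ fun i _ => rapidDecay_besselDeriv hφ i

end

section

variable {n : ℕ} {a : Fin n → ℝ}

/-! ### Symmetry of the Bessel-Laplace operator -/

/-- The continuous extension of the weight by zero outside the orthant. -/
def extWeight (a : Fin n → ℝ) (x : Space n) : ℝ := ∏ i, max (x i) 0 ^ a i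

lemma extWeight_nonneg (x : Space n) : 0 ≤ extWeight a x :=
  Finset.prod_nonneg fun _ _ => Real.rpow_nonneg (le_max_right _ _) _

lemma continuous_extWeight (ha : ∀ i, 0 < a i) : Continuous (extWeight a) := by
  unfold extWeight
  refine continuous_finsetProd _ fun i _ => Continuous.rpow_const (by fun_prop) fun _ =>
    Or.inr (ha i).le

lemma extWeight_eq_zero (ha : ∀ i, 0 < a i) {x : Space n} {i : Fin n} (h : x i ≤ 0) :
    extWeight a x = 0 :=
  Finset.prod_eq_zero (Finset.mem_univ i) (by rw [max_eq_right h, Real.zero_rpow (ha i).ne'])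

lemma wMeasure_eq_withDensity (ha : ∀ i, 0 < a i) :
    wMeasure a = volume.withDensity fun x => ENNReal.ofReal (extWeight a x) := by
  unfold wMeasure
  rw [← withDensity_indicator measurableSet_orthant]
  congr 1
  ext1 x
  by_cases hx : x ∈ orthant n
  · rw [indicator_of_mem hx]
    congr 1
    exact Finset.prod_congr rfl fun i _ => by rw [max_eq_left (hx i).le]
  · rw [indicator_of_notMem hx]
    obtain ⟨i, hi⟩ := not_forall.1 hx
    rw [extWeight_eq_zero ha (not_lt.1 hi), ENNReal.ofReal_zero]

lemma integral_wMeasure (ha : ∀ i, 0 < a i) (F : Space n → ℝ) :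
    ∫ x, F x ∂(wMeasure a) = ∫ x, extWeight a x * F x := by
  rw [wMeasure_eq_withDensity ha, integral_withDensity_eq_integral_toReal_smul
    (continuous_extWeight ha).measurable.ennreal_ofReal (ae_of_all _ fun _ => ENNReal.ofReal_lt_top)]
  simp only [ENNReal.toReal_ofReal (extWeight_nonneg _), smul_eq_mul]

lemma integrable_wMeasure_iff (ha : ∀ i, 0 < a i) (F : Space n → ℝ) :
    Integrable F (wMeasure a) ↔ Integrable fun x => extWeight a x * F x := by
  rw [wMeasure_eq_withDensity ha, integrable_withDensity_iff_integrable_smul'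
    (continuous_extWeight ha).measurable.ennreal_ofReal (ae_of_all _ fun _ => ENNReal.ofReal_lt_top)]
  simp only [ENNReal.toReal_ofReal (extWeight_nonneg _), smul_eq_mul]

lemma hasLineDerivAt_extWeight (ha : ∀ i, 0 < a i) {i : Fin n} {x : Space n} (hx : x i ≠ 0) :
    HasLineDerivAt ℝ (extWeight a) (extWeight a x * (a i / x i)) x
      (EuclideanSpace.single i 1) := by
  unfold HasLineDerivAt
  rcases lt_or_gt_of_ne hx with h | h
  · rw [extWeight_eq_zero ha h.le, zero_mul]
    refine (hasDerivAt_const (0 : ℝ) (0 : ℝ)).congr_of_eventuallyEq ?_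
    have h1 : ∀ᶠ t : ℝ in nhds 0, x i + t < 0 := by
      refine Filter.Tendsto.eventually_lt_const h ?_
      have : Continuous fun t : ℝ => x i + t := by fun_prop
      simpa using this.tendsto 0
    filter_upwards [h1] with t ht
    exact extWeight_eq_zero (i := i) ha (by simpa using ht.le)
  · have h1 : ∀ᶠ t : ℝ in nhds 0, 0 < x i + t := by
      refine Filter.Tendsto.eventually_const_lt h ?_
      have : Continuous fun t : ℝ => x i + t := by fun_prop
      simpa using this.tendsto 0
    set C := ∏ j ∈ Finset.univ.erase i, max (x j) 0 ^ a j with hC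
    have h2 : ∀ᶠ t : ℝ in nhds 0, extWeight a (x + t • EuclideanSpace.single i 1) =
        (x i + t) ^ a i * C := by
      filter_upwards [h1] with t ht
      unfold extWeight
      rw [← Finset.mul_prod_erase _ _ (Finset.mem_univ i)]
      congr 1
      · simp [max_eq_left ht.le]
      · refine Finset.prod_congr rfl fun j hj => ?_
        simp [Finset.ne_of_mem_erase hj]
    have h3 := (((hasDerivAt_id (0 : ℝ)).const_add (x i)).rpow_const (p := a i)
      (Or.inl (by simpa using h.ne'))).mul_const C
    refine (h3.congr_of_eventuallyEq h2).congr_deriv ?_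
    have h4 := h2.self_of_nhds
    simp only [zero_smul, add_zero] at h4
    rw [h4]
    simp only [id, add_zero]
    rw [Real.rpow_sub_one h.ne']
    ring

/-- The divergence form `∂ᵢ(x ^ a ∂ᵢφ) = x ^ a (∂ᵢ²φ + (aᵢ / xᵢ) ∂ᵢφ)`, valid on the whole space for
the weight extended by zero. -/
lemma hasLineDerivAt_extWeight_mul (ha : ∀ i, 0 < a i) {φ : 𝓢(Space n, ℝ)}
    (hφ : φ ∈ evenSchwartz n) (i : Fin n) (x : Space n) :
    HasLineDerivAt ℝ (fun x => extWeight a x * partialDeriv i φ x)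
      (extWeight a x * besselDeriv a i φ x) x (EuclideanSpace.single i 1) := by
  have hd := hasLineDerivAt_partialDeriv i φ x
  by_cases hx : x i = 0
  · -- On the hyperplane both factors vanish, so the difference quotient tends to zero although the
    -- weight itself need not be differentiable.
    rw [extWeight_eq_zero ha hx.le, zero_mul]
    unfold HasLineDerivAt at hd ⊢
    rw [hasDerivAt_iff_tendsto_slope_zero] at hd ⊢
    have h1 : Filter.Tendsto (fun t : ℝ => extWeight a (x + t • EuclideanSpace.single i 1))
        (nhdsWithin 0 {0}ᶜ) (nhds 0) := by
      have hc : Continuous fun t : ℝ => extWeight a (x + t • EuclideanSpace.single i 1) :=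
        (continuous_extWeight ha).comp (by fun_prop)
      have h2 := (hc.tendsto 0).mono_left (nhdsWithin_le_nhds (s := {0}ᶜ))
      simpa [extWeight_eq_zero ha hx.le] using h2
    have h3 := h1.mul hd
    rw [zero_mul] at h3
    refine h3.congr fun t => ?_
    simp only [zero_add, zero_smul, add_zero, partialDeriv_eq_zero hφ hx, smul_eq_mul]
    ring
  · have h1 := (hasLineDerivAt_extWeight ha hx)
    unfold HasLineDerivAt at hd h1 ⊢
    refine (h1.mul hd).congr_deriv ?_
    simp only [zero_smul, add_zero, besselDeriv]
    ring

lemma hasLineDerivAt_schwartz (i : Fin n) (ψ : 𝓢(Space n, ℝ)) (x : Space n) :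
    HasLineDerivAt ℝ ψ (partialDeriv i ψ x) x (EuclideanSpace.single i 1) :=
  ψ.differentiableAt.hasFDerivAt.hasLineDerivAt _

lemma RapidDecay.integrable (ha : ∀ i, 0 < a i) {g : Space n → ℝ} (hg : RapidDecay g)
    (hm : Measurable g) : Integrable g (wMeasure a) :=
  memLp_one_iff_integrable.1 (hg.memLp ha hm.aestronglyMeasurable 1)

/-- Integration by parts in one variable. The weight extended by zero makes this an integration over
the whole space, without boundary terms. -/
lemma integral_besselDeriv_mul (ha : ∀ i, 0 < a i) {φ ψ : 𝓢(Space n, ℝ)}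
    (hφ : φ ∈ evenSchwartz n) (i : Fin n) :
    ∫ x, besselDeriv a i φ x * ψ x ∂(wMeasure a) =
      -∫ x, partialDeriv i φ x * partialDeriv i ψ x ∂(wMeasure a) := by
  have m1 := (continuous_partialDeriv i φ).measurable
  have m2 := (continuous_partialDeriv i ψ).measurable
  have m3 := measurable_besselDeriv (a := a) i φ
  have m4 := ψ.continuous.measurable
  have d1 := rapidDecay_partialDeriv i φ
  have d2 := rapidDecay_partialDeriv i ψ
  have d3 := rapidDecay_besselDeriv (a := a) hφ i
  have d4 := RapidDecay.of_schwartz ψ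
  rw [integral_wMeasure ha, integral_wMeasure ha]
  have key := integral_bilinear_hasLineDerivAt_right_eq_neg_left_of_integrable
    (μ := (volume : Measure (Space n)))
    (f := fun x => extWeight a x * partialDeriv i φ x)
    (f' := fun x => extWeight a x * besselDeriv a i φ x) (g := ψ) (g' := partialDeriv i ψ)
    (v := EuclideanSpace.single i 1) (B := ContinuousLinearMap.mul ℝ ℝ)
  simp only [ContinuousLinearMap.mul_apply', mul_assoc] at key
  rw [key ((integrable_wMeasure_iff ha _).1 ((d3.mul d4).integrable ha (m3.mul m4)))
    ((integrable_wMeasure_iff ha _).1 ((d1.mul d2).integrable ha (m1.mul m2)))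
    ((integrable_wMeasure_iff ha _).1 ((d1.mul d4).integrable ha (m1.mul m4)))
    (fun x _ => hasLineDerivAt_extWeight_mul ha hφ i x)
    (fun x _ => hasLineDerivAt_schwartz i ψ x), neg_neg]

/-- The Bessel-Laplace operator is symmetric on the even Schwartz class. -/
lemma integral_besselLaplace_mul (ha : ∀ i, 0 < a i) {φ ψ : 𝓢(Space n, ℝ)}
    (hφ : φ ∈ evenSchwartz n) (hψ : ψ ∈ evenSchwartz n) :
    ∫ x, besselLaplace a φ x * ψ x ∂(wMeasure a) =
      ∫ x, φ x * besselLaplace a ψ x ∂(wMeasure a) := by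
  simp only [besselLaplace_eq, Finset.sum_mul, Finset.mul_sum]
  rw [integral_finsetSum, integral_finsetSum]
  · refine Finset.sum_congr rfl fun i _ => ?_
    rw [integral_besselDeriv_mul ha hφ]
    have h := integral_besselDeriv_mul (ψ := φ) ha hψ i
    simp only [mul_comm (φ _)]
    rw [h]
    simp only [mul_comm]
  · exact fun i _ => ((RapidDecay.of_schwartz φ).mul (rapidDecay_besselDeriv hψ i)).integrable ha
      (φ.continuous.measurable.mul (measurable_besselDeriv i ψ))
  · exact fun i _ => ((rapidDecay_besselDeriv hφ i).mul (RapidDecay.of_schwartz ψ)).integrable ha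
      ((measurable_besselDeriv i φ).mul ψ.continuous.measurable)

lemma isBesselLaplace_evenSchwartz (ha : ∀ i, 0 < a i) (p : ℝ≥0) {φ : 𝓢(Space n, ℝ)}
    (hφ : φ ∈ evenSchwartz n) : IsBesselLaplace a p φ (besselLaplace a φ) :=
  ⟨(rapidDecay_besselLaplace hφ).memLp ha (measurable_besselLaplace φ).aestronglyMeasurable p,
    fun _ hψ => integral_besselLaplace_mul ha hφ hψ⟩

lemma memLp_schwartz (ha : ∀ i, 0 < a i) (p : ℝ≥0∞) (φ : 𝓢(Space n, ℝ)) :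
    MemLp φ p (wMeasure a) :=
  (RapidDecay.of_schwartz φ).memLp ha φ.continuous.aestronglyMeasurable p

lemma evenSchwartz_subset_sobolev (ha : ∀ i, 0 < a i) (p : ℝ≥0) {φ : 𝓢(Space n, ℝ)}
    (hφ : φ ∈ evenSchwartz n) : (φ : Space n → ℝ) ∈ sobolev a p :=
  ⟨memLp_schwartz ha p φ, _, isBesselLaplace_evenSchwartz ha p hφ⟩

end

section

variable {n : ℕ} {a : Fin n → ℝ}

/-! ### Spherical differences of even Schwartz functions -/

/-- The mean chord differs from its radius by second order terms only, since `cos` has mean zero. -/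
lemma abs_integral_chord_sub_le {b : ℝ} (hb : 0 < b) {x : ℝ} (hx : 0 < x) (t : ℝ) :
    |∫ θ, (chord x t θ - x) ∂(angleMeasure b)| ≤ t ^ 2 / x := by
  have := isProbabilityMeasure_angleMeasure hb
  have hcos : ∫ θ, Real.cos θ ∂(angleMeasure b) = 0 := by
    have h := integral_angleMeasure_by_parts hb (G := fun _ => 1) (G' := fun _ => 0)
      (fun θ => hasDerivAt_const θ 1) continuous_const
    simp only [mul_one, mul_zero, add_zero, integral_const_mul, mul_eq_zero, hb.ne', false_or] at h
    exact h
  have hchord : Continuous fun θ => chord x t θ := by fun_prop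
  have h1 : ∀ θ, chord x t θ - x =
      (t ^ 2 / (2 * x) - t * Real.cos θ) - (chord x t θ - x) ^ 2 / (2 * x) := fun θ => by
    have h := chord_sq x t θ
    field_simp
    linear_combination h
  have hsq : ∀ θ, (chord x t θ - x) ^ 2 ≤ t ^ 2 := fun θ =>
    sq_le_sq.2 (abs_chord_sub_le hx.le t θ)
  have h2 : ∫ θ, (chord x t θ - x) ∂(angleMeasure b) =
      t ^ 2 / (2 * x) - (∫ θ, (chord x t θ - x) ^ 2 ∂(angleMeasure b)) / (2 * x) := by
    rw [integral_congr_ae (ae_of_all _ h1), integral_sub, integral_sub, integral_const_mul, hcos]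
    · simp [integral_div]
    · exact integrable_const _
    · exact integrable_angleMeasure hb (by fun_prop)
    · exact integrable_angleMeasure hb (by fun_prop)
    · exact integrable_angleMeasure hb (by fun_prop)
  have h3 : 0 ≤ ∫ θ, (chord x t θ - x) ^ 2 ∂(angleMeasure b) :=
    integral_nonneg fun θ => sq_nonneg _
  have h4 : ∫ θ, (chord x t θ - x) ^ 2 ∂(angleMeasure b) ≤ t ^ 2 := by
    have := integral_mono (μ := angleMeasure b)
      (integrable_angleMeasure hb (by fun_prop)) (integrable_const (t ^ 2)) hsq
    simpa using this
  rw [h2, ← sub_div, abs_div, abs_of_pos (by positivity : 0 < 2 * x), abs_of_nonneg (by linarith)]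
  rw [div_le_div_iff₀ (by positivity) hx]
  nlinarith [mul_nonneg h3 hx.le, mul_nonneg (sq_nonneg t) hx.le]

/-- Taylor's formula to first order, with a bound for the remainder by the second derivative on a
ball. -/
lemma norm_sub_sub_fderiv_le (φ : 𝓢(Space n, ℝ)) {x z : Space n} {r M : ℝ} (hr : 0 ≤ r)
    (hM : ∀ y, ‖y - x‖ ≤ r → ‖SchwartzMap.fderivCLM ℝ (Space n) (Space n →L[ℝ] ℝ)
      (SchwartzMap.fderivCLM ℝ (Space n) ℝ φ) y‖ ≤ M) (hz : ‖z - x‖ ≤ r) :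
    |φ z - φ x - fderiv ℝ φ x (z - x)| ≤ M * r ^ 2 := by
  have hM0 : 0 ≤ M := (norm_nonneg _).trans (hM x (by simpa))
  have hconv : Convex ℝ (Metric.closedBall x r) := convex_closedBall x r
  have h1 : ∀ y ∈ Metric.closedBall x r, ‖fderiv ℝ φ y - fderiv ℝ φ x‖ ≤ M * r := fun y hy => by
    have h2 := hconv.norm_image_sub_le_of_norm_hasFDerivWithin_le (𝕜 := ℝ)
      (f := SchwartzMap.fderivCLM ℝ (Space n) ℝ φ)
      (f' := SchwartzMap.fderivCLM ℝ (Space n) (Space n →L[ℝ] ℝ)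
        (SchwartzMap.fderivCLM ℝ (Space n) ℝ φ)) (C := M)
      (fun y _ => (SchwartzMap.differentiableAt _).hasFDerivAt.hasFDerivWithinAt)
      (fun y hy => hM y (by rwa [← dist_eq_norm])) (Metric.mem_closedBall_self hr) hy
    refine h2.trans ?_
    gcongr
    rwa [← dist_eq_norm]
  have h3 := hconv.norm_image_sub_le_of_norm_hasFDerivWithin_le' (𝕜 := ℝ) (f := φ)
    (f' := fderiv ℝ φ) (φ := fderiv ℝ φ x) (C := M * r)
    (fun y _ => φ.differentiableAt.hasFDerivAt.hasFDerivWithinAt) h1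
    (Metric.mem_closedBall_self hr) (by rwa [Metric.mem_closedBall, dist_eq_norm] : z ∈ _)
  rw [Real.norm_eq_abs] at h3
  refine h3.trans ?_
  rw [sq, ← mul_assoc]
  gcongr

/-- The Bessel translation by a short vector changes an even Schwartz function to second order. -/
lemma exists_sub_translation_le (ha : ∀ i, 0 < a i) {φ : 𝓢(Space n, ℝ)}
    (hφ : φ ∈ evenSchwartz n) (N : ℕ) :
    ∃ C, 0 ≤ C ∧ ∀ x ∈ orthant n, ∀ t : Space n, ‖t‖ ≤ 1 →
      (1 + ‖x‖) ^ N * |φ x - translation a t φ x| ≤ C * ‖t‖ ^ 2 := by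
  have hprob := isProbabilityMeasure_angles ha
  obtain ⟨B, hB0, hB⟩ := SchwartzMap.exists_one_add_pow_mul_le
    (SchwartzMap.fderivCLM ℝ (Space n) (Space n →L[ℝ] ℝ) (SchwartzMap.fderivCLM ℝ (Space n) ℝ φ)) N
  choose A hA using fun i => rapidDecay_partialDeriv_div hφ i N
  refine ⟨2 ^ N * B + ∑ i, |A i|, by positivity, fun x hx t ht => ?_⟩
  set w := (1 + ‖x‖) ^ N with hw
  have hw0 : 0 < w := by positivity
  have hM : ∀ y, ‖y - x‖ ≤ ‖t‖ → ‖SchwartzMap.fderivCLM ℝ (Space n) (Space n →L[ℝ] ℝ)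
      (SchwartzMap.fderivCLM ℝ (Space n) ℝ φ) y‖ ≤ 2 ^ N * B / w := fun y hy => by
    rw [le_div_iff₀ hw0, mul_comm]
    have h5 : 1 + ‖x‖ ≤ 2 * (1 + ‖y‖) := by
      have h6 : ‖x‖ ≤ ‖y‖ + ‖y - x‖ := norm_le_norm_add_norm_sub' x y |>.trans (by rw [norm_sub_rev])
      have := norm_nonneg y
      linarith
    calc w * _ ≤ (2 * (1 + ‖y‖)) ^ N * _ := by rw [hw]; gcongr
      _ = 2 ^ N * ((1 + ‖y‖) ^ N * _) := by rw [mul_pow, mul_assoc]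
      _ ≤ _ := by gcongr; exact hB y
  have hR : ∀ θ, ‖move x t θ - x‖ ≤ ‖t‖ := norm_move_sub_le hx t
  have hmc : Continuous fun θ => move x t θ := 
    continuous_move.comp (continuous_const.prodMk (continuous_const.prodMk continuous_id))
  have hlin : ∀ θ, fderiv ℝ φ x (move x t θ - x) =
      ∑ i, partialDeriv i φ x * (chord (x i) (t i) (θ i) - x i) := fun θ => by
    have h : move x t θ - x =
        ∑ i, (chord (x i) (t i) (θ i) - x i) • EuclideanSpace.single i (1 : ℝ) := by
      ext j
      simp [move, Finset.sum_apply, Pi.single_apply]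
    rw [h, map_sum]
    refine Finset.sum_congr rfl fun i _ => ?_
    rw [map_smul, smul_eq_mul, mul_comm]
    rfl
  have hchord : ∀ i, Continuous fun θ : Fin n → ℝ => chord (x i) (t i) (θ i) := fun i => by fun_prop
  have hsplit : translation a t φ x - φ x =
      ∫ θ, (φ (move x t θ) - φ x - fderiv ℝ φ x (move x t θ - x)) ∂(angles a) +
      ∑ i, partialDeriv i φ x * ∫ θ, (chord (x i) (t i) θ - x i) ∂(angleMeasure (a i)) := by
    have i1 : Integrable (fun θ => φ (move x t θ)) (angles a) :=
      integrable_angles ha (φ.continuous.comp hmc)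
    have i2 : ∀ i, Integrable (fun θ : Fin n → ℝ => partialDeriv i φ x *
        (chord (x i) (t i) (θ i) - x i)) (angles a) := fun i =>
      integrable_angles ha (by fun_prop)
    have i3 : Integrable (fun θ => φ (move x t θ) - φ x) (angles a) := i1.sub (integrable_const _)
    rw [integral_sub i3, integral_sub i1 (integrable_const _), translation_eq ha]
    · simp only [hlin]
      rw [integral_finsetSum _ fun i _ => i2 i]
      have h : ∀ i, ∫ θ, partialDeriv i φ x * (chord (x i) (t i) (θ i) - x i) ∂(angles a) =
          partialDeriv i φ x * ∫ θ, (chord (x i) (t i) θ - x i) ∂(angleMeasure (a i)) := fun i => by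
        rw [integral_const_mul]
        congr 1
        exact integral_angles_eval ha i (F := fun θ => chord (x i) (t i) θ - x i)
          (Continuous.measurable (by fun_prop))
      simp only [h]
      simp
    · simp only [hlin]
      exact integrable_finsetSum _ fun i _ => i2 i
  have hrem : |∫ θ, (φ (move x t θ) - φ x - fderiv ℝ φ x (move x t θ - x)) ∂(angles a)| ≤
      2 ^ N * B / w * ‖t‖ ^ 2 := by
    have h := norm_integral_le_of_norm_le_const (μ := angles a)
      (f := fun θ => φ (move x t θ) - φ x - fderiv ℝ φ x (move x t θ - x))
      (ae_of_all _ fun θ => norm_sub_sub_fderiv_le φ (norm_nonneg t) hM (hR θ))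
    simpa using h
  have hsum : ∀ i, |partialDeriv i φ x * ∫ θ, (chord (x i) (t i) θ - x i) ∂(angleMeasure (a i))| ≤
      |A i| / w * ‖t‖ ^ 2 := fun i => by
    have h1 := abs_integral_chord_sub_le (ha i) (hx i) (t i)
    have h2 : |partialDeriv i φ x / x i| ≤ |A i| / w := by
      rw [le_div_iff₀ hw0, mul_comm]
      exact (hA i x hx).trans (le_abs_self _)
    have h3 : t i ^ 2 ≤ ‖t‖ ^ 2 := sq_le_sq.2 (by
      rw [abs_norm]; exact PiLp.norm_apply_le t i)
    calc _ ≤ |partialDeriv i φ x| * (t i ^ 2 / x i) := by rw [abs_mul]; gcongr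
      _ = |partialDeriv i φ x / x i| * t i ^ 2 := by
        rw [abs_div, abs_of_pos (hx i)]
        ring
      _ ≤ _ := by gcongr
  rw [abs_sub_comm, hsplit]
  calc _ ≤ w * (2 ^ N * B / w * ‖t‖ ^ 2 + ∑ i, |A i| / w * ‖t‖ ^ 2) := by
        gcongr
        refine (abs_add_le _ _).trans (add_le_add hrem ?_)
        exact (Finset.abs_sum_le_sum_abs _ _).trans (Finset.sum_le_sum fun i _ => hsum i)
    _ = _ := by
        rw [← Finset.sum_mul, ← Finset.sum_div]
        field_simp

/-- The spherical difference of an even Schwartz function is of second order in the radius, with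
rapid decay in space. -/
lemma exists_sphericalDiff_le (ha : ∀ i, 0 < a i) {φ : 𝓢(Space n, ℝ)}
    (hφ : φ ∈ evenSchwartz n) (N : ℕ) :
    ∃ C, 0 ≤ C ∧ ∀ x ∈ orthant n, ∀ r : ℝ, 0 ≤ r → r ≤ 1 →
      (1 + ‖x‖) ^ N * |sphericalDiff a r φ x| ≤ C * r ^ 2 := by
  obtain ⟨C, hC0, hC⟩ := exists_sub_translation_le ha hφ N
  refine ⟨|1 / sphereArea a| * (C * (sphereMeasure n).real univ),
    mul_nonneg (abs_nonneg _) (mul_nonneg hC0 measureReal_nonneg),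
    fun x hx r hr0 hr1 => ?_⟩
  have hw0 : 0 < (1 + ‖x‖) ^ N := by positivity
  have h1 : ∀ᵐ Θ : Metric.sphere (0 : Space n) 1 ∂(sphereMeasure n),
      ‖(φ x - translation a (r • (Θ : Space n)) φ x) *
      weight a (Θ : Space n)‖ ≤ C * r ^ 2 / (1 + ‖x‖) ^ N := by
    refine ae_sphere_mem_orthant.mono fun Θ hΘ => ?_
    have hn : ‖r • (Θ : Space n)‖ = r := by
      rw [norm_smul, norm_eq_of_mem_sphere, mul_one, Real.norm_of_nonneg hr0]
    rw [norm_mul, Real.norm_of_nonneg (weight_nonneg a hΘ)]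
    refine (mul_le_of_le_one_right (norm_nonneg _) (weight_le_one ha hΘ (by simp))).trans ?_
    rw [le_div_iff₀ hw0, mul_comm, Real.norm_eq_abs]
    have h2 := hC x hx (r • (Θ : Space n)) (by rw [hn]; exact hr1)
    rwa [hn] at h2
  have h3 := norm_integral_le_of_norm_le_const h1
  rw [Real.norm_eq_abs] at h3
  unfold sphericalDiff
  rw [abs_mul]
  calc _ ≤ (1 + ‖x‖) ^ N * (|1 / sphereArea a| *
        (C * r ^ 2 / (1 + ‖x‖) ^ N * (sphereMeasure n).real univ)) := by gcongr
    _ = _ := by field_simp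

/-- For small radii the bound is the second order estimate, for large radii it is the uniform
boundedness of spherical differences on `L^p_a`. -/
lemma exists_eLpNorm_sphericalDiff_le (ha : ∀ i, 0 < a i) {p : ℝ≥0} (hp : 1 ≤ p)
    {φ : 𝓢(Space n, ℝ)} (hφ : φ ∈ evenSchwartz n) :
    ∃ K : ℝ≥0∞, K ≠ ∞ ∧ ∀ r : ℝ, 0 < r →
      eLpNorm (sphericalDiff a r φ) p (wMeasure a) ≤ K * ENNReal.ofReal (min 1 (r ^ 2)) := by
  have hm := φ.continuous.measurable
  have hφp := memLp_schwartz ha (p : ℝ≥0∞) φ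
  obtain ⟨k, hk⟩ := (hasTemperateGrowth_wMeasure ha).exists_eLpNorm_lt_top (p : ℝ≥0∞)
  obtain ⟨C, hC0, hC⟩ := exists_sphericalDiff_le ha hφ k
  obtain ⟨D, hD, hDr⟩ := exists_eLpNorm_sdiff_le (a := a) ha
  refine ⟨ENNReal.ofReal C * eLpNorm (fun x : Space n => (1 + ‖x‖) ^ (-k : ℝ)) p (wMeasure a) +
    D * eLpNorm φ p (wMeasure a), ENNReal.add_ne_top.2 ⟨ENNReal.mul_ne_top ENNReal.ofReal_ne_top
      hk.ne, ENNReal.mul_ne_top hD hφp.2.ne⟩, fun r hr => ?_⟩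
  rcases le_total r 1 with h1 | h1
  · have hmin : min 1 (r ^ 2) = r ^ 2 := min_eq_right (by nlinarith)
    rw [hmin, add_mul]
    refine le_add_right ?_
    have h2 : ∀ᵐ x ∂(wMeasure a), ‖sphericalDiff a r φ x‖ ≤
        (C * r ^ 2) * ‖(1 + ‖x‖) ^ (-k : ℝ)‖ := (ae_mem_orthant a).mono fun x hx => by
      have h2 : 0 < 1 + ‖x‖ := by positivity
      rw [Real.norm_of_nonneg (Real.rpow_nonneg h2.le _), Real.rpow_neg h2.le, Real.rpow_natCast,
        ← div_eq_mul_inv, le_div_iff₀ (by positivity), mul_comm]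
      exact hC x hx r hr.le h1
    refine (eLpNorm_le_mul_eLpNorm_of_ae_le_mul h2 _).trans_eq ?_
    rw [ENNReal.ofReal_mul hC0]
    ring
  · have hmin : min 1 (r ^ 2) = 1 := min_eq_left (by nlinarith)
    rw [hmin, ENNReal.ofReal_one, mul_one, eLpNorm_congr_ae (sphericalDiff_ae_eq ha r hp hm hφp)]
    exact (hDr r hp hm).trans le_add_self

end

section

variable {n : ℕ} {a : Fin n → ℝ}

/-! ### The Gagliardo integral -/

/-- The integrand `(A / t ^ s) ^ p / t` of the Gagliardo integral. -/
def radialTerm (s : ℝ) (p : ℝ≥0) (A : ℝ≥0∞) (t : ℝ) : ℝ≥0∞ :=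
  (A / ENNReal.ofReal (t ^ s)) ^ (p : ℝ) / ENNReal.ofReal t

lemma radialTerm_mono (s : ℝ) (p : ℝ≥0) {A B : ℝ≥0∞} (h : A ≤ B) (t : ℝ) :
    radialTerm s p A t ≤ radialTerm s p B t := by
  unfold radialTerm
  gcongr

lemma radialTerm_const_mul (s : ℝ) (p : ℝ≥0) (K A : ℝ≥0∞) (t : ℝ) :
    radialTerm s p (K * A) t = K ^ (p : ℝ) * radialTerm s p A t := by
  unfold radialTerm
  rw [mul_div_assoc, ENNReal.mul_rpow_of_nonneg _ _ p.coe_nonneg, mul_div_assoc]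

lemma radialTerm_add_le (s : ℝ) {p : ℝ≥0} (hp : 1 ≤ p) (A B : ℝ≥0∞) (t : ℝ) :
    radialTerm s p (A + B) t ≤
      2 ^ ((p : ℝ) - 1) * radialTerm s p A t + 2 ^ ((p : ℝ) - 1) * radialTerm s p B t := by
  unfold radialTerm
  rw [← mul_add, ← ENNReal.add_div, ← mul_div_assoc, ENNReal.add_div]
  gcongr
  exact ENNReal.rpow_add_le_mul_rpow_add_rpow _ _ (by exact_mod_cast hp)

lemma measurable_radialTerm (s : ℝ) (p : ℝ≥0) {A : ℝ → ℝ≥0∞} (hA : Measurable A) :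
    Measurable fun t => radialTerm s p (A t) t := by
  unfold radialTerm
  fun_prop

/-- The integrand is at most `t ^ ((2 - s) p - 1)` near `0` and `t ^ (-s p - 1)` near `∞`. -/
lemma lintegral_radialTerm_min_lt_top {s : ℝ} (hs0 : 0 < s) (hs2 : s < 2) {p : ℝ≥0} (hp : 1 ≤ p) :
    ∫⁻ t in Ioi (0 : ℝ), radialTerm s p (ENNReal.ofReal (min 1 (t ^ 2))) t < ∞ := by
  have hp' : (1 : ℝ) ≤ p := by exact_mod_cast hp
  have key : ∀ (q : ℝ) (t : ℝ), 0 < t → radialTerm s p (ENNReal.ofReal (t ^ q)) t =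
      ENNReal.ofReal (t ^ ((q - s) * p - 1)) := fun q t ht => by
    unfold radialTerm
    rw [← ENNReal.ofReal_div_of_pos (Real.rpow_pos_of_pos ht s), ← Real.rpow_sub ht,
      ENNReal.ofReal_rpow_of_pos (Real.rpow_pos_of_pos ht _), ← Real.rpow_mul ht.le,
      ← ENNReal.ofReal_div_of_pos ht, Real.rpow_sub_one ht.ne']
  rw [← Ioc_union_Ioi_eq_Ioi (zero_le_one' ℝ), lintegral_union measurableSet_Ioi
    (Ioc_disjoint_Ioi le_rfl)]
  refine ENNReal.add_lt_top.2 ⟨?_, ?_⟩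
  · have h1 : ∫⁻ t in Ioc (0 : ℝ) 1, radialTerm s p (ENNReal.ofReal (min 1 (t ^ 2))) t =
        ∫⁻ t in Ioc (0 : ℝ) 1, ENNReal.ofReal (t ^ ((2 - s) * p - 1)) := by
      refine setLIntegral_congr_fun measurableSet_Ioc fun t ht => ?_
      rw [min_eq_right (by nlinarith [ht.1, ht.2]), ← key 2 t ht.1, Real.rpow_two]
    rw [h1]
    have h2 : IntervalIntegrable (fun t : ℝ => t ^ ((2 - s) * p - 1)) volume 0 1 :=
      intervalIntegral.intervalIntegrable_rpow' (by nlinarith)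
    exact ((intervalIntegrable_iff_integrableOn_Ioc_of_le zero_le_one).1 h2).lintegral_lt_top
  · have h1 : ∫⁻ t in Ioi (1 : ℝ), radialTerm s p (ENNReal.ofReal (min 1 (t ^ 2))) t =
        ∫⁻ t in Ioi (1 : ℝ), ENNReal.ofReal (t ^ ((0 - s) * p - 1)) := by
      refine setLIntegral_congr_fun measurableSet_Ioi fun t ht => ?_
      have ht1 : 1 < t := ht
      rw [min_eq_left (by nlinarith), ← key 0 t (by linarith), Real.rpow_zero]
    rw [h1]
    exact (integrableOn_Ioi_rpow_of_lt (by nlinarith) one_pos).lintegral_lt_top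

/-- The outer exponents `1 / p` and `p` of the seminorm cancel. -/
lemma fracNorm_eq {p : ℝ≥0} (hp : 1 ≤ p) (s : ℝ) (f : Space n → ℝ) :
    fracNorm a s p f = (eLpNorm f p (wMeasure a) ^ (p : ℝ) + ∫⁻ t in Ioi (0 : ℝ),
      radialTerm s p (eLpNorm (sphericalDiff a t f) p (wMeasure a)) t) ^ (1 / (p : ℝ)) := by
  have hp' : (0 : ℝ) < p := lt_of_lt_of_le one_pos (by exact_mod_cast hp)
  unfold fracNorm gagliardo radialTerm
  rw [one_div, ENNReal.rpow_inv_rpow hp'.ne']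

lemma evenSchwartz_subset_fracSobolev (ha : ∀ i, 0 < a i) {s : ℝ} (hs0 : 0 < s) (hs2 : s < 2)
    {p : ℝ≥0} (hp : 1 ≤ p) {φ : 𝓢(Space n, ℝ)} (hφ : φ ∈ evenSchwartz n) :
    (φ : Space n → ℝ) ∈ fracSobolev a s p := by
  have hp' : (0 : ℝ) < p := lt_of_lt_of_le one_pos (by exact_mod_cast hp)
  have hφp := memLp_schwartz ha (p : ℝ≥0∞) φ
  refine ⟨hφp, ?_⟩
  obtain ⟨K, hK, h⟩ := exists_eLpNorm_sphericalDiff_le ha hp hφ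
  rw [fracNorm_eq hp]
  refine ENNReal.rpow_lt_top_of_nonneg (by positivity) (ENNReal.add_ne_top.2
    ⟨ENNReal.rpow_ne_top_of_nonneg hp'.le hφp.2.ne, ne_of_lt ?_⟩)
  calc _ ≤ ∫⁻ t in Ioi (0 : ℝ), radialTerm s p (K * ENNReal.ofReal (min 1 (t ^ 2))) t :=
        setLIntegral_mono' measurableSet_Ioi fun t ht => radialTerm_mono s p (h t ht) t
    _ = K ^ (p : ℝ) * ∫⁻ t in Ioi (0 : ℝ), radialTerm s p (ENNReal.ofReal (min 1 (t ^ 2))) t := by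
        simp only [radialTerm_const_mul]
        exact lintegral_const_mul _ (measurable_radialTerm s p (by fun_prop))
    _ < ∞ := ENNReal.mul_lt_top (ENNReal.rpow_lt_top_of_nonneg hp'.le hK)
        (lintegral_radialTerm_min_lt_top hs0 hs2 hp)

/-- Dominated convergence to zero for lower integrals, without measurability. -/
lemma tendsto_lintegral_zero_of_le {α : Type*} [MeasurableSpace α] {μ : Measure α}
    {f : ℕ → α → ℝ≥0∞} {g : α → ℝ≥0∞} (hfg : ∀ j x, f j x ≤ g x) (hg : ∫⁻ x, g x ∂μ ≠ ∞)
    (h : ∀ᵐ x ∂μ, Filter.Tendsto (fun j => f j x) Filter.atTop (nhds 0)) :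
    Filter.Tendsto (fun j => ∫⁻ x, f j x ∂μ) Filter.atTop (nhds 0) := by
  choose k hkm hkf hk using fun j => exists_measurable_le_lintegral_eq μ (f j)
  simp only [hk]
  have h1 := tendsto_lintegral_of_dominated_convergence (μ := μ) (F := k) (f := fun _ => 0)
    (fun x => ⨆ j, k j x) hkm (fun j => ae_of_all _ fun x => le_iSup (fun j => k j x) j)
    (ne_top_of_le_ne_top hg (lintegral_mono fun x => iSup_le fun j => (hkf j x).trans (hfg j x)))
    (h.mono fun x hx => tendsto_of_tendsto_of_tendsto_of_le_of_le tendsto_const_nhds hx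
      (fun _ => zero_le) fun j => hkf j x)
  simpa using h1

end

section

variable {n : ℕ} {a : Fin n → ℝ}

/-! ### Normalized Gaussians -/

lemma wMeasure_pos {U : Set (Space n)} (hU : IsOpen U) (h : (U ∩ orthant n).Nonempty) :
    0 < wMeasure a U := by
  have hopen : IsOpen (orthant n) := by
    have : orthant n = ⋂ i, {x : Space n | 0 < x i} := by ext x; simp [orthant]
    rw [this]
    exact isOpen_iInter_of_finite fun i => isOpen_lt continuous_const (by fun_prop)
  have hac : volume.restrict (orthant n) ≪ wMeasure a := by
    refine withDensity_absolutelyContinuous' (measurable_weight a).ennreal_ofReal.aemeasurable ?_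
    refine (ae_restrict_mem measurableSet_orthant).mono fun x hx => ?_
    have : 0 < weight a x := Finset.prod_pos fun i _ => Real.rpow_pos_of_pos (hx i) _
    simpa using this
  rw [pos_iff_ne_zero]
  intro h0
  have h1 := hac h0
  rw [Measure.restrict_apply hU.measurableSet] at h1
  exact ((hU.inter hopen).measure_pos volume h).ne' h1

lemma wMeasure_ball_pos {r : ℝ} (hr : 0 < r) : 0 < wMeasure a (Metric.ball 0 r) := by
  refine wMeasure_pos Metric.isOpen_ball ?_
  set v : Space n := WithLp.toLp 2 fun _ => 1
  have hv : 0 < 1 + ‖v‖ := by positivity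
  refine ⟨(r / (1 + ‖v‖)) • v, ?_, fun i => ?_⟩
  · rw [mem_ball_zero_iff, norm_smul, Real.norm_of_nonneg (by positivity), div_mul_eq_mul_div,
      div_lt_iff₀ hv]
    nlinarith
  · simp only [PiLp.smul_apply, smul_eq_mul, v, mul_one]
    positivity

/-- The weighted integral of the Gaussian. -/
def gaussianMass (a : Fin n → ℝ) (c : ℝ) : ℝ := ∫ x, Real.exp (-c * ‖x‖ ^ 2) ∂(wMeasure a)

lemma integrable_gaussian (ha : ∀ i, 0 < a i) {c : ℝ} (hc : 0 < c) :
    Integrable (fun x : Space n => Real.exp (-c * ‖x‖ ^ 2)) (wMeasure a) :=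
  memLp_one_iff_integrable.1 (memLp_schwartz ha 1 (gaussian c hc))

/-- A lower bound for the normalizing constant: on the ball of radius `r` the Gaussian is at least
`exp (-c r²)`. -/
lemma le_gaussianMass (ha : ∀ i, 0 < a i) {c r : ℝ} (hc : 0 < c) :
    Real.exp (-c * r ^ 2) * (wMeasure a).real (Metric.ball 0 r) ≤ gaussianMass a c := by
  have hloc := isLocallyFiniteMeasure_wMeasure ha
  have hfin : wMeasure a (Metric.ball 0 r) ≠ ∞ := measure_ball_lt_top.ne
  calc _ = ∫ _ in Metric.ball (0 : Space n) r, Real.exp (-c * r ^ 2) ∂(wMeasure a) := by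
        rw [setIntegral_const, smul_eq_mul, mul_comm]
    _ ≤ ∫ x in Metric.ball (0 : Space n) r, Real.exp (-c * ‖x‖ ^ 2) ∂(wMeasure a) := by
        refine setIntegral_mono_on (integrableOn_const hfin) (integrable_gaussian ha hc).integrableOn
          measurableSet_ball fun x hx => ?_
        have h1 : ‖x‖ ≤ r := (mem_ball_zero_iff.1 hx).le
        have h2 : ‖x‖ ^ 2 ≤ r ^ 2 := pow_le_pow_left₀ (norm_nonneg _) h1 2
        rw [Real.exp_le_exp]
        nlinarith
    _ ≤ gaussianMass a c := setIntegral_le_integral (integrable_gaussian ha hc)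
        (ae_of_all _ fun x => (Real.exp_pos _).le)

lemma gaussianMass_pos (ha : ∀ i, 0 < a i) {c : ℝ} (hc : 0 < c) : 0 < gaussianMass a c := by
  have hloc := isLocallyFiniteMeasure_wMeasure ha
  refine lt_of_lt_of_le ?_ (le_gaussianMass ha (r := 1) hc)
  exact mul_pos (Real.exp_pos _) (ENNReal.toReal_pos (wMeasure_ball_pos one_pos).ne'
    measure_ball_lt_top.ne)

/-- The normalized Gaussian `exp (-(j+1)‖x‖²) / gaussianMass`. -/
def mollifier (a : Fin n → ℝ) (j : ℕ) : 𝓢(Space n, ℝ) :=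
  (gaussianMass a (j + 1))⁻¹ • gaussian (j + 1 : ℝ) (by positivity)

lemma mollifier_apply (j : ℕ) (x : Space n) :
    mollifier a j x = (gaussianMass a (j + 1))⁻¹ * Real.exp (-(j + 1) * ‖x‖ ^ 2) := rfl

lemma mollifier_nonneg (ha : ∀ i, 0 < a i) (j : ℕ) (x : Space n) : 0 ≤ mollifier a j x :=
  mul_nonneg (inv_nonneg.2 (gaussianMass_pos ha (by positivity)).le) (Real.exp_nonneg _)

lemma integrable_mollifier (ha : ∀ i, 0 < a i) (j : ℕ) :
    Integrable (mollifier a j) (wMeasure a) :=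
  memLp_one_iff_integrable.1 (memLp_schwartz ha 1 _)

/-- The probability measure with the normalized Gaussian as density. -/
def mollifierLaw (a : Fin n → ℝ) (j : ℕ) : Measure (Space n) :=
  (wMeasure a).withDensity fun y => ‖mollifier a j y‖ₑ

lemma mollifierLaw_apply (ha : ∀ i, 0 < a i) (j : ℕ) {s : Set (Space n)} (hs : MeasurableSet s) :
    mollifierLaw a j s = ENNReal.ofReal (∫ x in s, mollifier a j x ∂(wMeasure a)) := by
  unfold mollifierLaw
  rw [withDensity_apply _ hs, ofReal_integral_eq_lintegral_ofReal
    (integrable_mollifier ha j).integrableOn (ae_of_all _ (mollifier_nonneg ha j))]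
  simp only [Real.enorm_of_nonneg (mollifier_nonneg ha j _)]

lemma isProbabilityMeasure_mollifierLaw (ha : ∀ i, 0 < a i) (j : ℕ) :
    IsProbabilityMeasure (mollifierLaw a j) := ⟨by
  rw [mollifierLaw_apply ha j MeasurableSet.univ, Measure.restrict_univ]
  simp only [mollifier_apply]
  have h : gaussianMass a (j + 1) =
    ∫ x, Real.exp (-((j : ℝ) + 1) * ‖x‖ ^ 2) ∂(wMeasure a) := rfl
  rw [integral_const_mul, ← h, inv_mul_cancel₀ (gaussianMass_pos ha (by positivity)).ne',
    ENNReal.ofReal_one]⟩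

/-- The normalized Gaussians concentrate at the origin. -/
lemma tendsto_mollifierLaw (ha : ∀ i, 0 < a i) {r : ℝ} (hr : 0 < r) :
    Filter.Tendsto (fun j => mollifierLaw a j {t | r < ‖t‖}) Filter.atTop (nhds 0) := by
  have hloc := isLocallyFiniteMeasure_wMeasure ha
  set m := (wMeasure a).real (Metric.ball 0 (r / 2)) with hm
  have hm0 : 0 < m := ENNReal.toReal_pos (wMeasure_ball_pos (by positivity)).ne'
    measure_ball_lt_top.ne
  set I := gaussianMass a 1 with hI
  have hI0 : 0 < I := gaussianMass_pos ha one_pos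
  have hs : MeasurableSet {t : Space n | r < ‖t‖} := measurableSet_lt (by fun_prop) (by fun_prop)
  have hb : ∀ j : ℕ, mollifierLaw a j {t | r < ‖t‖} ≤
      ENNReal.ofReal (I / m * Real.exp (r ^ 2 / 4) * Real.exp (-(3 / 4 * r ^ 2)) ^ j) := fun j => by
    rw [mollifierLaw_apply ha j hs]
    refine ENNReal.ofReal_le_ofReal ?_
    have hc : (0 : ℝ) < j + 1 := by positivity
    have hM := gaussianMass_pos ha hc
    -- Outside the ball of radius `r` one factor `exp (-‖x‖²)` is kept for integrability.
    have h1 : ∫ x in {t : Space n | r < ‖t‖}, mollifier a j x ∂(wMeasure a) ≤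
        (gaussianMass a (j + 1))⁻¹ * Real.exp (-j * r ^ 2) * I := by
      calc _ ≤ ∫ x in {t : Space n | r < ‖t‖}, (gaussianMass a (j + 1))⁻¹ *
            Real.exp (-j * r ^ 2) * Real.exp (-1 * ‖x‖ ^ 2) ∂(wMeasure a) := by
            refine setIntegral_mono_on (integrable_mollifier ha j).integrableOn
              ((integrable_gaussian ha one_pos).const_mul _).integrableOn hs fun x hx => ?_
            rw [mollifier_apply, mul_assoc, ← Real.exp_add]
            gcongr
            have h2 : r ^ 2 ≤ ‖x‖ ^ 2 := pow_le_pow_left₀ hr.le (le_of_lt hx) 2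
            nlinarith [(Nat.cast_nonneg j : (0 : ℝ) ≤ j)]
        _ ≤ ∫ x, (gaussianMass a (j + 1))⁻¹ *
            Real.exp (-j * r ^ 2) * Real.exp (-1 * ‖x‖ ^ 2) ∂(wMeasure a) :=
            setIntegral_le_integral ((integrable_gaussian ha one_pos).const_mul _)
              (ae_of_all _ fun x => by positivity)
        _ = _ := integral_const_mul _ _
    refine h1.trans ?_
    have h3 := le_gaussianMass ha (r := r / 2) hc
    rw [← hm] at h3
    rw [← Real.exp_nat_mul, div_mul_eq_mul_div, div_mul_eq_mul_div, le_div_iff₀ hm0,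
      inv_mul_eq_div, div_mul_eq_mul_div, div_mul_eq_mul_div, div_le_iff₀ hM]
    calc Real.exp (-j * r ^ 2) * I * m = I * Real.exp (r ^ 2 / 4) *
          Real.exp (j * -(3 / 4 * r ^ 2)) * (Real.exp (-(j + 1) * (r / 2) ^ 2) * m) := by
          have h4 : Real.exp (-j * r ^ 2) = Real.exp (r ^ 2 / 4) *
              Real.exp (j * -(3 / 4 * r ^ 2)) * Real.exp (-(j + 1) * (r / 2) ^ 2) := by
            rw [← Real.exp_add, ← Real.exp_add]
            congr 1
            ring
          rw [h4]
          ring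
      _ ≤ _ := by gcongr
  have hlim : Filter.Tendsto (fun j : ℕ => ENNReal.ofReal (I / m * Real.exp (r ^ 2 / 4) *
      Real.exp (-(3 / 4 * r ^ 2)) ^ j)) Filter.atTop (nhds 0) := by
    rw [← ENNReal.ofReal_zero]
    refine ENNReal.tendsto_ofReal ?_
    have h := (tendsto_pow_atTop_nhds_zero_of_lt_one (Real.exp_nonneg (-(3 / 4 * r ^ 2)))
      (by rw [Real.exp_lt_one_iff]; nlinarith [sq_pos_of_pos hr])).const_mul
      (I / m * Real.exp (r ^ 2 / 4))
    simpa using h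
  exact tendsto_of_tendsto_of_tendsto_of_le_of_le tendsto_const_nhds hlim (fun _ => zero_le) hb

lemma mollifier_mem (j : ℕ) : mollifier a j ∈ evenSchwartz n :=
  mem_evenSchwartz_of_reflect fun i x => by
    rw [mollifier_apply, mollifier_apply]
    congr 3
    rw [EuclideanSpace.norm_sq_eq, EuclideanSpace.norm_sq_eq]
    refine Finset.sum_congr rfl fun k _ => ?_
    rw [reflect_apply]
    split_ifs <;> simp

lemma exists_mollifier_le (j : ℕ) : ∃ C, ∀ x, |mollifier a j x| ≤ C := by
  obtain ⟨C, _, hC⟩ := SchwartzMap.exists_one_add_pow_mul_le (mollifier a j) 0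
  exact ⟨C, fun x => by simpa using hC x⟩

lemma translation_const_mul (ha : ∀ i, 0 < a i) (κ : ℝ) (t : Space n) (f : Space n → ℝ)
    (x : Space n) : translation a t (fun y => κ * f y) x = κ * translation a t f x := by
  rw [translation_eq ha, translation_eq ha, integral_const_mul]

lemma exists_evenSchwartz_conv_mollifier (ha : ∀ i, 0 < a i) (j : ℕ) {f : Space n → ℝ}
    (hf : Continuous f) (hs : HasCompactSupport f) :
    ∃ φ ∈ evenSchwartz n, ⇑φ = conv a f (mollifier a j) := by
  obtain ⟨φ, hφ, h⟩ := exists_evenSchwartz_conv (c := j + 1) (by positivity) ha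
    (f := fun x => (gaussianMass a (j + 1))⁻¹ * f x) (hf.const_mul _) hs.mul_left
  refine ⟨φ, hφ, h.trans (funext fun x => ?_)⟩
  refine integral_congr_ae (ae_of_all _ fun y => ?_)
  have h1 : translation a x (mollifier a j) y = _ :=
    translation_const_mul ha (gaussianMass a (j + 1))⁻¹ x (gaussian (j + 1 : ℝ) (by positivity)) y
  simp only [h1]
  ring

end

section

variable {n : ℕ} {a : Fin n → ℝ}

/-! ### Density in `W^{1,p}` -/

/-- The Bessel-Laplacian of the normalized Gaussian. -/
def mollifierLaplace (a : Fin n → ℝ) (j : ℕ) (x : Space n) : ℝ :=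
  (gaussianMass a (j + 1))⁻¹ * gaussianLaplace a (j + 1) x

lemma measurable_mollifierLaplace (j : ℕ) : Measurable (mollifierLaplace a j) :=
  measurable_const.mul continuous_gaussianLaplace.measurable

/-- The Bessel translate of the normalized Gaussian is an even Schwartz function whose
Bessel-Laplacian is the translate of the Bessel-Laplacian. -/
lemma exists_translation_mollifier (ha : ∀ i, 0 < a i) (j : ℕ) (t : Space n) :
    ∃ φ ∈ evenSchwartz n, ⇑φ = translation a t (mollifier a j) ∧
      ∀ y ∈ orthant n, besselLaplace a φ y = translation a t (mollifierLaplace a j) y := by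
  have hc : (0 : ℝ) < j + 1 := by positivity
  set κ := (gaussianMass a (j + 1))⁻¹ with hκ
  have hcoe : ⇑(κ • gaussianTranslate hc ha t) = κ • translation a t (gaussian (j + 1 : ℝ) hc) := by
    rw [← coe_gaussianTranslate hc ha t]
    rfl
  have hcoe' : translation a t (mollifier a j) = κ • translation a t (gaussian (j + 1 : ℝ) hc) :=
    funext fun y => translation_const_mul ha κ t (gaussian (j + 1 : ℝ) hc) y
  refine ⟨κ • gaussianTranslate hc ha t, mem_evenSchwartz_of_reflect fun i x => ?_, ?_,
    fun y hy => ?_⟩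
  · rw [hcoe, ← hcoe', translation_reflect ha i x t (mollifier a j).continuous.measurable]
  · rw [hcoe, hcoe']
  · have h1 : translation a t (mollifierLaplace a j) y =
        κ * translation a t (gaussianLaplace a (j + 1)) y := translation_const_mul ha κ t _ y
    rw [h1, ← besselLaplace_translation_gaussian hc ha t hy, ← coe_gaussianTranslate hc ha t]
    unfold besselLaplace
    rw [Finset.mul_sum]
    refine Finset.sum_congr rfl fun i _ => ?_
    have h2 : ⇑(κ • gaussianTranslate hc ha t) = κ • ⇑(gaussianTranslate hc ha t) := rfl
    rw [h2, iteratedFDeriv_const_smul_apply ((gaussianTranslate hc ha t).contDiffAt 2),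
      fderiv_const_smul (gaussianTranslate hc ha t).differentiableAt]
    simp only [smul_apply, smul_eq_mul]
    ring

/-- Convolving the weak Bessel-Laplacian of `f` with the normalized Gaussian moves the operator to
the Gaussian: the translates of the Gaussian are test functions. -/
lemma conv_mollifier_eq (ha : ∀ i, 0 < a i) {p : ℝ≥0} {f g : Space n → ℝ}
    (h : IsBesselLaplace a p f g) (j : ℕ) (x : Space n) :
    conv a g (mollifier a j) x = conv a f (mollifierLaplace a j) x := by
  obtain ⟨φ, hφ, hcoe, hL⟩ := exists_translation_mollifier ha j x
  have h1 := h.2 φ hφ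
  unfold conv
  rw [← hcoe, h1]
  exact integral_congr_ae ((ae_mem_orthant a).mono fun y hy => by simp only [hL y hy])

lemma translation_zero (ha : ∀ i, 0 < a i) (f : Space n → ℝ) {y : Space n} (hy : y ∈ orthant n) :
    translation a 0 f y = f y := by
  have := isProbabilityMeasure_angles ha
  have h : ∀ θ, move y 0 θ = y := fun θ => by
    ext i
    simp [move, chord, Real.sqrt_sq (hy i).le]
  rw [translation_eq ha]
  simp [h]

lemma rapidDecay_mollifierLaplace (ha : ∀ i, 0 < a i) (j : ℕ) : RapidDecay (mollifierLaplace a j) := by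
  obtain ⟨φ, hφ, _, hL⟩ := exists_translation_mollifier ha j 0
  intro N
  obtain ⟨C, hC⟩ := rapidDecay_besselLaplace (a := a) hφ N
  refine ⟨C, fun x hx => ?_⟩
  have h := hC x hx
  rwa [hL x hx, translation_zero ha _ hx] at h

/-- The Bessel-Laplacian of a convolution with the normalized Gaussian falls on the Gaussian. By
duality the identity for the test function `ψ` reduces to `(Δ_a ψ) * η = ψ * Δ_a η`. -/
lemma isBesselLaplace_conv (ha : ∀ i, 0 < a i) {p : ℝ≥0} (hp : 1 ≤ p) {f : Space n → ℝ}
    (hf : Continuous f) (hs : HasCompactSupport f) (j : ℕ) :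
    IsBesselLaplace a p (conv a f (mollifier a j)) (conv a f (mollifierLaplace a j)) := by
  have hloc := isLocallyFiniteMeasure_wMeasure ha
  have hfi : Integrable f (wMeasure a) := hf.integrable_of_hasCompactSupport hs
  have hki := (rapidDecay_mollifierLaplace ha j).integrable ha (measurable_mollifierLaplace j)
  refine ⟨memLp_conv ha hp hf.measurable (hf.memLp_of_hasCompactSupport hs)
    (measurable_mollifierLaplace j) hki, fun ψ hψ => ?_⟩
  obtain ⟨A, hA⟩ := SchwartzMap.exists_one_add_pow_mul_le ψ 0
  obtain ⟨B, hB⟩ := rapidDecay_besselLaplace (a := a) hψ 0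
  -- The Bessel-Laplacian of the test function is only controlled on the orthant.
  set Lψ := (orthant n).indicator (besselLaplace a ψ) with hLψ
  have hLm : Measurable Lψ := (measurable_besselLaplace ψ).indicator measurableSet_orthant
  have hLb : ∀ x, |Lψ x| ≤ |B| := fun x => by
    by_cases hx : x ∈ orthant n
    · rw [hLψ, indicator_of_mem hx]
      have := hB x hx
      rw [pow_zero, one_mul] at this
      exact this.trans (le_abs_self B)
    · rw [hLψ, indicator_of_notMem hx, abs_zero]
      exact abs_nonneg B
  have hLae : ∀ᵐ x ∂(wMeasure a), besselLaplace a ψ x = Lψ x :=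
    (ae_mem_orthant a).mono fun x hx => by rw [hLψ, indicator_of_mem hx]
  rw [integral_conv_mul ha hf.measurable hfi (measurable_mollifierLaplace j) hki
    ψ.continuous.measurable (C := A) fun x => by simpa using hA.2 x]
  have h2 := integral_conv_mul ha hf.measurable hfi (mollifier a j).continuous.measurable
    (integrable_mollifier ha j) hLm hLb
  have h3 : ∫ x, conv a f (mollifier a j) x * besselLaplace a ψ x ∂(wMeasure a) =
      ∫ x, conv a f (mollifier a j) x * Lψ x ∂(wMeasure a) :=
    integral_congr_ae (hLae.mono fun x hx => by simp only [hx])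
  rw [h3, h2]
  refine integral_congr_ae (ae_of_all _ fun y => ?_)
  simp only
  rw [← conv_mollifier_eq ha (isBesselLaplace_evenSchwartz ha 1 hψ) j y]
  congr 1
  exact integral_congr_ae (hLae.mono fun x hx => by simp only [hx])

lemma IsBesselLaplace.congr {p : ℝ≥0} {f g f' g' : Space n → ℝ} (h : IsBesselLaplace a p f g)
    (hf : f =ᵐ[wMeasure a] f') (hg : g =ᵐ[wMeasure a] g') : IsBesselLaplace a p f' g' := by
  refine ⟨h.1.ae_eq hg, fun φ hφ => ?_⟩
  rw [← integral_congr_ae (hg.mono fun x hx => by simp only [hx] : (fun x => g x * φ x) =ᵐ[_] _),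
    h.2 φ hφ]
  exact integral_congr_ae (hf.mono fun x hx => by simp only [hx])

/-- Products of `p`-integrable functions with rapidly decaying ones are integrable. -/
lemma RapidDecay.integrable_mul (ha : ∀ i, 0 < a i) {p : ℝ≥0} (hp : 1 ≤ p) {f g : Space n → ℝ}
    (hf : MemLp f p (wMeasure a)) (hg : RapidDecay g) (hm : Measurable g) :
    Integrable (fun x => f x * g x) (wMeasure a) := by
  have hp' : (1 : ℝ≥0∞) ≤ p := by exact_mod_cast hp
  have : ENNReal.HolderConjugate p (ENNReal.conjExponent p) := ENNReal.HolderConjugate.conjExponent hp'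
  exact hf.integrable_mul (hg.memLp ha hm.aestronglyMeasurable (ENNReal.conjExponent p))

lemma IsBesselLaplace.sub (ha : ∀ i, 0 < a i) {p : ℝ≥0} (hp : 1 ≤ p) {f g f' g' : Space n → ℝ}
    (hf : MemLp f p (wMeasure a)) (hf' : MemLp f' p (wMeasure a))
    (h : IsBesselLaplace a p f g) (h' : IsBesselLaplace a p f' g') :
    IsBesselLaplace a p (fun x => f x - f' x) (fun x => g x - g' x) := by
  refine ⟨h.1.sub h'.1, fun φ hφ => ?_⟩
  have d1 := RapidDecay.of_schwartz φ
  have d2 := rapidDecay_besselLaplace (a := a) hφ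
  have m1 := φ.continuous.measurable
  have m2 := measurable_besselLaplace (a := a) φ
  simp only [sub_mul]
  rw [integral_sub (d1.integrable_mul ha hp h.1 m1) (d1.integrable_mul ha hp h'.1 m1),
    integral_sub (d2.integrable_mul ha hp hf m2) (d2.integrable_mul ha hp hf' m2), h.2 φ hφ,
    h'.2 φ hφ]

/-- Convolution with the normalized Gaussian is averaging against its law. -/
lemma conv_mollifier_ae_eq_avg (ha : ∀ i, 0 < a i) {p : ℝ≥0} (hp : 1 ≤ p) {f : Space n → ℝ}
    (hf : Measurable f) (hfp : MemLp f p (wMeasure a)) (j : ℕ) :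
    conv a f (mollifier a j) =ᵐ[wMeasure a] avg a (mollifierLaw a j) f :=
  (ae_lt_top_conv ha hp hf hfp (integrable_mollifier ha j)).mono fun _ hx =>
    conv_eq_avg ha hf (mollifier a j).continuous.measurable (mollifier_nonneg ha j) hx

/-- The error of the approximation by a convolution with a nearby function. -/
lemma eLpNorm_sub_conv_le (ha : ∀ i, 0 < a i) {p : ℝ≥0} (hp : 1 ≤ p) {f k h : Space n → ℝ}
    {u : Space n → ℝ} (hu : Measurable u)
    (hf : Measurable f) (hfp : MemLp f p (wMeasure a)) (hk : Measurable k)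
    (hkp : MemLp k p (wMeasure a)) (hh : Measurable h) (hi : Integrable h (wMeasure a)) :
    eLpNorm (fun x => u x - conv a k h x) p (wMeasure a) ≤
      eLpNorm (fun x => u x - conv a f h x) p (wMeasure a) +
        eLpNorm h 1 (wMeasure a) * eLpNorm (fun x => f x - k x) p (wMeasure a) := by
  have h1 := conv_sub_left ha hp hf hfp hk hkp hh hi
  have h2 := eLpNorm_conv_le ha hp (hf.sub hk) hh hi
  have m1 := measurable_conv ha hf hh
  have m2 : Measurable (conv a (fun x => f x - k x) h) := measurable_conv ha (hf.sub hk) hh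
  have h3 : eLpNorm (conv a (fun x => f x - k x) h) p (wMeasure a) ≤
    eLpNorm h 1 (wMeasure a) * eLpNorm (fun x => f x - k x) p (wMeasure a) := h2
  clear h2
  generalize conv a (fun x => f x - k x) h = D at *
  generalize conv a f h = P at *
  generalize conv a k h = Q at *
  have h4 : (fun x => u x - Q x) =ᵐ[wMeasure a] (fun x => u x - P x) + D :=
    h1.mono fun x hx => by
      simp only [Pi.add_apply, hx]
      ring
  rw [eLpNorm_congr_ae h4]
  refine (eLpNorm_add_le (hu.sub m1).aestronglyMeasurable m2.aestronglyMeasurable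
    (by exact_mod_cast hp)).trans ?_
  exact add_le_add le_rfl h3

lemma exists_continuous_mul_eLpNorm_sub_le (ha : ∀ i, 0 < a i) {p : ℝ≥0} {f : Space n → ℝ}
    (hfp : MemLp f p (wMeasure a)) {L ε : ℝ≥0∞} (hL : L ≠ ∞) (hε : ε ≠ 0) :
    ∃ k : Space n → ℝ, Continuous k ∧ HasCompactSupport k ∧
      L * eLpNorm (fun x => f x - k x) p (wMeasure a) ≤ ε := by
  have hloc := isLocallyFiniteMeasure_wMeasure ha
  have hδ : ε / (L + 1) ≠ 0 := ENNReal.div_ne_zero.2 ⟨hε, ENNReal.add_ne_top.2 ⟨hL, ENNReal.one_ne_top⟩⟩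
  obtain ⟨k, hks, hk, hkc, _⟩ := hfp.exists_hasCompactSupport_eLpNorm_sub_le ENNReal.coe_ne_top hδ
  refine ⟨k, hkc, hks, ?_⟩
  calc _ ≤ (L + 1) * (ε / (L + 1)) := by
        gcongr
        · exact le_self_add
        · exact hk
    _ ≤ ε := ENNReal.mul_div_le

lemma sobolev_density (ha : ∀ i, 0 < a i) {p : ℝ≥0} (hp : 1 ≤ p) {f : Space n → ℝ}
    (hf : f ∈ sobolev a p) {ε : ℝ≥0∞} (hε : ε ≠ 0) :
    ∃ φ ∈ evenSchwartz n, sobolevNorm a p (fun x => f x - φ x) ≤ 4 * ε := by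
  obtain ⟨hfp0, g0, hg0⟩ := hf
  have hloc := isLocallyFiniteMeasure_wMeasure ha
  have hp0 : (1 : ℝ) ≤ p := by exact_mod_cast hp
  -- Measurable representatives of `f` and of its Bessel-Laplacian.
  obtain ⟨f', hf'm, hff'⟩ := hfp0.1
  obtain ⟨g, hgm, hgg⟩ := hg0.1.1
  have hfm := hf'm.measurable
  have hgm := hgm.measurable
  have hfp := hfp0.ae_eq hff'
  have hL := hg0.congr hff' hgg
  have hprob := isProbabilityMeasure_mollifierLaw ha
  have t1 := tendsto_eLpNorm_sub_avg ha (μ := mollifierLaw a)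
    (fun r hr => tendsto_mollifierLaw ha hr) hp hfm hfp
  have t2 := tendsto_eLpNorm_sub_avg ha (μ := mollifierLaw a)
    (fun r hr => tendsto_mollifierLaw ha hr) hp hgm hL.1
  obtain ⟨j, hj1, hj2⟩ := ((t1.eventually_lt_const (pos_iff_ne_zero.2 hε)).and
    (t2.eventually_lt_const (pos_iff_ne_zero.2 hε))).exists
  set η := mollifier a j with hη
  set κ := mollifierLaplace a j with hκ
  have hηm : Measurable η := η.continuous.measurable
  have hηi : Integrable η (wMeasure a) := integrable_mollifier ha j
  have hκm : Measurable κ := measurable_mollifierLaplace j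
  have hκi : Integrable κ (wMeasure a) := (rapidDecay_mollifierLaplace ha j).integrable ha hκm
  obtain ⟨k, hkc, hks, hk⟩ := exists_continuous_mul_eLpNorm_sub_le ha hfp
    (L := eLpNorm η 1 (wMeasure a) + eLpNorm κ 1 (wMeasure a))
    (ENNReal.add_ne_top.2 ⟨(memLp_one_iff_integrable.2 hηi).2.ne,
      (memLp_one_iff_integrable.2 hκi).2.ne⟩) hε
  have hkp : MemLp k p (wMeasure a) := hkc.memLp_of_hasCompactSupport hks
  obtain ⟨φ, hφ, hφc⟩ := exists_evenSchwartz_conv_mollifier ha j hkc hks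
  refine ⟨φ, hφ, ?_⟩
  have hLφ : IsBesselLaplace a p φ (conv a k κ) := by
    rw [hφc]
    exact isBesselLaplace_conv ha hp hkc hks j
  have hsub := (hL.sub ha hp hfp (memLp_schwartz ha p φ) hLφ).congr
    (f' := fun x => f x - φ x) (g' := fun x => g x - conv a k κ x)
    (hff'.mono fun x hx => by simp only [hx]) (ae_eq_refl _)
  have e1 : eLpNorm (fun x => f x - φ x) p (wMeasure a) ≤ 2 * ε := by
    rw [eLpNorm_congr_ae (hff'.mono fun x hx => by simp only [hx] :
      (fun x => f x - φ x) =ᵐ[_] fun x => f' x - φ x), hφc, two_mul]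
    refine (eLpNorm_sub_conv_le ha hp hfm hfm hfp hkc.measurable hkp hηm hηi).trans
      (add_le_add ?_ (le_trans (by gcongr; exact le_self_add) hk))
    rw [eLpNorm_congr_ae ((conv_mollifier_ae_eq_avg ha hp hfm hfp j).mono fun x hx => by
      simp only [hη, hx] : (fun x => f' x - conv a f' η x) =ᵐ[_] fun x => f' x - avg a (mollifierLaw a j) f' x)]
    exact hj1.le
  have e2 : eLpNorm (fun x => g x - conv a k κ x) p (wMeasure a) ≤ 2 * ε := by
    rw [two_mul]
    refine (eLpNorm_sub_conv_le ha hp hgm hfm hfp hkc.measurable hkp hκm hκi).trans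
      (add_le_add ?_ (le_trans (by gcongr; exact le_add_self) hk))
    have h3 : ∀ x, conv a f' κ x = conv a g η x := fun x => (conv_mollifier_eq ha hL j x).symm
    simp only [h3]
    rw [eLpNorm_congr_ae ((conv_mollifier_ae_eq_avg ha hp hgm hL.1 j).mono fun x hx => by
      simp only [hη, hx] : (fun x => g x - conv a g η x) =ᵐ[_] fun x => g x - avg a (mollifierLaw a j) g x)]
    exact hj2.le
  calc sobolevNorm a p (fun x => f x - φ x) ≤ (eLpNorm (fun x => f x - φ x) p (wMeasure a) ^ (p : ℝ) +
        eLpNorm (fun x => g x - conv a k κ x) p (wMeasure a) ^ (p : ℝ)) ^ (1 / (p : ℝ)) :=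
        iInf₂_le _ hsub
    _ ≤ eLpNorm (fun x => f x - φ x) p (wMeasure a) +
        eLpNorm (fun x => g x - conv a k κ x) p (wMeasure a) :=
        ENNReal.rpow_add_rpow_le_add _ _ hp0
    _ ≤ 2 * ε + 2 * ε := add_le_add e1 e2
    _ = 4 * ε := by rw [← add_mul]; norm_num

end

section

variable {n : ℕ} {a : Fin n → ℝ}

/-! ### Density in the fractional space -/

lemma sdiff_congr_ae (ha : ∀ i, 0 < a i) (r : ℝ) {f g : Space n → ℝ}
    (h : f =ᵐ[wMeasure a] g) : sdiff a r f =ᵐ[wMeasure a] sdiff a r g := by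
  have hfin := isFiniteMeasure_sphereLaw ha r
  filter_upwards [h, avg_congr_ae ha (μ := sphereLaw a r) h] with x h1 h2
  rw [sdiff, sdiff, h1, h2]

/-- The spherical difference of the error of approximation by the convolution of `k` with the
normalized Gaussian: the first term is the mollification error of the spherical difference itself,
the second is controlled by the smoothness of the Gaussian. -/
lemma eLpNorm_sdiff_sub_conv_le (ha : ∀ i, 0 < a i) (r : ℝ) {p : ℝ≥0} (hp : 1 ≤ p)
    {f k : Space n → ℝ} (hf : Measurable f) (hfp : MemLp f p (wMeasure a)) (hk : Measurable k)
    (hkp : MemLp k p (wMeasure a)) (j : ℕ) :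
    eLpNorm (sdiff a r fun x => f x - conv a k (mollifier a j) x) p (wMeasure a) ≤
      eLpNorm (fun x => sdiff a r f x - avg a (mollifierLaw a j) (sdiff a r f) x) p (wMeasure a) +
        eLpNorm (sdiff a r (mollifier a j)) 1 (wMeasure a) *
          eLpNorm (fun x => f x - k x) p (wMeasure a) := by
  have hprob := isProbabilityMeasure_mollifierLaw ha j
  have hηm : Measurable (mollifier a j) := (mollifier a j).continuous.measurable
  have hηi := integrable_mollifier ha j
  obtain ⟨C, hC⟩ := exists_mollifier_le (a := a) j
  have hdk : Measurable fun x => f x - k x := hf.sub hk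
  have hdkp : MemLp (fun x => f x - k x) p (wMeasure a) := hfp.sub hkp
  have h1 := conv_sub_left ha hp hf hfp hk hkp hηm hηi
  have h2 := eLpNorm_sdiff_conv_le ha r hp hdk hdkp hηm hC hηi
  have h3 := conv_mollifier_ae_eq_avg ha hp hf hfp j
  have m1 : Measurable (conv a f (mollifier a j)) := measurable_conv ha hf hηm
  have m2 : Measurable (conv a k (mollifier a j)) := measurable_conv ha hk hηm
  have p1 : MemLp (conv a f (mollifier a j)) p (wMeasure a) := memLp_conv ha hp hf hfp hηm hηi
  have p2 : MemLp (conv a k (mollifier a j)) p (wMeasure a) := memLp_conv ha hp hk hkp hηm hηi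
  generalize conv a (fun x => f x - k x) (mollifier a j) = D at *
  generalize conv a f (mollifier a j) = P at *
  generalize conv a k (mollifier a j) = Q at *
  have h4 : sdiff a r P =ᵐ[wMeasure a] avg a (mollifierLaw a j) (sdiff a r f) :=
    (sdiff_congr_ae ha r h3).trans (sdiff_avg ha r hp hf hfp)
  have h5 : sdiff a r D =ᵐ[wMeasure a] fun x => sdiff a r P x - sdiff a r Q x :=
    (sdiff_congr_ae ha r h1).trans (sdiff_sub_ae ha r hp m1 p1 m2 p2)
  have h6 : (sdiff a r fun x => f x - Q x) =ᵐ[wMeasure a]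
      (fun x => sdiff a r f x - avg a (mollifierLaw a j) (sdiff a r f) x) + sdiff a r D := by
    filter_upwards [sdiff_sub_ae ha r hp hf hfp m2 p2, h4, h5] with x e1 e2 e3
    rw [e1, Pi.add_apply, e3, e2]
    ring
  have ms := measurable_sdiff ha r hf
  have hD : AEStronglyMeasurable (sdiff a r D) (wMeasure a) :=
    ((measurable_sdiff ha r m1).sub (measurable_sdiff ha r m2)).aestronglyMeasurable.congr h5.symm
  rw [eLpNorm_congr_ae h6]
  refine (eLpNorm_add_le (ms.sub (measurable_avg ms)).aestronglyMeasurable hD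
    (by exact_mod_cast hp)).trans ?_
  exact add_le_add le_rfl h2

lemma eLpNorm_sub_avg_le (ha : ∀ i, 0 < a i) {μ : Measure (Space n)} [IsProbabilityMeasure μ]
    {p : ℝ≥0} (hp : 1 ≤ p) {f : Space n → ℝ} (hf : Measurable f) :
    eLpNorm (fun x => f x - avg a μ f x) p (wMeasure a) ≤ 2 * eLpNorm f p (wMeasure a) := by
  have h := eLpNorm_avg_le (μ := μ) ha hp hf
  rw [measure_univ, one_mul] at h
  rw [two_mul]
  exact (eLpNorm_sub_le hf.aestronglyMeasurable (measurable_avg hf).aestronglyMeasurable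
    (by exact_mod_cast hp)).trans (add_le_add le_rfl h)

/-- The Gagliardo integral of the mollification errors of the spherical differences tends to zero. -/
lemma tendsto_lintegral_radialTerm_sub_avg (ha : ∀ i, 0 < a i) (s : ℝ) {p : ℝ≥0} (hp : 1 ≤ p)
    {f : Space n → ℝ} (hf : Measurable f) (hfp : MemLp f p (wMeasure a))
    (hfin : ∫⁻ t in Ioi (0 : ℝ), radialTerm s p (eLpNorm (sdiff a t f) p (wMeasure a)) t ≠ ∞) :
    Filter.Tendsto (fun j => ∫⁻ t in Ioi (0 : ℝ), radialTerm s p (eLpNorm (fun x =>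
      sdiff a t f x - avg a (mollifierLaw a j) (sdiff a t f) x) p (wMeasure a)) t)
      Filter.atTop (nhds 0) := by
  have hp' : (0 : ℝ) < p := lt_of_lt_of_le one_pos (by exact_mod_cast hp)
  have hprob := isProbabilityMeasure_mollifierLaw ha
  refine tendsto_lintegral_zero_of_le
    (g := fun t => radialTerm s p (2 * eLpNorm (sdiff a t f) p (wMeasure a)) t)
    (fun j t => radialTerm_mono s p (eLpNorm_sub_avg_le ha hp (measurable_sdiff ha t hf)) t) ?_ ?_
  · simp only [radialTerm_const_mul]
    rw [lintegral_const_mul' _ _ (ENNReal.rpow_ne_top_of_nonneg hp'.le (by simp))]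
    exact ENNReal.mul_ne_top (ENNReal.rpow_ne_top_of_nonneg hp'.le (by simp)) hfin
  · refine (ae_restrict_mem measurableSet_Ioi).mono fun t (ht : 0 < t) => ?_
    have h1 := tendsto_eLpNorm_sub_avg ha (μ := mollifierLaw a)
      (fun r hr => tendsto_mollifierLaw ha hr) hp (measurable_sdiff ha t hf)
      (memLp_sdiff ha t hp hf hfp)
    have h2 : radialTerm s p 1 t ≠ ∞ := by
      unfold radialTerm
      have h3 : ENNReal.ofReal (t ^ s) ≠ 0 := by simpa using Real.rpow_pos_of_pos ht s
      have h4 : ENNReal.ofReal t ≠ 0 := by simpa using ht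
      exact ENNReal.div_ne_top (ENNReal.rpow_ne_top_of_nonneg hp'.le
        (ENNReal.div_ne_top (by simp) h3)) h4
    have h3 : ∀ A, radialTerm s p A t = A ^ (p : ℝ) * radialTerm s p 1 t := fun A => by
      rw [← radialTerm_const_mul, mul_one]
    have h4 := ENNReal.Tendsto.mul_const (h1.ennrpow_const (p : ℝ)) (Or.inr h2)
    rw [ENNReal.zero_rpow_of_pos hp', zero_mul] at h4
    exact h4.congr fun j => (h3 _).symm

/-- The Gagliardo integral of the error of the approximation by the convolution of `k` with the
normalized Gaussian. The first integral is the mollification error, the second term the effect of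
replacing `f` by `k`; `hK` is the second order smoothness of the Gaussian. -/
lemma lintegral_radialTerm_sub_conv_le (ha : ∀ i, 0 < a i) (s : ℝ) {p : ℝ≥0} (hp : 1 ≤ p)
    {f k : Space n → ℝ} (hf : Measurable f) (hfp : MemLp f p (wMeasure a)) (hk : Measurable k)
    (hkp : MemLp k p (wMeasure a)) (j : ℕ) {K : ℝ≥0∞}
    (hK : ∀ r : ℝ, 0 < r → eLpNorm (sdiff a r (mollifier a j)) 1 (wMeasure a) ≤
      K * ENNReal.ofReal (min 1 (r ^ 2))) :
    ∫⁻ t in Ioi (0 : ℝ), radialTerm s p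
        (eLpNorm (sdiff a t fun x => f x - conv a k (mollifier a j) x) p (wMeasure a)) t ≤
      2 ^ ((p : ℝ) - 1) * (∫⁻ t in Ioi (0 : ℝ), radialTerm s p (eLpNorm (fun x =>
        sdiff a t f x - avg a (mollifierLaw a j) (sdiff a t f) x) p (wMeasure a)) t) +
      2 ^ ((p : ℝ) - 1) * ((K * eLpNorm (fun x => f x - k x) p (wMeasure a)) ^ (p : ℝ) *
        ∫⁻ t in Ioi (0 : ℝ), radialTerm s p (ENNReal.ofReal (min 1 (t ^ 2))) t) := by
  have hp' : (1 : ℝ) ≤ p := by exact_mod_cast hp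
  have h2 : (2 : ℝ≥0∞) ^ ((p : ℝ) - 1) ≠ ∞ :=
    ENNReal.rpow_ne_top_of_nonneg (by linarith) (by simp)
  have hm : Measurable fun t => radialTerm s p (ENNReal.ofReal (min 1 (t ^ 2))) t :=
    measurable_radialTerm s p (by fun_prop)
  rw [← lintegral_const_mul' _ _ h2, ← lintegral_const_mul _ hm, ← lintegral_const_mul' _ _ h2,
    ← lintegral_add_right _ ((hm.const_mul _).const_mul _)]
  refine setLIntegral_mono' measurableSet_Ioi fun t ht => ?_
  rw [← radialTerm_const_mul]
  refine (radialTerm_mono s p ((eLpNorm_sdiff_sub_conv_le ha t hp hf hfp hk hkp j).trans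
    (add_le_add le_rfl ?_)) t).trans (radialTerm_add_le s hp _ _ t)
  calc _ ≤ K * ENNReal.ofReal (min 1 (t ^ 2)) * eLpNorm (fun x => f x - k x) p (wMeasure a) := by
        gcongr
        exact hK t ht
    _ = _ := by ring

lemma fracSobolev_density (ha : ∀ i, 0 < a i) {s : ℝ} (hs0 : 0 < s) (hs2 : s < 2) {p : ℝ≥0}
    (hp : 1 ≤ p) {f : Space n → ℝ} (hf : f ∈ fracSobolev a s p) {ε : ℝ≥0∞} (hε : ε ≠ 0)
    (hεt : ε ≠ ∞) :
    ∃ φ ∈ evenSchwartz n, fracNorm a s p (fun x => f x - φ x) < ε := by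
  obtain ⟨hfp0, hfin0⟩ := hf
  have hloc := isLocallyFiniteMeasure_wMeasure ha
  have hp1 : (1 : ℝ) ≤ p := by exact_mod_cast hp
  have hp' : (0 : ℝ) < p := by linarith
  obtain ⟨f', hf'm, hff'⟩ := hfp0.1
  have hfm := hf'm.measurable
  have hfp := hfp0.ae_eq hff'
  have hfin : ∫⁻ t in Ioi (0 : ℝ), radialTerm s p (eLpNorm (sdiff a t f') p (wMeasure a)) t ≠ ∞ := by
    rw [fracNorm_eq hp, ENNReal.rpow_lt_top_iff_of_pos (by positivity)] at hfin0
    have h1 := (ENNReal.add_lt_top.1 hfin0).2.ne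
    have h2 : ∀ t, eLpNorm (sdiff a t f') p (wMeasure a) =
        eLpNorm (sphericalDiff a t f) p (wMeasure a) := fun t =>
      eLpNorm_congr_ae ((sphericalDiff_congr_ae ha t hff').trans
        (sphericalDiff_ae_eq ha t hp hfm hfp)).symm
    simpa only [h2] using h1
  have hprob := isProbabilityMeasure_mollifierLaw ha
  set c : ℝ≥0∞ := 2 ^ ((p : ℝ) - 1) with hc
  have hctop : c ≠ ∞ := ENNReal.rpow_ne_top_of_nonneg (by linarith) (by simp)
  -- First the scale of the mollifier is chosen, then the compactly supported approximation.
  have t1 := (tendsto_eLpNorm_sub_avg ha (μ := mollifierLaw a)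
    (fun r hr => tendsto_mollifierLaw ha hr) hp hfm hfp)
  have t2 := ENNReal.Tendsto.const_mul
    (tendsto_lintegral_radialTerm_sub_avg ha s hp hfm hfp hfin) (Or.inr hctop)
  rw [mul_zero] at t2
  set I := ∫⁻ t in Ioi (0 : ℝ), radialTerm s p (ENNReal.ofReal (min 1 (t ^ 2))) t with hI
  have hItop : I ≠ ∞ := (lintegral_radialTerm_min_lt_top hs0 hs2 hp).ne
  set E := ε ^ (p : ℝ) with hE
  have hE0 : E ≠ 0 := by simp [hE, ENNReal.rpow_eq_zero_iff, hε, hεt]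
  have hEt : E ≠ ∞ := ENNReal.rpow_ne_top_of_nonneg hp'.le hεt
  have hE4 : E / 4 ≠ 0 := ENNReal.div_ne_zero.2 ⟨hE0, by simp⟩
  set δ := (E / 4) ^ (p : ℝ)⁻¹ with hδ
  have hδp : δ ^ (p : ℝ) = E / 4 := ENNReal.rpow_inv_rpow hp'.ne' _
  have hδ0 : δ / 2 ≠ 0 := by
    refine ENNReal.div_ne_zero.2 ⟨fun h => hE4 ?_, by simp⟩
    rw [← hδp, h, ENNReal.zero_rpow_of_pos hp']
  obtain ⟨j, hj1, hj2⟩ := ((t1.eventually_lt_const (pos_iff_ne_zero.2 hδ0)).and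
    (t2.eventually_lt_const (pos_iff_ne_zero.2 hE4))).exists
  obtain ⟨K, hK, hKr⟩ := exists_eLpNorm_sphericalDiff_le (p := 1) ha le_rfl (mollifier_mem (a := a) j)
  have hηm : Measurable (mollifier a j) := (mollifier a j).continuous.measurable
  have hηi := integrable_mollifier ha j
  have hK' : ∀ r : ℝ, 0 < r → eLpNorm (sdiff a r (mollifier a j)) 1 (wMeasure a) ≤
      K * ENNReal.ofReal (min 1 (r ^ 2)) := fun r hr => by
    rw [← eLpNorm_congr_ae (sphericalDiff_ae_eq ha r (p := 1) le_rfl hηm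
      (memLp_schwartz ha _ (mollifier a j)))]
    exact hKr r hr
  set L := c ^ (p : ℝ)⁻¹ * K * I ^ (p : ℝ)⁻¹ with hL
  have hLt : L ≠ ∞ := ENNReal.mul_ne_top (ENNReal.mul_ne_top
    (ENNReal.rpow_ne_top_of_nonneg (by positivity) hctop) hK)
    (ENNReal.rpow_ne_top_of_nonneg (by positivity) hItop)
  obtain ⟨k, hkc, hks, hk⟩ := exists_continuous_mul_eLpNorm_sub_le ha hfp
    (L := eLpNorm (mollifier a j) 1 (wMeasure a) + L)
    (ENNReal.add_ne_top.2 ⟨(memLp_one_iff_integrable.2 hηi).2.ne, hLt⟩) hδ0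
  have hkp : MemLp k p (wMeasure a) := hkc.memLp_of_hasCompactSupport hks
  obtain ⟨φ, hφ, hφc⟩ := exists_evenSchwartz_conv_mollifier ha j hkc hks
  refine ⟨φ, hφ, ?_⟩
  have hfφ : (fun x => f x - φ x) =ᵐ[wMeasure a] fun x => f' x - conv a k (mollifier a j) x := by
    rw [hφc]
    exact hff'.mono fun x hx => by simp only [hx]
  have hcm : Measurable (conv a k (mollifier a j)) := measurable_conv ha hkc.measurable hηm
  have hcp : MemLp (conv a k (mollifier a j)) p (wMeasure a) :=
    memLp_conv ha hp hkc.measurable hkp hηm hηi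
  have e1 : eLpNorm (fun x => f x - φ x) p (wMeasure a) ^ (p : ℝ) ≤ E / 4 := by
    rw [eLpNorm_congr_ae hfφ, ← hδp]
    gcongr
    rw [← ENNReal.add_halves δ]
    refine (eLpNorm_sub_conv_le ha hp hfm hfm hfp hkc.measurable hkp hηm hηi).trans
      (add_le_add ?_ (le_trans (by gcongr; exact le_self_add) hk))
    rw [eLpNorm_congr_ae ((conv_mollifier_ae_eq_avg ha hp hfm hfp j).mono fun x hx => by
      simp only [hx] : (fun x => f' x - conv a f' (mollifier a j) x) =ᵐ[_]
        fun x => f' x - avg a (mollifierLaw a j) f' x)]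
    exact hj1.le
  have e2 : ∫⁻ t in Ioi (0 : ℝ), radialTerm s p
      (eLpNorm (sphericalDiff a t fun x => f x - φ x) p (wMeasure a)) t ≤ E / 4 + E / 4 := by
    have h2 : ∀ t, eLpNorm (sphericalDiff a t fun x => f x - φ x) p (wMeasure a) =
        eLpNorm (sdiff a t fun x => f' x - conv a k (mollifier a j) x) p (wMeasure a) := fun t =>
      eLpNorm_congr_ae ((sphericalDiff_congr_ae ha t hfφ).trans
        (sphericalDiff_ae_eq ha t hp (hfm.sub hcm) (hfp.sub hcp)))
    simp only [h2]
    refine (lintegral_radialTerm_sub_conv_le ha s hp hfm hfp hkc.measurable hkp j hK').trans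
      (add_le_add hj2.le ?_)
    have h3 : c * ((K * eLpNorm (fun x => f' x - k x) p (wMeasure a)) ^ (p : ℝ) * I) =
        (L * eLpNorm (fun x => f' x - k x) p (wMeasure a)) ^ (p : ℝ) := by
      rw [hL]
      simp only [ENNReal.mul_rpow_of_nonneg _ _ hp'.le, ENNReal.rpow_inv_rpow hp'.ne']
      ring
    rw [h3, ← hδp]
    gcongr
    calc _ ≤ (eLpNorm (mollifier a j) 1 (wMeasure a) + L) *
          eLpNorm (fun x => f' x - k x) p (wMeasure a) := by gcongr; exact le_add_self
      _ ≤ δ / 2 := hk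
      _ ≤ δ := ENNReal.half_le_self
  have hεE : ε = E ^ (1 / (p : ℝ)) := by rw [hE, one_div, ENNReal.rpow_rpow_inv hp'.ne']
  rw [fracNorm_eq hp, hεE]
  refine ENNReal.rpow_lt_rpow ((add_le_add e1 e2).trans_lt ?_) (by positivity)
  have h4 : E = (E / 4 + (E / 4 + E / 4)) + E / 4 := by
    have h5 : E / 4 + E / 4 + (E / 4 + E / 4) = E := by
      have h6 : E / 4 = E / 2 / 2 := by
        rw [ENNReal.div_eq_inv_mul, ENNReal.div_eq_inv_mul, ENNReal.div_eq_inv_mul, ← mul_assoc,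
          ← ENNReal.mul_inv (by simp) (by simp)]
        norm_num
      rw [h6, ENNReal.add_halves, ENNReal.add_halves]
    nth_rewrite 1 [← h5]
    ring
  have h7 : E / 4 ≠ ∞ := ENNReal.div_ne_top hEt (by simp)
  nth_rewrite 4 [h4]
  exact ENNReal.lt_add_right (by simp [h7]) hE4

end

end BesselSobolev

end

theorem mainTheorem5 (n : ℕ) (hn : 1 ≤ n) (a : Fin n → ℝ) (ha : ∀ i, 0 < a i)
    (p : ℝ≥0) (hp : 1 ≤ p) (s : ℝ) (hs0 : 0 < s / 2) (hs1 : s / 2 < 1) :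
    ((∀ φ ∈ BesselSobolev.evenSchwartz n, (φ : BesselSobolev.Space n → ℝ) ∈
        BesselSobolev.sobolev a p) ∧
      ∀ f ∈ BesselSobolev.sobolev a p, ∀ ε : ℝ, 0 < ε →
        ∃ φ ∈ BesselSobolev.evenSchwartz n,
          BesselSobolev.sobolevNorm a p (fun x => f x - φ x) < ENNReal.ofReal ε) ∧
    ((∀ φ ∈ BesselSobolev.evenSchwartz n, (φ : BesselSobolev.Space n → ℝ) ∈
        BesselSobolev.fracSobolev a s p) ∧
      ∀ f ∈ BesselSobolev.fracSobolev a s p, ∀ ε : ℝ, 0 < ε →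
        ∃ φ ∈ BesselSobolev.evenSchwartz n,
          BesselSobolev.fracNorm a s p (fun x => f x - φ x) < ENNReal.ofReal ε) := by
  have hs : 0 < s := by linarith
  have hs2 : s < 2 := by linarith
  refine ⟨⟨fun φ hφ => BesselSobolev.evenSchwartz_subset_sobolev ha p hφ, fun f hf ε hε => ?_⟩,
    fun φ hφ => BesselSobolev.evenSchwartz_subset_fracSobolev ha hs hs2 hp hφ, fun f hf ε hε =>
      BesselSobolev.fracSobolev_density ha hs hs2 hp hf (ENNReal.ofReal_pos.2 hε).ne'
        ENNReal.ofReal_ne_top⟩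
  obtain ⟨φ, hφ, h⟩ := BesselSobolev.sobolev_density ha hp hf (ε := ENNReal.ofReal (ε / 8))
    (ENNReal.ofReal_pos.2 (by positivity)).ne'
  refine ⟨φ, hφ, h.trans_lt ?_⟩
  have h4 : (4 : ℝ≥0∞) = ENNReal.ofReal 4 := by simp
  rw [h4, ← ENNReal.ofReal_mul (by norm_num)]
  exact (ENNReal.ofReal_lt_ofReal_iff hε).2 (by linarith)
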